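/- A $3$-graph $H$ consists of a finite vertex set $V(H)$ and a set $E(H)$ of $3$-element subsets of $V(H)$. The minimum codegree $\delta(H)$ is the minimum, over all $2$-element sets $f \subseteq V(H)$, of the number of edges $e \in E(H)$ with $f \subseteq e$. Let $T$ be the generalised triangle, that is, the $3$-graph with five vertices $a,b,c,d,e$ and three edges $abc$, $abd$, $cde$. A perfect $T$-tiling in $H$ is a set of pairwise vertex-disjoint subgraphs of $H$, each isomorphic to $T$, such that every vertex of $H$ lies in one of them. **Theorem.** There exists $n_0 \in \mathbb{N}$ such that for every $n \ge n_0$ with $5 \mid n$, every $3$-graph $H$ on $n$ vertices with $\delta(H) \ge 2n/5$ admits a perfect $T$-tiling. Moreover, the codegree condition is best possible: for every positive integer $n$ with $5 \mid n$ and all disjoint sets $A$ and $B$ with $|A| = 2n/5 - 1$ and $|B| = 3n/5 + 1$, the $3$-graph $H_{\mathrm{ext}}$ on the $n$ vertices $A \cup B$ whose edges are all triples of vertices that intersect $A$ has $\delta(H_{\mathrm{ext}}) = 2n/5 - 1$ and admits no perfect $T$-tiling. -/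

import Mathlib

namespace Hypergraph

/-- `H` is `k`-uniform (a `k`-graph): every edge is a set of exactly `k` vertices. -/
def IsUniform {α : Type*} (H : Hypergraph α) (k : ℕ) : Prop :=
  ∀ e ∈ H.edgeSet, e.encard = k

/-- The degree of a set `f` of vertices: the number of edges containing `f`.
It is the honest count whenever `H` has finitely many vertices. -/
noncomputable def deg {α : Type*} (H : Hypergraph α) (f : Set α) : ℕ :=
  {e ∈ H.edgeSet | f ⊆ e}.ncard

/-- The minimum codegree of a `k`-graph `H`: the minimum of `deg f` over all sets `f` of
`k - 1` vertices of `H`. -/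
noncomputable def minCodegree {α : Type*} (H : Hypergraph α) (k : ℕ) : ℕ :=
  sInf {d | ∃ f ⊆ H.vertexSet, f.encard + 1 = k ∧ H.deg f = d}

/-- `C` is a copy of `F` in `H`: a subgraph of `H` that is isomorphic to `F`. -/
def IsCopy {α β : Type*} (F : Hypergraph β) (H C : Hypergraph α) : Prop :=
  C.vertexSet ⊆ H.vertexSet ∧ C.edgeSet ⊆ H.edgeSet ∧
    ∃ φ : β → α, Set.InjOn φ F.vertexSet ∧ C = F.image φ

/-- An `F`-tiling in `H`: a set of pairwise vertex-disjoint copies of `F` in `H`. -/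
def IsTiling {α β : Type*} (F : Hypergraph β) (H : Hypergraph α)
    (𝒯 : Set (Hypergraph α)) : Prop :=
  (∀ C ∈ 𝒯, IsCopy F H C) ∧ 𝒯.Pairwise fun C D => Disjoint C.vertexSet D.vertexSet

/-- An `F`-tiling in `H` is perfect if every vertex of `H` lies in some member of the tiling. -/
def IsPerfectTiling {α β : Type*} (F : Hypergraph β) (H : Hypergraph α)
    (𝒯 : Set (Hypergraph α)) : Prop :=
  IsTiling F H 𝒯 ∧ ∀ v ∈ H.vertexSet, ∃ C ∈ 𝒯, v ∈ C.vertexSet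

/-- The generalised triangle: vertices `a, b, c, d, e = 0, 1, 2, 3, 4` and edges
`abc`, `abd`, `cde`. -/
def genTriangle : Hypergraph (Fin 5) where
  vertexSet := Set.univ
  edgeSet := {{0, 1, 2}, {0, 1, 3}, {2, 3, 4}}
  subset_vertexSet_of_mem_edgeSet' := fun _ _ => Set.subset_univ _

/-- The 3-graph with vertex set `A ∪ B` whose edges are all triples of vertices meeting `A`. -/
def extremal {α : Type*} (A B : Set α) : Hypergraph α where
  vertexSet := A ∪ B
  edgeSet := {e | e ⊆ A ∪ B ∧ e.encard = 3 ∧ (e ∩ A).Nonempty}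
  subset_vertexSet_of_mem_edgeSet' := fun _ he => he.1

end Hypergraph

/-! ### Three-graphs, generalised triangles and tileable vertex sets. -/

open scoped Classical
open Finset

universe u

/-! Call a copy of the generalised triangle a tile. In the extremal example every tile has at least
two vertices in `A`, so weight `1/2` on `A` is a fractional cover of the tiles of total weight just
below `n/5`. The proof shows that this is essentially the only obstruction. It distinguishes whether
some pair `x, y` has a neighbourhood of size close to `2n/5` whose complement spans few edges (the
extremal case) or not.

In the non-extremal case the tiling comes from absorption. The covering half rests on
`extremal_of_cover`: a fractional cover of weight at most `|U|/5` that vanishes on three vertices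
must look like weight `1/2` on the neighbourhood of a pair, and then `U` is near-extremal.
Subtracting the third smallest value from an arbitrary weighting and rescaling turns this into
`exists_light_tile`: every weighting of a non-extremal `U` admits a tile of about average weight.
Light tiles are then removed one at a time, the weighting being the gradient of an exponential
potential that records all codegrees and all edge counts outside neighbourhoods. The potential grows
so little that the remainder keeps its codegree and stays non-extremal until almost nothing is left
(`potential_step`, `exists_almost_til_of_light`, `exists_almost_til`).

The absorbing half needs, for any two vertices `l, x`, many `14`-sets that become tileable with
either of them (`card_switchers_fourteen_ge`). Among any three vertices two have largely overlapping
links, which already gives `4`-sets with this property. Any other pair is joined by a chain of two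
or three such steps. The three-step case asks for many reachable pairs between two large classes and
is settled by `card_reachable_ge`. Switchers combine into absorbers for `5`-sets, and a derandomised
greedy choice of disjoint absorbers gives `exists_absorbing_set`.

In the extremal case `exists_split` produces a partition `A, B` in which almost all triples of type
`ABB` are edges. A few tiles with three or one vertices in `A` correct the ratio `|A| : |B|` to `2 :
3`, further tiles cover the atypical vertices of `A`, and the rest is five almost complete classes,
tiled by an exchange argument (`exists_perms_of_dense`, `til_of_dense_parts`). The exact value
`2n/5` matters in `exists_tile_one`: when `|A|` falls short by `k`, every pair in `B` has at least
`k` neighbours in `B`.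

For sharpness, a perfect tiling of the extremal graph would have `n/5` tiles with at least two
vertices each in a set of `2n/5 - 1` vertices. -/

/-- A `3`-graph on the vertex type `V`, given by its symmetric irreflexive adjacency relation. -/
structure TriGraph (V : Type u) where
  /-- `adj x y z` says that `{x, y, z}` is an edge. -/
  adj : V → V → V → Prop
  swap12 : ∀ {x y z}, adj x y z → adj y x z
  swap23 : ∀ {x y z}, adj x y z → adj x z y
  ne12 : ∀ {x y z}, adj x y z → x ≠ y

namespace TriGraph

variable {V : Type u} (G : TriGraph V)

theorem rot {G : TriGraph V} {x y z : V} (h : G.adj x y z) : G.adj y z x :=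
  G.swap23 (G.swap12 h)

theorem rot' {G : TriGraph V} {x y z : V} (h : G.adj x y z) : G.adj z x y :=
  G.swap12 (G.swap23 h)

theorem ne23 {G : TriGraph V} {x y z : V} (h : G.adj x y z) : y ≠ z := G.ne12 (rot h)

theorem ne13 {G : TriGraph V} {x y z : V} (h : G.adj x y z) : x ≠ z := G.ne12 (G.swap23 h)

/-- The vertices `a, b, c, d, e` span a generalised triangle with edges `abc`, `abd`, `cde`. -/
def IsT (a b c d e : V) : Prop :=
  G.adj a b c ∧ G.adj a b d ∧ G.adj c d e ∧ e ≠ a ∧ e ≠ b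

/-- A set of five vertices spanning a generalised triangle. -/
def TSet (X : Finset V) : Prop :=
  ∃ a b c d e, G.IsT a b c d e ∧ X = {a, b, c, d, e}

/-- The ordered edges inside the vertex set `S`. -/
noncomputable def tri (S : Finset V) : Finset (V × V × V) :=
  (S ×ˢ S ×ˢ S).filter fun t => G.adj t.1 t.2.1 t.2.2

/-- A set of vertices that can be partitioned into generalised triangles. -/
inductive Til : Finset V → Prop
  | empty : Til ∅
  | add {X A : Finset V} : G.TSet X → Til A → Disjoint X A → Til (X ∪ A)

variable {G}

@[simp] theorem mem_tri {S : Finset V} {t : V × V × V} :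
    t ∈ G.tri S ↔ (t.1 ∈ S ∧ t.2.1 ∈ S ∧ t.2.2 ∈ S) ∧ G.adj t.1 t.2.1 t.2.2 := by
  simp [tri, and_assoc]

/-- Every edge has distinct vertices, so the three edges give all the inequalities except `e ≠ a`
and `e ≠ b`; this is why `IsT` lists just these two. -/
theorem IsT.card {a b c d e : V} (h : G.IsT a b c d e) : ({a, b, c, d, e} : Finset V).card = 5 := by
  obtain ⟨h1, h2, h3, h4, h5⟩ := h
  have := G.ne12 h1; have := ne23 h1; have := ne13 h1; have := ne23 h2; have := ne13 h2
  have := G.ne12 h3; have := ne23 h3; have := ne13 h3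
  rw [card_insert_of_notMem, card_insert_of_notMem, card_insert_of_notMem, card_insert_of_notMem,
    card_singleton] <;> simp <;> grind

theorem IsT.sum {a b c d e : V} (h : G.IsT a b c d e) (w : V → ℝ) :
    ∑ v ∈ ({a, b, c, d, e} : Finset V), w v = w a + w b + w c + w d + w e := by
  obtain ⟨h1, h2, h3, h4, h5⟩ := h
  have := G.ne12 h1; have := ne23 h1; have := ne13 h1; have := ne23 h2; have := ne13 h2
  have := G.ne12 h3; have := ne23 h3; have := ne13 h3
  rw [sum_insert, sum_insert, sum_insert, sum_insert, sum_singleton]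
  · ring
  all_goals (simp; grind)

theorem TSet.card {X : Finset V} (h : G.TSet X) : X.card = 5 := by
  obtain ⟨a, b, c, d, e, h, rfl⟩ := h
  exact h.card

theorem TSet.til {X : Finset V} (h : G.TSet X) : G.Til X := by
  simpa using Til.add h Til.empty (disjoint_empty_right X)

theorem Til.union {A B : Finset V} (hA : G.Til A) (hB : G.Til B) (h : Disjoint A B) :
    G.Til (A ∪ B) := by
  induction hA with
  | empty => simpa using hB
  | @add X A hX hA hd ih =>
    rw [disjoint_union_left] at h
    rw [union_assoc]
    exact Til.add hX (ih h.2) (disjoint_union_right.2 ⟨hd, h.1⟩)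

theorem Til.dvd_card {A : Finset V} (hA : G.Til A) : 5 ∣ A.card := by
  induction hA with
  | empty => simp
  | add hX _ hd ih =>
    rw [card_union_of_disjoint hd, hX.card]
    exact Dvd.dvd.add (dvd_refl 5) ih

theorem Til.exists_partition {A : Finset V} (hA : G.Til A) :
    ∃ Q : Finset (Finset V), (∀ X ∈ Q, G.TSet X) ∧
      (∀ X ∈ Q, ∀ Y ∈ Q, X ≠ Y → Disjoint X Y) ∧ (∀ X ∈ Q, X ⊆ A) ∧
      ∀ v ∈ A, ∃ X ∈ Q, v ∈ X := by
  induction hA with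
  | empty => exact ⟨∅, by simp, by simp, by simp, by simp⟩
  | @add X A hX hA hd ih =>
    obtain ⟨Q, h1, h2, h3, h4⟩ := ih
    have key : ∀ Y ∈ Q, Disjoint X Y := fun Y hY =>
      disjoint_of_subset_right (h3 Y hY) hd
    refine ⟨insert X Q, ?_, ?_, ?_, ?_⟩
    · intro Y hY
      rcases mem_insert.1 hY with rfl | hY
      · exact hX
      · exact h1 Y hY
    · intro Y hY Z hZ hne
      rcases mem_insert.1 hY with rfl | hY' <;> rcases mem_insert.1 hZ with rfl | hZ'
      · exact absurd rfl hne
      · exact key Z hZ'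
      · exact (key Y hY').symm
      · exact h2 Y hY' Z hZ' hne
    · intro Y hY
      rcases mem_insert.1 hY with rfl | hY
      · exact subset_union_left
      · exact (h3 Y hY).trans subset_union_right
    · intro v hv
      rcases mem_union.1 hv with hv | hv
      · exact ⟨X, mem_insert_self _ _, hv⟩
      · obtain ⟨Y, hY, hvY⟩ := h4 v hv
        exact ⟨Y, mem_insert_of_mem hY, hvY⟩

variable [Fintype V] (G)

/-- The vertices forming an edge together with `x` and `y`. -/
noncomputable def nb (x y : V) : Finset V := univ.filter (G.adj x y)

variable {G}

@[simp] theorem mem_nb {x y z : V} : z ∈ G.nb x y ↔ G.adj x y z := by simp [nb]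

theorem nb_comm (x y : V) : G.nb x y = G.nb y x := by
  ext z; simp only [mem_nb]; exact ⟨G.swap12, G.swap12⟩

end TriGraph

/-! ### Fractional covers: finding a pair with a heavy neighbourhood. -/

namespace TriGraph

variable {V : Type u} {G : TriGraph V}

theorem exists_two_smallest {S : Finset V} (w : V → ℝ) (h : 2 ≤ S.card) :
    ∃ c ∈ S, ∃ d ∈ S, c ≠ d ∧ w c ≤ w d ∧ ∀ v ∈ S, v ≠ c → w d ≤ w v := by
  obtain ⟨c, hc, hc'⟩ := exists_min_image S w (card_pos.1 (by omega))
  have h2 : (S.erase c).Nonempty := card_pos.1 (by rw [card_erase_of_mem hc]; omega)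
  obtain ⟨d, hd, hd'⟩ := exists_min_image (S.erase c) w h2
  rw [mem_erase] at hd
  exact ⟨c, hc, d, hd.2, hd.1.symm, hc' d hd.2, fun v hv hvc => hd' v (mem_erase.2 ⟨hvc, hv⟩)⟩

theorem mul_card_le_sum {S : Finset V} {w : V → ℝ} {m : ℝ} (h : ∀ v ∈ S, m ≤ w v) :
    m * S.card ≤ ∑ v ∈ S, w v := by
  have := card_nsmul_le_sum S w m h
  rw [nsmul_eq_mul] at this; linarith

/-- The weight bound used when three weightless vertices `a, b, c` do not form an edge. -/
theorem sum_union_nb_ge {U : Finset V} {w : V → ℝ} (hw : ∀ v, 0 ≤ w v) {X Y : Finset V}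
    (hX : X ⊆ U) (hY : Y ⊆ U) {m : ℝ} (hm0 : 0 ≤ m) (hm1 : m ≤ 1) {c1 c2 c3 : V}
    (h1 : ∀ v ∈ X, v ≠ c2 → m ≤ w v) (h2 : ∀ v ∈ Y, v ≠ c3 → m ≤ w v)
    (h3 : ∀ v ∈ X ∩ Y, v ≠ c1 → 1 - m ≤ w v) :
    ((X ∩ Y).card : ℝ) * (1 - m) + ((X.card : ℝ) + Y.card - 2 * (X ∩ Y).card) * m - 3
      ≤ ∑ v ∈ U, w v := by
  have e1 : ∑ v ∈ (X ∩ Y).erase c1, w v + (∑ v ∈ (X \ Y).erase c2, w v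
      + ∑ v ∈ (Y \ X).erase c3, w v) ≤ ∑ v ∈ U, w v := by
    rw [← sum_union, ← sum_union]
    · apply sum_le_sum_of_subset_of_nonneg
      · intro v; simp only [mem_union, mem_erase, mem_inter, mem_sdiff]
        rintro (⟨_, h, _⟩ | ⟨_, h, _⟩ | ⟨_, h, _⟩)
        exacts [hX h, hX h, hY h]
      · intros; exact hw _
    · rw [disjoint_left]; intro v; simp only [mem_union, mem_erase, mem_inter, mem_sdiff]; tauto
    · rw [disjoint_left]; intro v; simp only [mem_erase, mem_sdiff]; tauto
  have f1 : (1 - m) * ((X ∩ Y).erase c1).card ≤ ∑ v ∈ (X ∩ Y).erase c1, w v :=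
    mul_card_le_sum fun v hv => h3 v (mem_of_mem_erase hv) (ne_of_mem_erase hv)
  have f2 : m * ((X \ Y).erase c2).card ≤ ∑ v ∈ (X \ Y).erase c2, w v :=
    mul_card_le_sum fun v hv => h1 v (mem_sdiff.1 (mem_of_mem_erase hv)).1 (ne_of_mem_erase hv)
  have f3 : m * ((Y \ X).erase c3).card ≤ ∑ v ∈ (Y \ X).erase c3, w v :=
    mul_card_le_sum fun v hv => h2 v (mem_sdiff.1 (mem_of_mem_erase hv)).1 (ne_of_mem_erase hv)
  have g : ∀ (S : Finset V) (c : V), (S.card : ℝ) - 1 ≤ (S.erase c).card := by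
    intro S c
    have := pred_card_le_card_erase (s := S) (a := c)
    have h : S.card ≤ (S.erase c).card + 1 := by omega
    have : (S.card : ℝ) ≤ (S.erase c).card + 1 := by exact_mod_cast h
    linarith
  have k1 : ((X \ Y).card : ℝ) = X.card - (X ∩ Y).card := by
    have := card_sdiff_add_card_inter X Y
    have : ((X \ Y).card : ℝ) + (X ∩ Y).card = X.card := by exact_mod_cast this
    linarith
  have k2 : ((Y \ X).card : ℝ) = Y.card - (X ∩ Y).card := by
    have := card_sdiff_add_card_inter Y X
    rw [inter_comm] at this
    have : ((Y \ X).card : ℝ) + (X ∩ Y).card = Y.card := by exact_mod_cast this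
    linarith
  have m1 := mul_le_mul_of_nonneg_left (g (X ∩ Y) c1) (sub_nonneg.2 hm1)
  have m2 := mul_le_mul_of_nonneg_left (g (X \ Y) c2) hm0
  have m3 := mul_le_mul_of_nonneg_left (g (Y \ X) c3) hm0
  rw [k1] at m2; rw [k2] at m3
  nlinarith

/-- The right side is `(α + β) * m + i * (1 - 3 * m) - 3`, so the sign of `1 - 3 * m` decides which
`i` is worst. For `m ≤ 1/3` the term in `i` is dropped and `m > 1/4` suffices; for `m ≥ 1/3` the
bound is `(2/5 - γ) * u * (1 - m)` and `m < 1/2` suffices. The margins in `ζ` absorb the `3` and the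
loss `γ * u`. -/
theorem weight_arith {u γ ζ α β i m : ℝ} (hγ : 0 ≤ γ) (hγζ : γ ≤ ζ / 10) (hζ : ζ ≤ 1 / 100)
    (hu : 100 ≤ ζ * u) (hu0 : 0 ≤ u) (hα : (2 / 5 - γ) * u ≤ α) (hβ : (2 / 5 - γ) * u ≤ β)
    (hi : 0 ≤ i) (hiα : i ≤ α) (hiβ : i ≤ β)
    (hm : 1 / 4 + ζ / 2 < m) (hm' : m < 1 / 2 - ζ) :
    u / 5 < i * (1 - m) + (α + β - 2 * i) * m - 3 := by
  have hγu : γ * u ≤ ζ * u / 10 := by nlinarith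
  rcases le_total m (1 / 3) with h | h
  · have h1 : 0 ≤ i * (1 - 3 * m) := mul_nonneg hi (by linarith)
    have h2 : 2 * ((2 / 5 - γ) * u) * m ≤ (α + β) * m :=
      mul_le_mul_of_nonneg_right (by linarith) (by linarith)
    have h3 : ((2 / 5 - γ) * u) * (1 / 4 + ζ / 2) ≤ ((2 / 5 - γ) * u) * m :=
      mul_le_mul_of_nonneg_left hm.le (mul_nonneg (by linarith) hu0)
    have h4 : γ * u * ζ ≤ ζ * u / 10 * ζ := mul_le_mul_of_nonneg_right hγu (by linarith)
    have h5 : ζ * u / 10 * ζ ≤ ζ * u / 10 * (1 / 100) :=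
      mul_le_mul_of_nonneg_left hζ (by linarith)
    nlinarith
  · have key : (2 / 5 - γ) * u * (1 - m) ≤ i * (1 - m) + (α + β - 2 * i) * m := by
      rcases le_total i ((2 / 5 - γ) * u) with h' | h'
      · have a1 : 2 * ((2 / 5 - γ) * u - i) * m ≤ (α + β - 2 * i) * m :=
          mul_le_mul_of_nonneg_right (by linarith) (by linarith)
        have a2 : ((2 / 5 - γ) * u - i) * (1 - m) ≤ ((2 / 5 - γ) * u - i) * (2 * m) :=
          mul_le_mul_of_nonneg_left (by linarith) (by linarith)
        nlinarith
      · have a1 : (2 / 5 - γ) * u * (1 - m) ≤ i * (1 - m) :=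
          mul_le_mul_of_nonneg_right h' (by linarith)
        have a2 : 0 ≤ (α + β - 2 * i) * m := mul_nonneg (by linarith) (by linarith)
        linarith
    have h3 : ((2 / 5 - γ) * u) * (1 / 2 + ζ) ≤ ((2 / 5 - γ) * u) * (1 - m) :=
      mul_le_mul_of_nonneg_left (by linarith) (mul_nonneg (by linarith) hu0)
    have h4 : γ * u * ζ ≤ ζ * u / 10 * ζ := mul_le_mul_of_nonneg_right hγu (by linarith)
    have h5 : ζ * u / 10 * ζ ≤ ζ * u / 10 * (1 / 100) :=
      mul_le_mul_of_nonneg_left hζ (by linarith)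
    nlinarith

variable [Fintype V]

/-- The decisive quantity is `m = w d1`, the second smallest weight on the neighbourhood of `ab`,
assumed minimal among the three pairs. If `m` is near `1/2`, then `ab` itself has a heavy
neighbourhood. If `m` is at most about `1/4`, the tiles on `a, b, c1, d1` make the neighbourhood of
`c1 d1` heavy. In between, the neighbourhoods of `ac` and `bc` together weigh more than `|U| / 5`.
-/
theorem exists_heavy_nb_of_not_adj {U : Finset V} {γ ζ : ℝ} (hγ : 0 ≤ γ) (hγζ : γ ≤ ζ / 10)
    (hζ : ζ ≤ 1 / 100) (hu : 100 ≤ ζ * U.card)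
    (hcod : ∀ x ∈ U, ∀ y ∈ U, x ≠ y → (2 / 5 - γ) * U.card ≤ ((G.nb x y ∩ U).card : ℝ))
    {w : V → ℝ} (hw : ∀ v, 0 ≤ w v)
    (hT : ∀ a ∈ U, ∀ b ∈ U, ∀ c ∈ U, ∀ d ∈ U, ∀ e ∈ U, G.IsT a b c d e →
      1 ≤ w a + w b + w c + w d + w e)
    (hsum : ∑ v ∈ U, w v ≤ U.card / 5)
    {a b c : V} (ha : a ∈ U) (hb : b ∈ U) (hc : c ∈ U) (hab : a ≠ b) (hac : a ≠ c) (hbc : b ≠ c)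
    (wa : w a = 0) (wb : w b = 0) (wc : w c = 0) (habc : ¬ G.adj a b c)
    {c1 d1 c2 c3 : V} (hc1 : c1 ∈ G.nb a b ∩ U) (hd1 : d1 ∈ G.nb a b ∩ U) (hne : c1 ≠ d1)
    (hw1 : w c1 ≤ w d1) (hmin : ∀ v ∈ G.nb a b ∩ U, v ≠ c1 → w d1 ≤ w v)
    (h2 : ∀ v ∈ G.nb a c ∩ U, v ≠ c2 → w d1 ≤ w v)
    (h3 : ∀ v ∈ G.nb b c ∩ U, v ≠ c3 → w d1 ≤ w v) :
    ∃ x ∈ U, ∃ y ∈ U, x ≠ y ∧ ∃ E : Finset V, E.card ≤ 2 ∧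
      ∀ v ∈ (G.nb x y ∩ U) \ E, 1 / 2 - ζ ≤ w v := by
  simp only [mem_inter, mem_nb] at hc1 hd1
  by_cases hm : 1 / 2 - ζ ≤ w d1
  · refine ⟨a, ha, b, hb, hab, {c1}, by simp, fun v hv => ?_⟩
    simp only [mem_sdiff, mem_singleton] at hv
    exact hm.trans (hmin v hv.1 hv.2)
  by_cases hm' : w d1 ≤ 1 / 4 + ζ / 2
  · refine ⟨c1, hc1.2, d1, hd1.2, hne, {a, b}, card_le_two, fun v hv => ?_⟩
    simp only [mem_sdiff, mem_insert, mem_singleton, mem_inter, mem_nb, not_or] at hv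
    have := hT a ha b hb c1 hc1.2 d1 hd1.2 v hv.1.2 ⟨hc1.1, hd1.1, hv.1.1, hv.2.1, hv.2.2⟩
    linarith
  push Not at hm hm'
  exfalso
  have key := sum_union_nb_ge (U := U) (w := w) hw (X := G.nb a c ∩ U) (Y := G.nb b c ∩ U)
    inter_subset_right inter_subset_right (hw d1) (by linarith [hw d1]) (c1 := c1) h2 h3 (by
      intro v hv hvc
      simp only [mem_inter, mem_nb] at hv
      -- The tile has edges `vca`, `vcb`, `abc1` and weight `w v + w c1`, so `w v ≥ 1 - w d1`. Here
      -- `c1 ≠ c` because `abc` is not an edge.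
      have := hT v hv.1.2 c hc a ha b hb c1 hc1.2
        ⟨rot' (G.swap12 (G.swap12 hv.1.1)) |> fun h => G.swap23 h,
          rot' hv.2.1 |> fun h => G.swap23 h, hc1.1, fun h => hvc h.symm, ?_⟩
      · linarith
      · rintro rfl; exact habc hc1.1)
  have := weight_arith (i := ((G.nb a c ∩ U ∩ (G.nb b c ∩ U)).card : ℝ)) hγ hγζ hζ hu
    (Nat.cast_nonneg _) (hcod a ha c hc hac) (hcod b hb c hc hbc)
    (Nat.cast_nonneg _) (by exact_mod_cast card_le_card inter_subset_left)
    (by exact_mod_cast card_le_card inter_subset_right) hm' hm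
  linarith

/-- In a low-weight cover with three weightless vertices, some pair has a neighbourhood of
vertices of weight at least about `1 / 2`. -/
theorem exists_heavy_nb {U : Finset V} {γ ζ : ℝ} (hγ : 0 ≤ γ) (hγζ : γ ≤ ζ / 10)
    (hζ : ζ ≤ 1 / 100) (hu : 100 ≤ ζ * U.card)
    (hcod : ∀ x ∈ U, ∀ y ∈ U, x ≠ y → (2 / 5 - γ) * U.card ≤ ((G.nb x y ∩ U).card : ℝ))
    {w : V → ℝ} (hw : ∀ v, 0 ≤ w v)
    (hT : ∀ a ∈ U, ∀ b ∈ U, ∀ c ∈ U, ∀ d ∈ U, ∀ e ∈ U, G.IsT a b c d e →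
      1 ≤ w a + w b + w c + w d + w e)
    (hsum : ∑ v ∈ U, w v ≤ U.card / 5)
    {a b c : V} (ha : a ∈ U) (hb : b ∈ U) (hc : c ∈ U) (hab : a ≠ b) (hac : a ≠ c) (hbc : b ≠ c)
    (wa : w a = 0) (wb : w b = 0) (wc : w c = 0) :
    ∃ x ∈ U, ∃ y ∈ U, x ≠ y ∧ ∃ E : Finset V, E.card ≤ 2 ∧
      ∀ v ∈ (G.nb x y ∩ U) \ E, 1 / 2 - ζ ≤ w v := by
  have hcard : (3 : ℝ) ≤ (2 / 5 - γ) * U.card := by nlinarith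
  have hcod2 : ∀ x ∈ U, ∀ y ∈ U, x ≠ y → 2 ≤ (G.nb x y ∩ U).card := by
    intro x hx y hy hxy
    have := hcard.trans (hcod x hx y hy hxy)
    have : 3 ≤ (G.nb x y ∩ U).card := by exact_mod_cast this
    omega
  by_cases habc : G.adj a b c
  · have hne : ((G.nb a b ∩ U).erase c).Nonempty := by
      rw [← card_pos, card_erase_of_mem (by simp [habc, hc])]
      have := hcod2 a ha b hb hab; omega
    obtain ⟨d, hd, hdmin⟩ := exists_min_image _ w hne
    simp only [mem_erase, mem_inter, mem_nb] at hd
    -- Either `d`, the lightest neighbour of `ab` other than `c`, is already heavy, or every `e`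
    -- completing `a, b, c, d` to a tile must supply the missing half.
    by_cases hwd : 1 / 2 ≤ w d
    · refine ⟨a, ha, b, hb, hab, {c}, by simp, fun v hv => ?_⟩
      simp only [mem_sdiff, mem_singleton] at hv
      have := hdmin v (mem_erase.2 ⟨hv.2, hv.1⟩)
      linarith
    · refine ⟨c, hc, d, hd.2.2, hd.1.symm, {a, b}, card_le_two, fun v hv => ?_⟩
      simp only [mem_sdiff, mem_insert, mem_singleton, mem_inter, mem_nb, not_or] at hv
      have := hT a ha b hb c hc d hd.2.2 v hv.1.2 ⟨habc, hd.2.1, hv.1.1, hv.2.1, hv.2.2⟩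
      linarith
  · obtain ⟨c1, hc1, d1, hd1, n1, l1, m1⟩ := exists_two_smallest w (hcod2 a ha b hb hab)
    obtain ⟨c2, hc2, d2, hd2, n2, l2, m2⟩ := exists_two_smallest w (hcod2 a ha c hc hac)
    obtain ⟨c3, hc3, d3, hd3, n3, l3, m3⟩ := exists_two_smallest w (hcod2 b hb c hc hbc)
    have A := fun {x y : ℝ} {S : Finset V} {c : V} (h : ∀ v ∈ S, v ≠ c → x ≤ w v) (hyx : y ≤ x) =>
      show ∀ v ∈ S, v ≠ c → y ≤ w v from fun v hv hvc => hyx.trans (h v hv hvc)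
    -- The situation is symmetric in `a, b, c`, so the pair whose second smallest weight is minimal
    -- may take the place of `ab`.
    by_cases h12 : w d1 ≤ w d2 ∧ w d1 ≤ w d3
    · exact exists_heavy_nb_of_not_adj hγ hγζ hζ hu hcod hw hT hsum ha hb hc hab hac hbc wa wb wc
        habc hc1 hd1 n1 l1 m1 (A m2 h12.1) (A m3 h12.2)
    by_cases h23 : w d2 ≤ w d1 ∧ w d2 ≤ w d3
    · rw [nb_comm b c] at m3
      exact exists_heavy_nb_of_not_adj hγ hγζ hζ hu hcod hw hT hsum ha hc hb hac hab hbc.symm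
        wa wc wb (fun h => habc (G.swap23 h)) hc2 hd2 n2 l2 m2 (A m1 h23.1) (A m3 h23.2)
    have h31 : w d3 ≤ w d1 ∧ w d3 ≤ w d2 := by
      rw [not_and_or, not_le, not_le] at h12 h23
      rcases h12 with h | h <;> rcases h23 with h' | h' <;> constructor <;> linarith
    rw [nb_comm a b] at m1; rw [nb_comm a c] at m2
    exact exists_heavy_nb_of_not_adj hγ hγζ hζ hu hcod hw hT hsum hb hc ha hbc hab.symm hac.symm
        wb wc wa (fun h => habc (rot' h)) hc3 hd3 n3 l3 m3 (A m1 h31.1) (A m2 h31.2)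

end TriGraph

/-! ### Fractional covers: near-extremal structure. -/

namespace TriGraph

variable {V : Type u} {G : TriGraph V}

/-- Few edges inside `S` if every edge inside `S` has a pair with at most two neighbours in `S`. -/
theorem card_tri_le_of_light_pairs [Fintype V] {S : Finset V}
    (h : ∀ p ∈ S, ∀ q ∈ S, ∀ r ∈ S, G.adj p q r → (G.nb p q ∩ S).card ≤ 2 ∨
      (G.nb p r ∩ S).card ≤ 2 ∨ (G.nb q r ∩ S).card ≤ 2) :
    (G.tri S).card ≤ 6 * S.card ^ 2 := by
  let L : Finset (V × V) := (S ×ˢ S).filter fun p => (G.nb p.1 p.2 ∩ S).card ≤ 2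
  let T : Finset (V × V × V) := L.biUnion fun p => (G.nb p.1 p.2 ∩ S).image fun z => (p.1, p.2, z)
  have hT : T.card ≤ 2 * S.card ^ 2 := by
    calc T.card ≤ L.card * 2 := card_biUnion_le_card_mul _ _ _ fun p hp =>
          card_image_le.trans (mem_filter.1 hp).2
      _ ≤ (S ×ˢ S).card * 2 := Nat.mul_le_mul_right _ (card_filter_le _ _)
      _ = 2 * S.card ^ 2 := by rw [card_product]; ring
  have hsub : G.tri S ⊆ T ∪ T.image (fun t => (t.1, t.2.2, t.2.1)) ∪
      T.image (fun t => (t.2.2, t.1, t.2.1)) := by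
    rintro ⟨p, q, r⟩ ht
    rw [mem_tri] at ht
    obtain ⟨⟨hp, hq, hr⟩, hadj⟩ := ht
    have mk : ∀ x y z, x ∈ S → y ∈ S → z ∈ S → G.adj x y z → (G.nb x y ∩ S).card ≤ 2 →
        (x, y, z) ∈ T := by
      intro x y z hx hy hz hxyz hc
      refine mem_biUnion.2 ⟨(x, y), mem_filter.2 ⟨mem_product.2 ⟨hx, hy⟩, hc⟩, ?_⟩
      exact mem_image.2 ⟨z, mem_inter.2 ⟨mem_nb.2 hxyz, hz⟩, rfl⟩
    simp only [mem_union]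
    rcases h p hp q hq r hr hadj with h | h | h
    · exact Or.inl (Or.inl (mk _ _ _ hp hq hr hadj h))
    · exact Or.inl (Or.inr (mem_image.2 ⟨(p, r, q), mk _ _ _ hp hr hq (G.swap23 hadj) h, rfl⟩))
    · exact Or.inr (mem_image.2 ⟨(q, r, p), mk _ _ _ hq hr hp (rot hadj) h, rfl⟩)
  calc (G.tri S).card ≤ _ := card_le_card hsub
    _ ≤ T.card + T.card + T.card := (card_union_le _ _).trans
        (add_le_add ((card_union_le _ _).trans (add_le_add le_rfl card_image_le)) card_image_le)
    _ ≤ 6 * S.card ^ 2 := by omega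

theorem card_tri_le_add {S S' U : Finset V} (hS : S ⊆ U) :
    (G.tri S).card ≤ (G.tri S').card + 3 * (S \ S').card * U.card ^ 2 := by
  have hsub : G.tri S ⊆ G.tri S' ∪ (((S \ S') ×ˢ U ×ˢ U) ∪ (U ×ˢ (S \ S') ×ˢ U) ∪
      (U ×ˢ U ×ˢ (S \ S'))) := by
    rintro ⟨p, q, r⟩ ht
    rw [mem_tri] at ht
    obtain ⟨⟨hp, hq, hr⟩, hadj⟩ := ht
    have := hS hp; have := hS hq; have := hS hr
    simp only [mem_union, mem_tri, mem_product, mem_sdiff] at *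
    tauto
  calc (G.tri S).card ≤ _ := card_le_card hsub
    _ ≤ (G.tri S').card + ((((S \ S') ×ˢ U ×ˢ U).card + (U ×ˢ (S \ S') ×ˢ U).card) +
        (U ×ˢ U ×ˢ (S \ S')).card) := (card_union_le _ _).trans (add_le_add le_rfl
          ((card_union_le _ _).trans (add_le_add (card_union_le _ _) le_rfl)))
    _ = _ := by simp only [card_product]; ring

theorem exists_mem_two_of_three {S X Y Z : Finset V} (hX : X ⊆ S) (hY : Y ⊆ S) (hZ : Z ⊆ S)
    (h : S.card < X.card + Y.card + Z.card) :
    (X ∩ Y).Nonempty ∨ (X ∩ Z).Nonempty ∨ (Y ∩ Z).Nonempty := by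
  by_contra! hcon
  obtain ⟨h1, h2, h3⟩ := hcon
  have d1 : Disjoint X Y := disjoint_iff_inter_eq_empty.2 h1
  have d2 : Disjoint (X ∪ Y) Z := disjoint_union_left.2
    ⟨disjoint_iff_inter_eq_empty.2 h2, disjoint_iff_inter_eq_empty.2 h3⟩
  have := card_le_card (union_subset (union_subset hX hY) hZ)
  rw [card_union_of_disjoint d2, card_union_of_disjoint d1] at this
  omega

variable [Fintype V]

set_option maxHeartbeats 800000 in
/-- A cover of the generalised triangles in `U` of weight at most `|U| / 5` that vanishes on three
vertices forces `U` to be close to the extremal configuration. -/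
theorem extremal_of_cover {U : Finset V} {γ ζ : ℝ} (hγ : 0 ≤ γ) (hγζ : γ ≤ ζ / 10)
    (hζ : ζ ≤ 1 / 1000) (hu : 1000 ≤ ζ * U.card)
    (hcod : ∀ x ∈ U, ∀ y ∈ U, x ≠ y → (2 / 5 - γ) * U.card ≤ ((G.nb x y ∩ U).card : ℝ))
    {w : V → ℝ} (hw : ∀ v, 0 ≤ w v)
    (hT : ∀ a ∈ U, ∀ b ∈ U, ∀ c ∈ U, ∀ d ∈ U, ∀ e ∈ U, G.IsT a b c d e →
      1 ≤ w a + w b + w c + w d + w e)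
    (hsum : ∑ v ∈ U, w v ≤ U.card / 5)
    {a b c : V} (ha : a ∈ U) (hb : b ∈ U) (hc : c ∈ U) (hab : a ≠ b) (hac : a ≠ c) (hbc : b ≠ c)
    (wa : w a = 0) (wb : w b = 0) (wc : w c = 0) :
    ∃ x ∈ U, ∃ y ∈ U, x ≠ y ∧ ((G.nb x y ∩ U).card : ℝ) ≤ (2 / 5 + 100 * ζ) * U.card ∧
      ((G.tri (U \ G.nb x y)).card : ℝ) ≤ 100 * ζ * U.card ^ 3 := by
  obtain ⟨x, hx, y, hy, hxy, E, hE, hEw⟩ := exists_heavy_nb hγ hγζ (by linarith) (by linarith)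
    hcod hw hT hsum ha hb hc hab hac hbc wa wb wc
  have hcxy := hcod x hx y hy hxy
  set u : ℝ := (U.card : ℝ) with hudef
  have hζ0 : 0 ≤ ζ := by linarith
  have hu0 : 0 ≤ u := Nat.cast_nonneg _
  have hu1 : 1000000 ≤ u := by nlinarith
  have hγu : γ * u ≤ ζ * u / 10 := by nlinarith
  set N := G.nb x y ∩ U with hN
  set B := U \ G.nb x y with hB
  have hNE : (N.card : ℝ) - 2 ≤ (N \ E).card := by
    have h1 := le_card_sdiff E N
    have : N.card ≤ (N \ E).card + 2 := by omega
    have : (N.card : ℝ) ≤ (N \ E).card + 2 := by exact_mod_cast this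
    linarith
  have hsumNB : ∑ v ∈ N, w v + ∑ v ∈ B, w v = ∑ v ∈ U, w v := by
    rw [hN, inter_comm, hB]; exact sum_inter_add_sum_sdiff U _ w
  have hNE' : ∑ v ∈ N \ E, w v ≤ ∑ v ∈ N, w v :=
    sum_le_sum_of_subset_of_nonneg sdiff_subset fun _ _ _ => hw _
  have hBw : 0 ≤ ∑ v ∈ B, w v := sum_nonneg fun _ _ => hw _
  have hNElow : (1 / 2 - ζ) * (N \ E).card ≤ ∑ v ∈ N \ E, w v := mul_card_le_sum hEw
  have hlow1 : (1 / 2 - ζ) * (N.card - 2) ≤ (1 / 2 - ζ) * (N \ E).card :=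
    mul_le_mul_of_nonneg_left hNE (by linarith)
  have hlow2 : (1 / 2 - ζ) * ((2 / 5 - γ) * u - 2) ≤ (1 / 2 - ζ) * (N.card - 2) :=
    mul_le_mul_of_nonneg_left (by linarith) (by linarith)
  have hpos1 : 0 ≤ ζ * (γ * u) := by positivity
  -- The neighbourhood of `xy` alone uses up nearly the whole budget `u / 5`, so only `ζ * u` is
  -- left for its complement `B`.
  have hlow3 : u / 5 - ζ * u / 2 ≤ (1 / 2 - ζ) * ((2 / 5 - γ) * u - 2) := by nlinarith
  have hBsum : ∑ v ∈ B, w v ≤ ζ * u := by linarith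
  -- the heavy part of `B`
  have hBheavy : ((B.filter fun v => 1 / 16 ≤ w v).card : ℝ) ≤ 16 * ζ * u := by
    have h1 : (1 / 16 : ℝ) * (B.filter fun v => 1 / 16 ≤ w v).card ≤
        ∑ v ∈ B.filter fun v => 1 / 16 ≤ w v, w v :=
      mul_card_le_sum fun v hv => (mem_filter.1 hv).2
    have h2 : ∑ v ∈ B.filter (fun v => 1 / 16 ≤ w v), w v ≤ ∑ v ∈ B, w v :=
      sum_le_sum_of_subset_of_nonneg (filter_subset _ _) fun _ _ _ => hw _
    linarith
  -- Each vertex of weight at least `7/10` exceeds the lower bound `1/2 - ζ` by at least `1/5`, and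
  -- the total excess over `N \ E` is small.
  have hNheavy : (((N \ E).filter fun v => 7 / 10 ≤ w v).card : ℝ) ≤ 4 * ζ * u := by
    have h1 : (1 / 5 : ℝ) * ((N \ E).filter fun v => 7 / 10 ≤ w v).card ≤
        ∑ v ∈ (N \ E).filter (fun v => 7 / 10 ≤ w v), (w v - (1 / 2 - ζ)) :=
      mul_card_le_sum fun v hv => by have := (mem_filter.1 hv).2; linarith
    have h2 : ∑ v ∈ (N \ E).filter (fun v => 7 / 10 ≤ w v), (w v - (1 / 2 - ζ)) ≤
        ∑ v ∈ N \ E, (w v - (1 / 2 - ζ)) :=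
      sum_le_sum_of_subset_of_nonneg (filter_subset _ _) fun v hv _ => by
        have := hEw v hv; linarith
    have h3 : ∑ v ∈ N \ E, (w v - (1 / 2 - ζ)) =
        ∑ v ∈ N \ E, w v - (N \ E).card * (1 / 2 - ζ) := by
      rw [sum_sub_distrib, sum_const, nsmul_eq_mul]
    linarith
  refine ⟨x, hx, y, hy, hxy, ?_, ?_⟩
  · have h1 : (1 / 2 - ζ) * (N.card - 2) ≤ u / 5 := by linarith
    have h2 : (1 / 2 - ζ) * ((2 / 5 + 2 * ζ) * u) ≥ u / 5 + ζ * u / 2 := by nlinarith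
    have h3 : (N.card : ℝ) - 2 ≤ (2 / 5 + 2 * ζ) * u := by
      by_contra hcon
      push Not at hcon
      have := mul_le_mul_of_nonneg_left hcon.le (show (0 : ℝ) ≤ 1 / 2 - ζ by linarith)
      linarith
    linarith
  · set B0 := B.filter fun v => w v < 1 / 16 with hB0
    set V0 := B0 ∪ (N \ E).filter (fun v => w v < 7 / 10) with hV0
    have hV0U : V0 ⊆ U := by
      rw [hV0]
      exact union_subset ((filter_subset _ _).trans sdiff_subset)
        ((filter_subset _ _).trans (sdiff_subset.trans inter_subset_right))
    have hB0V : B0 ⊆ V0 := subset_union_left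
    have hUV0 : ((U \ V0).card : ℝ) ≤ 20 * ζ * u + 2 := by
      have hsub : U \ V0 ⊆ (B.filter fun v => 1 / 16 ≤ w v) ∪
          ((N \ E).filter fun v => 7 / 10 ≤ w v) ∪ E := by
        intro v hv
        simp only [hV0, hB0, hN, hB, mem_sdiff, mem_union, mem_filter, mem_inter] at hv ⊢
        obtain ⟨hvU, hv⟩ := hv
        push Not at hv
        by_cases h1 : v ∈ G.nb x y
        · by_cases h2 : v ∈ E
          · exact Or.inr h2
          · exact Or.inl (Or.inr ⟨⟨⟨h1, hvU⟩, h2⟩, hv.2 ⟨⟨h1, hvU⟩, h2⟩⟩)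
        · exact Or.inl (Or.inl ⟨⟨hvU, h1⟩, hv.1 ⟨hvU, h1⟩⟩)
      have h := (card_le_card hsub).trans ((card_union_le _ _).trans
        (add_le_add (card_union_le _ _) hE))
      have : ((U \ V0).card : ℝ) ≤ (B.filter fun v => 1 / 16 ≤ w v).card +
          ((N \ E).filter fun v => 7 / 10 ≤ w v).card + 2 := by exact_mod_cast h
      linarith
    have hwV0 : ∀ v ∈ V0, w v < 7 / 10 := by
      intro v hv
      rcases mem_union.1 hv with h | h
      · have := (mem_filter.1 h).2; linarith
      · exact (mem_filter.1 h).2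
    have hlight : ∀ p ∈ B0, ∀ q ∈ B0, ∀ r ∈ B0, G.adj p q r → (G.nb p q ∩ B0).card ≤ 2 ∨
        (G.nb p r ∩ B0).card ≤ 2 ∨ (G.nb q r ∩ B0).card ≤ 2 := by
      intro p hp q hq r hr hadj
      by_contra! hcon
      obtain ⟨c1, c2, c3⟩ := hcon
      have hU := fun {z : V} (hz : z ∈ B0) => hV0U (hB0V hz)
      have hw16 := fun {z : V} (hz : z ∈ B0) => (mem_filter.1 hz).2
      -- The tile has edges `pdq`, `pdr`, `qre`: four vertices of weight below `1/16` and `d` below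
      -- `7/10`, which together stay below `1`.
      have bad : ∀ p ∈ B0, ∀ q ∈ B0, ∀ r ∈ B0, ∀ d ∈ V0, G.adj p q d → G.adj p r d → q ≠ r →
          p ≠ q → 2 < (G.nb q r ∩ B0).card → False := by
        intro p hp q hq r hr d hd h1 h2 hqr hpq h3
        have : ((G.nb q r ∩ B0) \ {p, d}).Nonempty := by
          rw [← card_pos]
          have := le_card_sdiff {p, d} (G.nb q r ∩ B0)
          have := card_le_two (a := p) (b := d)
          omega
        obtain ⟨e, he⟩ := this
        simp only [mem_sdiff, mem_inter, mem_nb, mem_insert, mem_singleton, not_or] at he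
        have := hT p (hU hp) d (hV0U hd) q (hU hq) r (hU hr) e (hU he.1.2)
          ⟨G.swap23 h1, G.swap23 h2, he.1.1, he.2.1, he.2.2⟩
        have := hw16 hp; have := hw16 hq; have := hw16 hr; have := hw16 he.1.2; have := hwV0 d hd
        linarith
      -- Since `3 * 0.36 > 1`, two of the three pairs of an edge inside `B0` have a common neighbour
      -- in `V0`; it plays the role of `d` in `bad`.
      have hdeg : ∀ p ∈ B0, ∀ q ∈ B0, p ≠ q → u * (0.36 : ℝ) ≤ (G.nb p q ∩ V0).card := by
        intro p hp q hq hpq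
        have h1 := hcod p (hU hp) q (hU hq) hpq
        have h2 : (G.nb p q ∩ U).card ≤ (G.nb p q ∩ V0).card + (U \ V0).card := by
          refine (card_le_card ?_).trans (card_union_le _ _)
          intro v; simp only [mem_inter, mem_union, mem_sdiff]; tauto
        have h3 : ((G.nb p q ∩ U).card : ℝ) ≤ (G.nb p q ∩ V0).card + (U \ V0).card := by
          exact_mod_cast h2
        have h4 : ζ * u ≤ 1 / 1000 * u := mul_le_mul_of_nonneg_right hζ hu0
        have h5 : (2 / 5 - γ) * u = 2 / 5 * u - γ * u := by ring
        linarith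
      have h12 := hdeg p hp q hq (G.ne12 hadj)
      have h13 := hdeg p hp r hr (ne13 hadj)
      have h23 := hdeg q hq r hr (ne23 hadj)
      have hVc : (V0.card : ℝ) ≤ u := Nat.cast_le.2 (card_le_card hV0U)
      have hlt : V0.card < (G.nb p q ∩ V0).card + (G.nb p r ∩ V0).card + (G.nb q r ∩ V0).card := by
        have : (V0.card : ℝ) < (G.nb p q ∩ V0).card + (G.nb p r ∩ V0).card +
          (G.nb q r ∩ V0).card := by linarith
        exact_mod_cast this
      rcases exists_mem_two_of_three inter_subset_right inter_subset_right inter_subset_right hlt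
        with ⟨d, hd⟩ | ⟨d, hd⟩ | ⟨d, hd⟩
      all_goals simp only [mem_inter, mem_nb] at hd
      · exact bad p hp q hq r hr d hd.1.2 hd.1.1 hd.2.1 (ne23 hadj) (G.ne12 hadj) c3
      · exact bad q hq p hp r hr d hd.1.2 (G.swap12 hd.1.1) hd.2.1 (ne13 hadj) (G.ne12 hadj).symm c2
      · exact bad r hr p hp q hq d hd.1.2 (G.swap12 hd.1.1) (G.swap12 hd.2.1) (G.ne12 hadj)
          (ne13 hadj).symm c1
    have h1 := card_tri_le_of_light_pairs hlight
    have h2 := card_tri_le_add (G := G) (S := B) (S' := B0) (U := U) sdiff_subset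
    have h3 : B \ B0 ⊆ B.filter fun v => 1 / 16 ≤ w v := by
      intro v; simp only [hB0, mem_sdiff, mem_filter, not_and, not_lt]; tauto
    have h4 : ((B \ B0).card : ℝ) ≤ 16 * ζ * u :=
      le_trans (by exact_mod_cast card_le_card h3) hBheavy
    have h5 : (B0.card : ℝ) ≤ u := Nat.cast_le.2 (card_le_card (hB0V.trans hV0U))
    have h6 : ((G.tri B).card : ℝ) ≤ 6 * (B0.card : ℝ) ^ 2 + 3 * (B \ B0).card * u ^ 2 := by
      rw [hudef]; exact_mod_cast h2.trans (add_le_add h1 le_rfl)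
    have h7 : (B0.card : ℝ) ^ 2 ≤ u ^ 2 := pow_le_pow_left₀ (Nat.cast_nonneg _) h5 2
    have h8 : 3 * ((B \ B0).card : ℝ) * u ^ 2 ≤ 3 * (16 * ζ * u) * u ^ 2 := by gcongr
    have h9 : 1000 * u ^ 2 ≤ ζ * u * u ^ 2 := by gcongr
    nlinarith [sq_nonneg u]

end TriGraph

/-! ### Light tiles for arbitrary weightings. -/

namespace TriGraph

variable {V : Type u} {G : TriGraph V}

theorem exists_three_smallest {U : Finset V} (ω : V → ℝ) (h : 3 ≤ U.card) :
    ∃ a ∈ U, ∃ b ∈ U, ∃ c ∈ U, a ≠ b ∧ a ≠ c ∧ b ≠ c ∧ ω a ≤ ω c ∧ ω b ≤ ω c ∧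
      ∀ v ∈ U, v ≠ a → v ≠ b → ω c ≤ ω v := by
  obtain ⟨a, ha, ha'⟩ := exists_min_image U ω (card_pos.1 (by omega))
  obtain ⟨b, hb, c, hc, hbc, hle, hmin⟩ := exists_two_smallest (S := U.erase a) ω
    (by rw [card_erase_of_mem ha]; omega)
  rw [mem_erase] at hb hc
  exact ⟨a, ha, b, hb.2, c, hc.2, hb.1.symm, hc.1.symm, hbc, ha' c hc.2, hle,
    fun v hv hva hvb => hmin v (mem_erase.2 ⟨hva, hv⟩) hvb⟩

variable [Fintype V]

/-- If `U` is not close to the extremal configuration, then for any weighting of `U` some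
generalised triangle in `U` has at most (about) the average weight. -/
theorem exists_light_tile {U : Finset V} {γ ζ : ℝ} (hγ : 0 ≤ γ) (hγζ : γ ≤ ζ / 10)
    (hζ : ζ ≤ 1 / 1000) (hu : 1000 ≤ ζ * U.card)
    (hcod : ∀ x ∈ U, ∀ y ∈ U, x ≠ y → (2 / 5 - γ) * U.card ≤ ((G.nb x y ∩ U).card : ℝ))
    (hext : ∀ x ∈ U, ∀ y ∈ U, x ≠ y → (2 / 5 + 100 * ζ) * U.card < ((G.nb x y ∩ U).card : ℝ) ∨
      100 * ζ * U.card ^ 3 < ((G.tri (U \ G.nb x y)).card : ℝ))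
    {ω : V → ℝ} (hω : ∀ v, 0 ≤ ω v) :
    ∃ X ⊆ U, G.TSet X ∧ (∑ v ∈ X, ω v) * (U.card / 5 - 1) ≤ ∑ v ∈ U, ω v := by
  have hζ0 : 0 ≤ ζ := by linarith
  have hu0 : (0 : ℝ) ≤ U.card := Nat.cast_nonneg _
  have hu1 : (1000 : ℝ) ≤ U.card := by nlinarith
  have hu2 : 3 ≤ U.card := by
    have : 1000 ≤ U.card := by exact_mod_cast hu1
    omega
  have hno : ∀ w : V → ℝ, (∀ v, 0 ≤ w v) →
    (∀ a ∈ U, ∀ b ∈ U, ∀ c ∈ U, ∀ d ∈ U, ∀ e ∈ U, G.IsT a b c d e →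
      1 ≤ w a + w b + w c + w d + w e) → (∑ v ∈ U, w v ≤ U.card / 5) →
      ∀ a ∈ U, ∀ b ∈ U, ∀ c ∈ U, a ≠ b → a ≠ c → b ≠ c → w a = 0 → w b = 0 → w c = 0 → False := by
    intro w hw hT hs a ha b hb c hc h1 h2 h3 h4 h5 h6
    obtain ⟨x, hx, y, hy, hxy, e1, e2⟩ := extremal_of_cover hγ hγζ hζ hu hcod hw hT hs ha hb hc h1
      h2 h3 h4 h5 h6
    rcases hext x hx y hy hxy with h | h <;> linarith
  obtain ⟨a, ha, b, hb, c, hc, hab, hac, hbc, hlea, hleb, hmin⟩ := exists_three_smallest ω hu2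
  by_contra! hcon
  have hcon' : ∀ a ∈ U, ∀ b ∈ U, ∀ c ∈ U, ∀ d ∈ U, ∀ e ∈ U, G.IsT a b c d e →
      ∑ v ∈ U, ω v < (ω a + ω b + ω c + ω d + ω e) * (U.card / 5 - 1) := by
    intro a ha b hb c hc d hd e he h
    rw [← h.sum ω]
    refine hcon _ ?_ ⟨a, b, c, d, e, h, rfl⟩
    intro v; simp only [mem_insert, mem_singleton]
    rintro (rfl | rfl | rfl | rfl | rfl) <;> assumption
  -- The `-1` pays for the three vertices that the truncation below sets to zero: lowering all
  -- weights by `x` saves at least `(|U| - 3) * x` in total, while five vertices lose at most `5 *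
  -- x`, and `5 * k = |U| - 5`.
  set k : ℝ := (U.card : ℝ) / 5 - 1 with hk
  have hk0 : 0 < k := by linarith
  set Ω := ∑ v ∈ U, ω v with hΩ
  set x := ω c with hx
  -- Subtracting the third smallest weight creates the three zeros needed by `extremal_of_cover`;
  -- after division by `θ` the result is a cover of total weight at most `|U| / 5`.
  set w' : V → ℝ := fun v => max (ω v - x) 0 with hw'
  have hw'0 : ∀ v, 0 ≤ w' v := fun v => le_max_right _ _
  have wa : w' a = 0 := max_eq_right (by linarith)
  have wb : w' b = 0 := max_eq_right (by linarith)
  have wc : w' c = 0 := max_eq_right (by linarith)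
  have hsum : ∑ v ∈ U, w' v ≤ Ω - (U.card - 3) * x := by
    have h1 : ∀ v ∈ U, w' v ≤ ω v - x + (if v = a then x else 0) + (if v = b then x else 0)
        + (if v = c then x else 0) := by
      intro v hv
      have hxx : 0 ≤ x := hω c
      by_cases h1 : v = a
      · subst h1; rw [wa, if_pos rfl, if_neg hab, if_neg hac]; linarith [hω v]
      by_cases h2 : v = b
      · subst h2; rw [wb, if_neg h1, if_pos rfl, if_neg hbc]; linarith [hω v]
      have := hmin v hv h1 h2
      rw [if_neg h1, if_neg h2, hw']
      simp only
      rw [max_eq_left (by linarith)]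
      split_ifs <;> linarith
    refine (sum_le_sum h1).trans (le_of_eq ?_)
    simp only [sum_add_distrib, sum_sub_distrib, sum_ite_eq', ha, hb, hc, if_true, sum_const,
      nsmul_eq_mul]
    rw [← hΩ]; ring
  have hxx : 0 ≤ x := hω c
  have hsum0 : 0 ≤ ∑ v ∈ U, w' v := sum_nonneg fun v _ => hw'0 v
  set θ : ℝ := Ω / k - 5 * x with hθ
  have hθk : θ * k = Ω - 5 * x * k := by rw [hθ]; field_simp
  have hθk' : ∑ v ∈ U, w' v ≤ θ * k := by rw [hθk, hk]; nlinarith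
  have hθ0 : 0 ≤ θ := by
    by_contra h
    push Not at h
    have := mul_neg_of_neg_of_pos h hk0
    linarith
  have hTw : ∀ a ∈ U, ∀ b ∈ U, ∀ c ∈ U, ∀ d ∈ U, ∀ e ∈ U, G.IsT a b c d e →
      θ < w' a + w' b + w' c + w' d + w' e := by
    intro a ha b hb c hc d hd e he h
    have h1 := hcon' a ha b hb c hc d hd e he h
    have h2 : Ω / k < ω a + ω b + ω c + ω d + ω e := (div_lt_iff₀ hk0).2 h1
    have h3 : ∀ v, ω v - x ≤ w' v := fun v => le_max_left _ _
    have := h3 a; have := h3 b; have := h3 c; have := h3 d; have := h3 e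
    linarith
  -- If `θ = 0` then `w'` vanishes on `U`, so the strict bound `hTw` leaves no tile in `U` at all
  -- and the zero weighting is a cover.
  rcases hθ0.eq_or_lt with h0 | hpos
  · have hz : ∀ v ∈ U, w' v = 0 := by
      have : ∑ v ∈ U, w' v = 0 := le_antisymm (by rw [← h0, zero_mul] at hθk'; exact hθk') hsum0
      exact (sum_eq_zero_iff_of_nonneg fun v _ => hw'0 v).1 this
    refine hno (fun _ => 0) (fun _ => le_rfl) ?_ (by simp; positivity) a ha b hb c hc hab hac hbc
      rfl rfl rfl
    intro a ha b hb c hc d hd e he h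
    have := hTw a ha b hb c hc d hd e he h
    rw [hz a ha, hz b hb, hz c hc, hz d hd, hz e he] at this
    linarith
  · refine hno (fun v => w' v / θ) (fun v => div_nonneg (hw'0 v) hθ0) ?_ ?_ a ha b hb c hc hab hac
      hbc (by simp [wa]) (by simp [wb]) (by simp [wc])
    · intro a ha b hb c hc d hd e he h
      have := hTw a ha b hb c hc d hd e he h
      rw [← add_div, ← add_div, ← add_div, ← add_div, le_div_iff₀ hpos]
      linarith
    · rw [← sum_div, div_le_iff₀ hpos]
      rw [hk] at hθk'
      nlinarith

end TriGraph

/-! ### Densities of families of triples and the exponential potential. -/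

section Counting

variable {V : Type u}

/-- The number of triples of `F` inside `U`. -/
noncomputable def triCount (F : Finset (V × V × V)) (U : Finset V) : ℕ :=
  (F.filter fun t => t.1 ∈ U ∧ t.2.1 ∈ U ∧ t.2.2 ∈ U).card

/-- The number of incidences of `v` with the triples of `F` inside `U`. -/
noncomputable def triDeg (F : Finset (V × V × V)) (U : Finset V) (v : V) : ℕ :=
  ((F.filter fun t => t.1 ∈ U ∧ t.2.1 ∈ U ∧ t.2.2 ∈ U).filter fun t => t.1 = v).card +
  ((F.filter fun t => t.1 ∈ U ∧ t.2.1 ∈ U ∧ t.2.2 ∈ U).filter fun t => t.2.1 = v).card +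
  ((F.filter fun t => t.1 ∈ U ∧ t.2.1 ∈ U ∧ t.2.2 ∈ U).filter fun t => t.2.2 = v).card

/-- The density of `F` inside `U`. -/
noncomputable def tdens (F : Finset (V × V × V)) (U : Finset V) : ℝ := triCount F U / (U.card : ℝ) ^ 3

theorem sum_triDeg (F : Finset (V × V × V)) (U : Finset V) : ∑ v ∈ U, triDeg F U v = 3 * triCount F U := by
  set S := F.filter fun t => t.1 ∈ U ∧ t.2.1 ∈ U ∧ t.2.2 ∈ U with hS
  have h : ∀ f : V × V × V → V, (∀ t ∈ S, f t ∈ U) →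
      ∑ v ∈ U, (S.filter fun t => f t = v).card = S.card := fun f hf =>
    (card_eq_sum_card_fiberwise hf).symm
  have mem : ∀ t ∈ S, t.1 ∈ U ∧ t.2.1 ∈ U ∧ t.2.2 ∈ U := fun t ht => (mem_filter.1 ht).2
  simp only [triDeg, sum_add_distrib, triCount, ← hS]
  rw [h _ fun t ht => (mem t ht).1, h _ fun t ht => (mem t ht).2.1, h _ fun t ht => (mem t ht).2.2]
  ring

theorem triCount_le_add (F : Finset (V × V × V)) (U X : Finset V) :
    triCount F U ≤ triCount F (U \ X) + ∑ v ∈ X, triDeg F U v := by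
  set S := F.filter fun t => t.1 ∈ U ∧ t.2.1 ∈ U ∧ t.2.2 ∈ U with hS
  have hsub : S ⊆ (F.filter fun t => t.1 ∈ U \ X ∧ t.2.1 ∈ U \ X ∧ t.2.2 ∈ U \ X) ∪
      X.biUnion fun v => (S.filter fun t => t.1 = v) ∪ (S.filter fun t => t.2.1 = v) ∪
        (S.filter fun t => t.2.2 = v) := by
    intro t ht
    have ht' := ht
    rw [hS] at ht'
    simp only [mem_filter] at ht'
    by_cases h1 : t.1 ∈ X
    · exact mem_union_right _ (mem_biUnion.2 ⟨_, h1, by simp [ht]⟩)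
    by_cases h2 : t.2.1 ∈ X
    · exact mem_union_right _ (mem_biUnion.2 ⟨_, h2, by simp [ht]⟩)
    by_cases h3 : t.2.2 ∈ X
    · exact mem_union_right _ (mem_biUnion.2 ⟨_, h3, by simp [ht]⟩)
    refine mem_union_left _ (mem_filter.2 ⟨ht'.1, ?_⟩)
    simp only [mem_sdiff]
    tauto
  refine (card_le_card hsub).trans ((card_union_le _ _).trans (add_le_add le_rfl ?_))
  refine card_biUnion_le.trans (sum_le_sum fun v _ => ?_)
  exact (card_union_le _ _).trans (add_le_add (card_union_le _ _) le_rfl)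

theorem triCount_le (F : Finset (V × V × V)) (U : Finset V) : triCount F U ≤ U.card ^ 3 := by
  have : (F.filter fun t => t.1 ∈ U ∧ t.2.1 ∈ U ∧ t.2.2 ∈ U) ⊆ U ×ˢ U ×ˢ U := by
    intro t; simp only [mem_filter, mem_product]; tauto
  refine (card_le_card this).trans (le_of_eq ?_)
  simp only [card_product]; ring

theorem triDeg_le (F : Finset (V × V × V)) (U : Finset V) (v : V) : triDeg F U v ≤ 3 * U.card ^ 2 := by
  have h1 : ((F.filter fun t => t.1 ∈ U ∧ t.2.1 ∈ U ∧ t.2.2 ∈ U).filter fun t => t.1 = v) ⊆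
      {v} ×ˢ U ×ˢ U := by
    intro t; simp only [mem_filter, mem_product, mem_singleton]; tauto
  have h2 : ((F.filter fun t => t.1 ∈ U ∧ t.2.1 ∈ U ∧ t.2.2 ∈ U).filter fun t => t.2.1 = v) ⊆
      U ×ˢ {v} ×ˢ U := by
    intro t; simp only [mem_filter, mem_product, mem_singleton]; tauto
  have h3 : ((F.filter fun t => t.1 ∈ U ∧ t.2.1 ∈ U ∧ t.2.2 ∈ U).filter fun t => t.2.2 = v) ⊆
      U ×ˢ U ×ˢ {v} := by
    intro t; simp only [mem_filter, mem_product, mem_singleton]; tauto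
  refine (add_le_add (add_le_add (card_le_card h1) (card_le_card h2)) (card_le_card h3)).trans
    (le_of_eq ?_)
  simp only [card_product, card_singleton]; ring

theorem tdens_nonneg (F : Finset (V × V × V)) (U : Finset V) : 0 ≤ tdens F U := by
  unfold tdens; positivity

theorem tdens_le_one (F : Finset (V × V × V)) (U : Finset V) : tdens F U ≤ 1 := by
  unfold tdens
  refine div_le_one_of_le₀ ?_ (by positivity)
  exact_mod_cast triCount_le F U

/-- The loss in density caused by removing five vertices is controlled by their degrees. -/
theorem tdens_sub_le (F : Finset (V × V × V)) {U X : Finset V} (hX : X ⊆ U) (hX5 : X.card = 5)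
    (hU : (10 : ℝ) ≤ U.card) :
    tdens F U - tdens F (U \ X) ≤ (∑ v ∈ X, (triDeg F U v : ℝ)) / (U.card : ℝ) ^ 3
      - 15 * tdens F U / U.card + 225 / (U.card : ℝ) ^ 2 := by
  set u : ℝ := (U.card : ℝ) with hu
  set D : ℝ := ∑ v ∈ X, (triDeg F U v : ℝ) with hD
  have hD15 : D ≤ 15 * u ^ 2 := by
    have : D ≤ ∑ v ∈ X, 3 * u ^ 2 := sum_le_sum fun v _ => by
      rw [hu]; exact_mod_cast triDeg_le F U v
    rw [sum_const, hX5, nsmul_eq_mul] at this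
    push_cast at this
    linarith
  have hD0 : 0 ≤ D := sum_nonneg fun _ _ => Nat.cast_nonneg _
  have hc : ((U \ X).card : ℝ) = u - 5 := by
    rw [card_sdiff_of_subset hX, hX5, Nat.cast_sub]
    · simp [hu]
    · rw [← hX5]; exact card_le_card hX
  have hf : (triCount F U : ℝ) - D ≤ triCount F (U \ X) := by
    have : (triCount F U : ℝ) ≤ triCount F (U \ X) + D := by
      rw [hD]; exact_mod_cast triCount_le_add F U X
    linarith
  have hu5 : 0 < u - 5 := by linarith
  have hu0 : 0 < u := by linarith
  have hu3 : 0 < u ^ 3 := by positivity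
  set f : ℝ := (triCount F U : ℝ) with hfdef
  have key : (f - D) / u ^ 3 * (1 + 15 / u) ≤ tdens F (U \ X) := by
    by_cases hneg : f - D ≤ 0
    · exact (mul_nonpos_of_nonpos_of_nonneg (div_nonpos_of_nonpos_of_nonneg hneg hu3.le)
        (by positivity)).trans (tdens_nonneg _ _)
    · push Not at hneg
      unfold tdens
      rw [hc]
      -- Normalising by `(u - 5) ^ 3` instead of `u ^ 3` gains a factor `1 + 15 / u`, which offsets
      -- the expected loss of triples to first order.
      have h1 : (1 + 15 / u) / u ^ 3 ≤ 1 / (u - 5) ^ 3 := by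
        rw [div_le_div_iff₀ hu3 (by positivity)]
        have : (1 + 15 / u) = (u + 15) / u := by field_simp
        rw [this, div_mul_eq_mul_div, div_le_iff₀ hu0]
        nlinarith [sq_nonneg u, mul_pos hu0 hu0]
      calc (f - D) / u ^ 3 * (1 + 15 / u) = (f - D) * ((1 + 15 / u) / u ^ 3) := by ring
        _ ≤ (f - D) * (1 / (u - 5) ^ 3) := mul_le_mul_of_nonneg_left h1 hneg.le
        _ = (f - D) / (u - 5) ^ 3 := by ring
        _ ≤ _ := by gcongr
  have hdens : tdens F U = f / u ^ 3 := rfl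
  have h2 : (f - D) / u ^ 3 * (1 + 15 / u) =
      f / u ^ 3 + 15 * (f / u ^ 3) / u - D / u ^ 3 - 15 * D / u ^ 4 := by
    field_simp; ring
  have h3 : 15 * D / u ^ 4 ≤ 225 / u ^ 2 := by
    rw [div_le_div_iff₀ (by positivity) (by positivity)]
    nlinarith [mul_le_mul_of_nonneg_right hD15 (sq_nonneg u)]
  rw [hdens]
  linarith

/-- Only an upper bound `y` on the exponent is available, since a density may also rise when a tile
is removed; hence no lower bound on `x` is asked. -/
theorem exp_le_quadratic {x y : ℝ} (hxy : x ≤ y) (hy : |y| ≤ 1) : Real.exp x ≤ 1 + y + y ^ 2 := by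
  have h1 := Real.abs_exp_sub_one_sub_id_le hy
  have h2 := (abs_le.1 h1).2
  have h3 := Real.exp_le_exp.2 hxy
  linarith

/-- One step of the tile removal: the exponential potential grows by a small factor only. -/
theorem potential_step {ι : Type*} (J : Finset ι) (F : ι → Finset (V × V × V)) {U X : Finset V}
    (hX : X ⊆ U) (hX5 : X.card = 5) (hU : (10 : ℝ) ≤ U.card) {l : ℝ} (hl : 1 ≤ l)
    (hlu : 300 * l ≤ U.card) (c : ι → ℝ)
    (hlight : (∑ v ∈ X, ∑ j ∈ J, Real.exp (l * (c j - tdens (F j) U)) * triDeg (F j) U v) *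
        (U.card / 5 - 1) ≤
      ∑ v ∈ U, ∑ j ∈ J, Real.exp (l * (c j - tdens (F j) U)) * triDeg (F j) U v) :
    ∑ j ∈ J, Real.exp (l * (c j - tdens (F j) (U \ X))) ≤
      (∑ j ∈ J, Real.exp (l * (c j - tdens (F j) U))) * (1 + 100000 * l ^ 2 / (U.card : ℝ) ^ 2) := by
  set u : ℝ := (U.card : ℝ) with hu
  set q : ι → ℝ := fun j => Real.exp (l * (c j - tdens (F j) U)) with hq
  have hq0 : ∀ j, 0 ≤ q j := fun j => (Real.exp_pos _).le
  set D : ι → ℝ := fun j => ∑ v ∈ X, (triDeg (F j) U v : ℝ) with hD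
  set z : ι → ℝ := fun j => D j / u ^ 3 - 15 * tdens (F j) U / u + 225 / u ^ 2 with hz
  have hu0 : 0 < u := by linarith
  have hD15 : ∀ j, D j ≤ 15 * u ^ 2 := by
    intro j
    have : D j ≤ ∑ v ∈ X, 3 * u ^ 2 := sum_le_sum fun v _ => by
      rw [hu]; exact_mod_cast triDeg_le (F j) U v
    rw [sum_const, hX5, nsmul_eq_mul] at this
    push_cast at this
    linarith
  have hD0 : ∀ j, 0 ≤ D j := fun j => sum_nonneg fun _ _ => Nat.cast_nonneg _
  have hz1 : ∀ j, |z j| ≤ 300 / u := by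
    intro j
    have h1 : D j / u ^ 3 ≤ 15 / u := by
      rw [div_le_div_iff₀ (by positivity) hu0]
      nlinarith [mul_le_mul_of_nonneg_right (hD15 j) hu0.le]
    have h2 : 0 ≤ D j / u ^ 3 := div_nonneg (hD0 j) (by positivity)
    have h3 : 15 * tdens (F j) U / u ≤ 15 / u := by
      gcongr; linarith [tdens_le_one (F j) U]
    have h4 : 0 ≤ 15 * tdens (F j) U / u := by have := tdens_nonneg (F j) U; positivity
    have h5 : 225 / u ^ 2 ≤ 22.5 / u := by
      rw [div_le_div_iff₀ (by positivity) hu0]; nlinarith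
    have h6 : 0 ≤ 225 / u ^ 2 := by positivity
    have h7 : 300 / u = 15 / u + 15 / u + 22.5 / u + 247.5 / u := by ring
    have h8 : 0 ≤ 247.5 / u := by positivity
    have h9 : 0 ≤ 15 / u := by positivity
    rw [abs_le]; constructor <;> simp only [hz] <;> linarith
  have hstep : ∀ j ∈ J, Real.exp (l * (c j - tdens (F j) (U \ X))) ≤
      q j * (1 + l * z j + l ^ 2 * (300 / u) ^ 2) := by
    intro j _
    have h1 : Real.exp (l * (c j - tdens (F j) (U \ X))) =
        q j * Real.exp (l * (tdens (F j) U - tdens (F j) (U \ X))) := by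
      rw [hq]; simp only; rw [← Real.exp_add]; congr 1; ring
    rw [h1]
    refine mul_le_mul_of_nonneg_left ?_ (hq0 j)
    have h2 : l * (tdens (F j) U - tdens (F j) (U \ X)) ≤ l * z j :=
      mul_le_mul_of_nonneg_left (tdens_sub_le (F j) hX hX5 hU) (by linarith)
    have h3 : |l * z j| ≤ 1 := by
      rw [abs_mul, abs_of_nonneg (by linarith : (0 : ℝ) ≤ l)]
      calc l * |z j| ≤ l * (300 / u) := mul_le_mul_of_nonneg_left (hz1 j) (by linarith)
        _ = 300 * l / u := by ring
        _ ≤ 1 := div_le_one_of_le₀ hlu hu0.le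
    refine (exp_le_quadratic h2 h3).trans ?_
    have h4 : (l * z j) ^ 2 ≤ l ^ 2 * (300 / u) ^ 2 := by
      rw [mul_pow]
      refine mul_le_mul_of_nonneg_left ?_ (sq_nonneg l)
      exact sq_le_sq' (abs_le.1 (hz1 j)).1 (abs_le.1 (hz1 j)).2
    linarith
  set Q := ∑ j ∈ J, q j with hQ
  have hQ0 : 0 ≤ Q := sum_nonneg fun j _ => hq0 j
  set S := ∑ j ∈ J, q j * tdens (F j) U with hS
  have hS0 : 0 ≤ S := sum_nonneg fun j _ => mul_nonneg (hq0 j) (tdens_nonneg _ _)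
  have hSQ : S ≤ Q := sum_le_sum fun j _ => by
    have := mul_le_mul_of_nonneg_left (tdens_le_one (F j) U) (hq0 j); linarith
  set A := ∑ j ∈ J, q j * D j with hA
  -- Each triple has three incidences, so the weighted degrees over all of `U` sum to `3 * u ^ 3 *
  -- S`; lightness of `X` caps its share.
  have hA1 : A * (u / 5 - 1) ≤ 3 * u ^ 3 * S := by
    have e1 : ∑ v ∈ X, ∑ j ∈ J, q j * (triDeg (F j) U v : ℝ) = A := by
      rw [sum_comm, hA]
      exact sum_congr rfl fun j _ => by rw [hD, mul_sum]
    have e2 : ∑ v ∈ U, ∑ j ∈ J, q j * (triDeg (F j) U v : ℝ) = 3 * u ^ 3 * S := by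
      rw [sum_comm, hS, mul_sum]
      refine sum_congr rfl fun j _ => ?_
      rw [← mul_sum]
      have : ∑ v ∈ U, (triDeg (F j) U v : ℝ) = 3 * triCount (F j) U := by exact_mod_cast sum_triDeg (F j) U
      rw [this, tdens, ← hu]
      field_simp
    rw [e1, e2] at hlight
    exact hlight
  have hA2 : A / u ^ 3 ≤ 15 * S / u + 150 * S / u ^ 2 := by
    have h1 : A ≤ 3 * u ^ 3 * S / (u / 5 - 1) := (le_div_iff₀ (by linarith)).2 hA1
    have h2 : A / u ^ 3 ≤ 15 * S / (u - 5) := by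
      rw [div_le_iff₀ (by positivity)]
      refine h1.trans (le_of_eq ?_)
      have : u - 5 ≠ 0 := by linarith
      have : u / 5 - 1 = (u - 5) / 5 := by ring
      rw [this]; field_simp; ring
    refine h2.trans ?_
    have h3 : 15 * S / u + 150 * S / u ^ 2 = (15 * S * u + 150 * S) / u ^ 2 := by field_simp
    rw [h3, div_le_div_iff₀ (by linarith) (by positivity)]
    nlinarith [mul_nonneg hS0 hu0.le, mul_nonneg hS0 (by linarith : (0 : ℝ) ≤ u - 10)]
  -- The first-order terms `15 * S / u` cancel: a tile of average weight loses just what the smaller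
  -- ground set regains. An error of order `1 / u ^ 2` survives.
  have hsumz : ∑ j ∈ J, q j * z j ≤ 375 * Q / u ^ 2 := by
    have e : ∑ j ∈ J, q j * z j = A / u ^ 3 - 15 * S / u + 225 * Q / u ^ 2 := by
      rw [hA, hS, hQ, mul_sum, mul_sum, sum_div, sum_div, sum_div, ← sum_sub_distrib,
        ← sum_add_distrib]
      exact sum_congr rfl fun j _ => by simp only [hz]; ring
    have h1 : 150 * S / u ^ 2 ≤ 150 * Q / u ^ 2 := by gcongr
    have h2 : 375 * Q / u ^ 2 = 150 * Q / u ^ 2 + 225 * Q / u ^ 2 := by ring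
    linarith
  calc ∑ j ∈ J, Real.exp (l * (c j - tdens (F j) (U \ X)))
      ≤ ∑ j ∈ J, q j * (1 + l * z j + l ^ 2 * (300 / u) ^ 2) := sum_le_sum hstep
    _ = Q + l * ∑ j ∈ J, q j * z j + l ^ 2 * (300 / u) ^ 2 * Q := by
        rw [mul_sum, hQ, mul_sum, ← sum_add_distrib, ← sum_add_distrib]
        exact sum_congr rfl fun j _ => by ring
    _ ≤ Q + l * (375 * Q / u ^ 2) + l ^ 2 * (300 / u) ^ 2 * Q := by gcongr
    _ ≤ Q * (1 + 100000 * l ^ 2 / u ^ 2) := by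
        have h1 : l * (375 * Q / u ^ 2) ≤ l ^ 2 * (375 * Q / u ^ 2) := by
          refine mul_le_mul_of_nonneg_right ?_ (by positivity)
          nlinarith
        have h2 : Q * (1 + 100000 * l ^ 2 / u ^ 2) = Q + l ^ 2 * (375 * Q / u ^ 2) +
            l ^ 2 * (300 / u) ^ 2 * Q + 9625 * l ^ 2 * Q / u ^ 2 := by
          field_simp; ring
        have h3 : 0 ≤ 9625 * l ^ 2 * Q / u ^ 2 := by positivity
        linarith

end Counting

/-! ### Almost perfect tilings away from the extremal configuration. -/

namespace TriGraph

variable {V : Type u} {G : TriGraph V}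

/-- Repeated removal of light tiles, while the densities of all families `F j` stay close to their
initial values. -/
theorem exists_almost_til_of_light {ι : Type*} (J : Finset ι) (F : ι → Finset (V × V × V))
    {U₀ : Finset V} {ε κ l : ℝ} (hε : 0 < ε) (hl : 1 ≤ l)
    (hlu : 300 * l ≤ ε * U₀.card) (hpos : 0 < U₀.card)
    (hpar : (J.card : ℝ) * Real.exp (100000 * l ^ 2 / (ε * U₀.card) ^ 2 * U₀.card) ≤
      Real.exp (l * κ))
    (hlight : ∀ U ⊆ U₀, ε * U₀.card ≤ U.card →
      (∀ j ∈ J, tdens (F j) U₀ - κ ≤ tdens (F j) U) → ∀ ω : V → ℝ, (∀ v, 0 ≤ ω v) →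
      ∃ X ⊆ U, G.TSet X ∧ (∑ v ∈ X, ω v) * (U.card / 5 - 1) ≤ ∑ v ∈ U, ω v) :
    ∃ W ⊆ U₀, (W.card : ℝ) ≤ ε * U₀.card ∧ G.Til (U₀ \ W) := by
  by_contra hcon
  set θ : ℝ := 100000 * l ^ 2 / (ε * U₀.card) ^ 2 with hθ
  have hu0 : (0 : ℝ) < U₀.card := by exact_mod_cast hpos
  have hθ0 : 0 ≤ θ := by positivity
  have key : ∀ i : ℕ, ∃ U ⊆ U₀, U.card + 5 * i = U₀.card ∧ G.Til (U₀ \ U) ∧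
      ∑ j ∈ J, Real.exp (l * (tdens (F j) U₀ - tdens (F j) U)) ≤ J.card * (1 + θ) ^ i := by
    intro i
    induction i with
    | zero =>
      refine ⟨U₀, subset_rfl, by simp, by simpa using Til.empty, ?_⟩
      simp
    | succ i ih =>
      obtain ⟨U, hU, hcard, htil, hpot⟩ := ih
      have hbig : ε * U₀.card ≤ U.card := by
        by_contra h
        exact hcon ⟨U, hU, (not_le.1 h).le, htil⟩
      have hi : (i : ℝ) ≤ U₀.card := by exact_mod_cast (by omega : i ≤ U₀.card)
      -- There are at most `|U₀|` steps, so the potential has grown by a factor of at most `exp (θ *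
      -- |U₀|)`.
      have hbound : J.card * (1 + θ) ^ i ≤ Real.exp (l * κ) := by
        refine le_trans ?_ hpar
        refine mul_le_mul_of_nonneg_left ?_ (Nat.cast_nonneg _)
        calc (1 + θ) ^ i ≤ Real.exp θ ^ i :=
              pow_le_pow_left₀ (by positivity) (by linarith [Real.add_one_le_exp θ]) i
          _ = Real.exp (i * θ) := (Real.exp_nat_mul θ i).symm
          _ ≤ Real.exp (θ * U₀.card) := by
              rw [Real.exp_le_exp, mul_comm]; exact mul_le_mul_of_nonneg_left hi hθ0
      -- A single density falling by more than `κ` would push its own summand beyond the bound for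
      -- the whole potential.
      have hdens : ∀ j ∈ J, tdens (F j) U₀ - κ ≤ tdens (F j) U := by
        intro j hj
        have h1 : Real.exp (l * (tdens (F j) U₀ - tdens (F j) U)) ≤ Real.exp (l * κ) :=
          (single_le_sum (f := fun j => Real.exp (l * (tdens (F j) U₀ - tdens (F j) U)))
            (fun _ _ => (Real.exp_pos _).le) hj).trans (hpot.trans hbound)
        have h2 := le_of_mul_le_mul_left (Real.exp_le_exp.1 h1) (by linarith)
        linarith
      obtain ⟨X, hX, hTX, hXl⟩ := hlight U hU hbig hdens
        (fun v => ∑ j ∈ J, Real.exp (l * (tdens (F j) U₀ - tdens (F j) U)) * triDeg (F j) U v)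
        (fun v => sum_nonneg fun j _ => by positivity)
      have hstep := potential_step J F hX hTX.card (by linarith) hl (by linarith)
        (fun j => tdens (F j) U₀) hXl
      refine ⟨U \ X, sdiff_subset.trans hU, ?_, ?_, hstep.trans ?_⟩
      · rw [card_sdiff_of_subset hX, hTX.card]
        have := card_le_card hX
        rw [hTX.card] at this
        omega
      · have : U₀ \ (U \ X) = X ∪ (U₀ \ U) := by
          ext v; simp only [mem_sdiff, mem_union]
          have h1 := @hX v; have h2 := @hU v; tauto
        rw [this]
        exact Til.add hTX htil (disjoint_sdiff.mono_left hX)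
      · have h1 : 100000 * l ^ 2 / (U.card : ℝ) ^ 2 ≤ θ := by
          rw [hθ]
          gcongr
        calc (∑ j ∈ J, Real.exp (l * (tdens (F j) U₀ - tdens (F j) U))) *
              (1 + 100000 * l ^ 2 / (U.card : ℝ) ^ 2)
            ≤ (J.card * (1 + θ) ^ i) * (1 + θ) := by
              gcongr
          _ = _ := by ring
  -- After `|U₀|` steps five times as many vertices as exist would have been removed.
  obtain ⟨U, _, h, _⟩ := key U₀.card
  omega

variable [Fintype V]

/-- The families of triples whose densities record codegrees and distance from the extremal
configuration. -/
noncomputable def famTri (G : TriGraph V) : V × V × Bool → Finset (V × V × V)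
  | (x, y, true) => G.nb x y ×ˢ univ ×ˢ univ
  | (x, y, false) => G.tri (univ \ G.nb x y)

/-- The two free coordinates cancel against `|U| ^ 2`, so codegrees and edge counts can be tracked
by one notion of density of triples. -/
theorem tdens_famTri_true (x y : V) {U : Finset V} (hU : 0 < U.card) :
    tdens (G.famTri (x, y, true)) U = (G.nb x y ∩ U).card / U.card := by
  have h : (G.famTri (x, y, true)).filter (fun t => t.1 ∈ U ∧ t.2.1 ∈ U ∧ t.2.2 ∈ U) =
      (G.nb x y ∩ U) ×ˢ U ×ˢ U := by
    ext t; simp only [famTri, mem_filter, mem_product, mem_univ, mem_inter]; tauto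
  have hu : (0 : ℝ) < U.card := by exact_mod_cast hU
  rw [tdens, triCount, h]
  simp only [card_product]
  push_cast
  field_simp

theorem tdens_famTri_false (x y : V) (U : Finset V) :
    tdens (G.famTri (x, y, false)) U = (G.tri (U \ G.nb x y)).card / (U.card : ℝ) ^ 3 := by
  have h : (G.famTri (x, y, false)).filter (fun t => t.1 ∈ U ∧ t.2.1 ∈ U ∧ t.2.2 ∈ U) =
      G.tri (U \ G.nb x y) := by
    ext t; simp only [famTri, mem_filter, mem_tri, mem_sdiff, mem_univ]; tauto
  rw [tdens, triCount, h]

/-- Away from the extremal configuration there is a tiling covering almost all vertices. -/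
theorem exists_almost_til {ζ ε : ℝ} (hζ0 : 0 < ζ) (hζ : ζ ≤ 1 / 1000) (hε : 0 < ε) :
    ∃ N : ℕ, ∀ (V : Type u) [Fintype V] (G : TriGraph V) (U : Finset V), N ≤ U.card →
      (∀ x ∈ U, ∀ y ∈ U, x ≠ y → (2 / 5 - ζ / 20) * U.card ≤ ((G.nb x y ∩ U).card : ℝ)) →
      (∀ x ∈ U, ∀ y ∈ U, x ≠ y → (2 / 5 + 200 * ζ) * U.card ≤ ((G.nb x y ∩ U).card : ℝ) ∨
        200 * ζ * U.card ^ 3 ≤ ((G.tri (U \ G.nb x y)).card : ℝ)) →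
      ∃ W ⊆ U, (W.card : ℝ) ≤ ε * U.card ∧ G.Til (U \ W) := by
  set κ : ℝ := ζ / 20 with hκ
  have hκ0 : 0 < κ := by positivity
  -- The estimate `exp t ≥ t ^ 6 / 6!` at `t = κ * √u` is cubic in `u`. Beyond `K` it beats the at
  -- most `2 * u ^ 2` summands times the total growth `exp (100000 / ε ^ 2)`.
  set K : ℝ := 2 * Real.exp (100000 / ε ^ 2) * 720 / κ ^ 6 with hK
  obtain ⟨N, hN⟩ := exists_nat_ge (max (max K (1000 / (ζ * ε))) (max ((300 / ε) ^ 2) 1))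
  refine ⟨N, fun V _ G U hNU hcod hext => ?_⟩
  have hNU' : (N : ℝ) ≤ U.card := by exact_mod_cast hNU
  simp only [max_le_iff] at hN
  obtain ⟨⟨hN1, hN2⟩, hN3, hN4⟩ := hN
  set u : ℝ := (U.card : ℝ) with hu
  have hu1 : 1 ≤ u := hN4.trans hNU'
  have hu0 : 0 < u := by linarith
  have hpos : 0 < U.card := by rw [hu] at hu0; exact_mod_cast hu0
  have hsq : Real.sqrt u ^ 2 = u := Real.sq_sqrt hu0.le
  have hs1 : 1 ≤ Real.sqrt u := Real.one_le_sqrt.2 hu1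
  have hζε : 1000 ≤ ζ * (ε * u) := by
    have := (div_le_iff₀ (by positivity)).1 (hN2.trans hNU')
    linarith
  set J : Finset (V × V × Bool) := (U ×ˢ U ×ˢ univ).filter fun p => p.1 ≠ p.2.1 with hJ
  have hJc : (J.card : ℝ) ≤ 2 * u ^ 2 := by
    have : J.card ≤ (U ×ˢ U ×ˢ (univ : Finset Bool)).card := card_filter_le _ _
    simp only [card_product, card_univ, Fintype.card_bool] at this
    have : (J.card : ℝ) ≤ u * (u * 2) := by rw [hu]; exact_mod_cast this
    linarith
  -- With `l = √u` the accumulated second-order growth is a constant, whereas the permitted exponent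
  -- `l * κ` still tends to infinity.
  refine exists_almost_til_of_light J G.famTri hε hs1 ?_ hpos (κ := κ) ?_ ?_
  · have h1 : 300 / ε ≤ Real.sqrt u := Real.le_sqrt_of_sq_le (hN3.trans hNU')
    have h2 : 300 ≤ Real.sqrt u * ε := (div_le_iff₀ hε).1 h1
    calc 300 * Real.sqrt u ≤ (Real.sqrt u * ε) * Real.sqrt u := by gcongr
      _ = ε * Real.sqrt u ^ 2 := by ring
      _ = ε * u := by rw [hsq]
  · rw [hsq]
    have e1 : 100000 * u / (ε * u) ^ 2 * u = 100000 / ε ^ 2 := by field_simp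
    rw [e1]
    have h1 := Real.pow_div_factorial_le_exp (Real.sqrt u * κ) (by positivity) 6
    refine le_trans ?_ h1
    have e2 : (Real.sqrt u * κ) ^ 6 = u ^ 3 * κ ^ 6 := by
      rw [mul_pow, show Real.sqrt u ^ 6 = (Real.sqrt u ^ 2) ^ 3 by ring, hsq]
    have e3 : ((6 : ℕ).factorial : ℝ) = 720 := by norm_num [Nat.factorial]
    rw [e2, e3, le_div_iff₀ (by norm_num)]
    have h2 : K ≤ u := hN1.trans hNU'
    rw [hK, div_le_iff₀ (by positivity)] at h2
    calc (J.card : ℝ) * Real.exp (100000 / ε ^ 2) * 720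
        ≤ (2 * u ^ 2) * Real.exp (100000 / ε ^ 2) * 720 := by gcongr
      _ = u ^ 2 * (2 * Real.exp (100000 / ε ^ 2) * 720) := by ring
      _ ≤ u ^ 2 * (u * κ ^ 6) := by gcongr
      _ = _ := by ring
  · intro U' hU' hbig hdens ω hω
    set u' : ℝ := (U'.card : ℝ) with hu'
    have hu'0 : 0 < u' := lt_of_lt_of_le (by positivity) hbig
    have hpos' : 0 < U'.card := by rw [hu'] at hu'0; exact_mod_cast hu'0
    have hmem : ∀ x ∈ U', ∀ y ∈ U', x ≠ y → ∀ b, (x, y, b) ∈ J := by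
      intro x hx y hy hxy b
      simp [hJ, hU' hx, hU' hy, hxy]
    -- The codegree defect `ζ / 10` is the initial `ζ / 20` plus the drift `κ = ζ / 20`; the drop
    -- from `200 * ζ` to `100 * ζ` leaves ample room for the other conditions.
    refine exists_light_tile (γ := ζ / 10) (ζ := ζ) (by positivity) le_rfl hζ ?_ ?_ ?_ hω
    · rw [← hu']; nlinarith
    · intro x hx y hy hxy
      have h1 := hdens _ (hmem x hx y hy hxy true)
      rw [tdens_famTri_true x y hpos, tdens_famTri_true x y hpos'] at h1
      have h2 := (le_div_iff₀ hu0).2 (hcod x (hU' hx) y (hU' hy) hxy)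
      have h3 : 2 / 5 - ζ / 10 ≤ (G.nb x y ∩ U').card / u' := by linarith
      exact (le_div_iff₀ hu'0).1 h3
    · intro x hx y hy hxy
      rcases hext x (hU' hx) y (hU' hy) hxy with h | h
      · left
        have h1 := hdens _ (hmem x hx y hy hxy true)
        rw [tdens_famTri_true x y hpos, tdens_famTri_true x y hpos'] at h1
        have h2 := (le_div_iff₀ hu0).2 h
        have h3 : 2 / 5 + 100 * ζ < (G.nb x y ∩ U').card / u' := by linarith
        exact (lt_div_iff₀ hu'0).1 h3
      · right
        have h1 := hdens _ (hmem x hx y hy hxy false)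
        rw [tdens_famTri_false, tdens_famTri_false] at h1
        have h2 := (le_div_iff₀ (by positivity)).2 h
        have h3 : 100 * ζ < (G.tri (U' \ G.nb x y)).card / u' ^ 3 := by linarith
        exact (lt_div_iff₀ (by positivity)).1 h3

end TriGraph

/-! ### Dense families of vertex sets. -/

section Families

variable {V : Type u} [Fintype V]

theorem card_sets_le_pow (𝒜 : Finset (Finset V)) {t : ℕ} (h : ∀ A ∈ 𝒜, A.card = t) :
    𝒜.card ≤ Fintype.card V ^ t := by
  have : 𝒜 ⊆ powersetCard t univ := fun A hA => mem_powersetCard.2 ⟨subset_univ _, h A hA⟩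
  refine (card_le_card this).trans ?_
  rw [card_powersetCard, card_univ]
  exact Nat.choose_le_pow _ _

/-- A set meeting `F` contains one of its vertices, and the remaining `t - 1` vertices are chosen in
at most `n ^ (t - 1)` ways. The factor `n` on the left avoids the truncated exponent. -/
theorem card_meeting_le (𝒜 : Finset (Finset V)) {t : ℕ} (h : ∀ A ∈ 𝒜, A.card = t) (F : Finset V) :
    Fintype.card V * (𝒜.filter fun A => ¬ Disjoint A F).card ≤ F.card * Fintype.card V ^ t := by
  cases t with
  | zero =>
    have : (𝒜.filter fun A => ¬ Disjoint A F) = ∅ := by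
      refine filter_eq_empty_iff.2 fun A hA => ?_
      rw [card_eq_zero.1 (h A hA)]; simp
    rw [this]; simp
  | succ t =>
    have hsub : (𝒜.filter fun A => ¬ Disjoint A F) ⊆
        F.biUnion fun v => 𝒜.filter fun A => v ∈ A := by
      intro A hA
      rw [mem_filter, not_disjoint_iff] at hA
      obtain ⟨hA, v, hvA, hvF⟩ := hA
      exact mem_biUnion.2 ⟨v, hvF, mem_filter.2 ⟨hA, hvA⟩⟩
    have h2 : ∀ v ∈ F, (𝒜.filter fun A => v ∈ A).card ≤ Fintype.card V ^ t := by
      intro v _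
      have hinj : Set.InjOn (fun A : Finset V => A.erase v) (𝒜.filter fun A => v ∈ A) := by
        intro A hA B hB hAB
        have hA := (mem_filter.1 hA).2
        have hB := (mem_filter.1 hB).2
        rw [← insert_erase hA, ← insert_erase hB]
        exact congrArg _ hAB
      rw [← card_image_of_injOn hinj]
      refine card_sets_le_pow _ fun A hA => ?_
      obtain ⟨B, hB, rfl⟩ := mem_image.1 hA
      rw [mem_filter] at hB
      rw [card_erase_of_mem hB.2, h B hB.1]; rfl
    calc Fintype.card V * (𝒜.filter fun A => ¬ Disjoint A F).card
        ≤ Fintype.card V * (F.card * Fintype.card V ^ t) :=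
          Nat.mul_le_mul_left _ ((card_le_card hsub).trans (card_biUnion_le_card_mul _ _ _ h2))
      _ = _ := by ring

/-- A dense family of `t`-sets has many members avoiding a given small set. -/
theorem card_avoiding_ge (𝒜 : Finset (Finset V)) {t : ℕ} (h : ∀ A ∈ 𝒜, A.card = t) (F : Finset V)
    {β : ℝ} (hβ : β * (Fintype.card V : ℝ) ^ t ≤ 𝒜.card)
    (hF : 2 * (F.card : ℝ) ≤ β * Fintype.card V) (hn : 0 < Fintype.card V) :
    β / 2 * (Fintype.card V : ℝ) ^ t ≤ (𝒜.filter fun A => Disjoint A F).card := by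
  have h1 := card_meeting_le 𝒜 h F
  have h2 : (𝒜.filter fun A => Disjoint A F).card + (𝒜.filter fun A => ¬ Disjoint A F).card =
    𝒜.card := card_filter_add_card_filter_not _
  set n : ℝ := (Fintype.card V : ℝ) with hndef
  have hn0 : 0 < n := by rw [hndef]; exact_mod_cast hn
  have h3 : n * ((𝒜.filter fun A => ¬ Disjoint A F).card : ℝ) ≤ F.card * n ^ t := by
    rw [hndef]; exact_mod_cast h1
  have h4 : ((𝒜.filter fun A => Disjoint A F).card : ℝ) +
    (𝒜.filter fun A => ¬ Disjoint A F).card = 𝒜.card := by exact_mod_cast h2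
  have h5 : n * ((𝒜.filter fun A => ¬ Disjoint A F).card : ℝ) ≤ n * (β / 2 * n ^ t) := by
    refine h3.trans ?_
    have : (F.card : ℝ) * n ^ t ≤ (β * n / 2) * n ^ t := by gcongr; linarith
    linarith
  have h6 := le_of_mul_le_mul_left h5 hn0
  linarith

/-- Disjoint unions of members of dense families form a dense family. -/
theorem card_combine_ge {s t : ℕ} {α β : ℝ}
    (𝒜 : Finset (Finset V)) (hs : ∀ A ∈ 𝒜, A.card = s)
    (hα : α * (Fintype.card V : ℝ) ^ s ≤ 𝒜.card) (ℬ : Finset V → Finset (Finset V))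
    (ht : ∀ A ∈ 𝒜, ∀ B ∈ ℬ A, B.card = t)
    (hβ : ∀ A ∈ 𝒜, β * (Fintype.card V : ℝ) ^ t ≤ (ℬ A).card) (hβ0 : 0 ≤ β)
    (F : Finset V) (hF : 2 * ((s : ℝ) + F.card) ≤ β * Fintype.card V) (hn : 0 < Fintype.card V)
    (𝒞 : Finset (Finset V))
    (h : ∀ A ∈ 𝒜, ∀ B ∈ ℬ A, Disjoint A B → Disjoint B F → A ∪ B ∈ 𝒞) :
    α * β / 2 ^ (s + t + 1) * (Fintype.card V : ℝ) ^ (s + t) ≤ 𝒞.card := by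
  set n : ℝ := (Fintype.card V : ℝ) with hndef
  set P : Finset (Finset V × Finset V) := 𝒜.biUnion fun A =>
    ((ℬ A).filter fun B => Disjoint B (A ∪ F)).image fun B => (A, B) with hP
  have hPmem : ∀ p ∈ P, p.1 ∈ 𝒜 ∧ p.2 ∈ ℬ p.1 ∧ Disjoint p.2 (p.1 ∪ F) := by
    intro p hp
    simp only [hP, mem_biUnion, mem_image, mem_filter] at hp
    obtain ⟨A, hA, B, hB, rfl⟩ := hp
    exact ⟨hA, hB.1, hB.2⟩
  have hPcard : α * n ^ s * (β / 2 * n ^ t) ≤ P.card := by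
    rw [hP, card_biUnion]
    · push_cast
      calc α * n ^ s * (β / 2 * n ^ t) ≤ 𝒜.card * (β / 2 * n ^ t) := by gcongr
        _ = ∑ A ∈ 𝒜, β / 2 * n ^ t := by rw [sum_const, nsmul_eq_mul]
        _ ≤ _ := sum_le_sum fun A hA => by
          rw [card_image_of_injective _ (fun B B' h => (Prod.mk.inj h).2)]
          refine card_avoiding_ge (ℬ A) (ht A hA) (A ∪ F) (hβ A hA) ?_ hn
          refine le_trans ?_ hF
          have : (A ∪ F).card ≤ s + F.card := by
            rw [← hs A hA]; exact card_union_le _ _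
          have : ((A ∪ F).card : ℝ) ≤ s + F.card := by exact_mod_cast this
          linarith
    · intro A _ A' _ hne
      rw [Function.onFun, disjoint_left]
      rintro p hp hp'
      obtain ⟨B, _, rfl⟩ := mem_image.1 hp
      obtain ⟨B', _, h'⟩ := mem_image.1 hp'
      exact hne (Prod.mk.inj h').1.symm
  have hmaps : ∀ p ∈ P, p.1 ∪ p.2 ∈ 𝒞 := by
    intro p hp
    obtain ⟨h1, h2, h3⟩ := hPmem p hp
    rw [disjoint_union_right] at h3
    exact h _ h1 _ h2 h3.1.symm h3.2
  -- Within a given union `C` the first set determines the second as its complement, so at most `2 ^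
  -- (s + t)` pairs have the same union.
  have hfib : ∀ C ∈ 𝒞, (P.filter fun p => p.1 ∪ p.2 = C).card ≤ 2 ^ (s + t) := by
    intro C _
    by_cases hemp : (P.filter fun p => p.1 ∪ p.2 = C) = ∅
    · rw [hemp]; simp
    have hC : C.card = s + t := by
      obtain ⟨p, hp⟩ := nonempty_of_ne_empty hemp
      rw [mem_filter] at hp
      obtain ⟨h1, h2, h3⟩ := hPmem p hp.1
      rw [disjoint_union_right] at h3
      rw [← hp.2, card_union_of_disjoint h3.1.symm, hs _ h1, ht _ h1 _ h2]
    rw [← hC, ← card_powerset]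
    refine card_le_card_of_injOn Prod.fst ?_ ?_
    · intro p hp
      rw [mem_coe, mem_filter] at hp
      rw [mem_coe, mem_powerset, ← hp.2]; exact subset_union_left
    · intro p hp q hq hpq
      rw [mem_coe, mem_filter] at hp hq
      have h3 := (disjoint_union_right.1 (hPmem p hp.1).2.2).1
      have h4 := (disjoint_union_right.1 (hPmem q hq.1).2.2).1
      refine Prod.ext hpq ?_
      have e1 : p.2 = C \ p.1 := by rw [← hp.2, union_sdiff_left, sdiff_eq_self_of_disjoint h3]
      have e2 : q.2 = C \ q.1 := by rw [← hq.2, union_sdiff_left, sdiff_eq_self_of_disjoint h4]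
      rw [e1, e2, hpq]
  have hle : P.card ≤ 2 ^ (s + t) * 𝒞.card :=
    card_le_mul_card_image_of_maps_to hmaps _ hfib
  have hle' : (P.card : ℝ) ≤ 2 ^ (s + t) * 𝒞.card := by exact_mod_cast hle
  have : α * β / 2 ^ (s + t + 1) * n ^ (s + t) = α * n ^ s * (β / 2 * n ^ t) / 2 ^ (s + t) := by
    rw [pow_add n, pow_succ]; field_simp
  rw [this, div_le_iff₀ (by positivity)]
  linarith

end Families

/-! ### Switchers and absorbers. -/

namespace TriGraph

variable {V : Type u} [Fintype V]

/-- The `t`-sets that form a tileable set both with `L` and with `X`. -/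
noncomputable def switchers (G : TriGraph V) (t : ℕ) (L X : Finset V) : Finset (Finset V) :=
  univ.filter fun A => A.card = t ∧ Disjoint A L ∧ Disjoint A X ∧ G.Til (A ∪ L) ∧ G.Til (A ∪ X)

/-- The vertex sets of the generalised triangles. -/
noncomputable def tSets (G : TriGraph V) : Finset (Finset V) := univ.filter G.TSet

/-- The `75`-sets that are tileable and remain so together with `L`. -/
noncomputable def absorbers (G : TriGraph V) (L : Finset V) : Finset (Finset V) :=
  univ.filter fun A => A.card = 75 ∧ Disjoint A L ∧ G.Til A ∧ G.Til (A ∪ L)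

variable {G : TriGraph V}

@[simp] theorem mem_switchers {t : ℕ} {L X A : Finset V} : A ∈ G.switchers t L X ↔
    A.card = t ∧ Disjoint A L ∧ Disjoint A X ∧ G.Til (A ∪ L) ∧ G.Til (A ∪ X) := by
  simp [switchers]

@[simp] theorem mem_tSets {A : Finset V} : A ∈ G.tSets ↔ G.TSet A := by simp [tSets]

@[simp] theorem mem_absorbers {L A : Finset V} : A ∈ G.absorbers L ↔
    A.card = 75 ∧ Disjoint A L ∧ G.Til A ∧ G.Til (A ∪ L) := by
  simp [absorbers]

/-- If `A` switches `l` with `y` and `B` switches `y` with `x`, then `A ∪ {y} ∪ B` switches `l` with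
`x`: tile `A ∪ {l}` and `B ∪ {y}`, or `A ∪ {y}` and `B ∪ {x}`. A linear number of middle vertices
`y` keeps the family dense in its new size `s + t + 1`. -/
theorem switchers_chain {s t : ℕ} {ρ β β' : ℝ} (hβ0 : 0 ≤ β) (hβ'0 : 0 ≤ β')
    {l x : V} (Y : Finset V) (hlY : l ∉ Y) (hxY : x ∉ Y)
    (hY : ρ * Fintype.card V ≤ Y.card)
    (h1 : ∀ y ∈ Y, β * (Fintype.card V : ℝ) ^ s ≤ (G.switchers s {l} {y}).card)
    (h2 : ∀ y ∈ Y, β' * (Fintype.card V : ℝ) ^ t ≤ (G.switchers t {y} {x}).card)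
    (hn1 : 4 ≤ β * Fintype.card V) (hn2 : 2 * ((s : ℝ) + 2) ≤ β' * Fintype.card V)
    (hn : 0 < Fintype.card V) :
    ρ * β / 2 ^ (s + 2) * β' / 2 ^ (s + t + 2) * (Fintype.card V : ℝ) ^ (s + t + 1) ≤
      (G.switchers (s + t + 1) {l} {x}).card := by
  set 𝒞 : Finset (Finset V) := univ.filter fun C => C.card = s + 1 ∧ x ∉ C ∧
    ∃ y ∈ Y, y ∈ C ∧ C.erase y ∈ G.switchers s {l} {y} with h𝒞
  -- The first family consists of the singletons `{y}`; the conditional union merely recovers `y`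
  -- from `{y}`.
  have hfirst : ρ * β / 2 ^ (1 + s + 1) * (Fintype.card V : ℝ) ^ (1 + s) ≤ 𝒞.card := by
    refine card_combine_ge (Y.image fun y => ({y} : Finset V)) ?_ ?_
      (fun A => Y.biUnion fun y => if A = {y} then G.switchers s {l} {y} else ∅) ?_ ?_ hβ0 {x}
      ?_ hn 𝒞 ?_
    · intro A hA
      obtain ⟨y, _, rfl⟩ := mem_image.1 hA
      simp
    · rw [card_image_of_injective _ singleton_injective]; simpa using hY
    · intro A _ B hB
      obtain ⟨y, _, hB⟩ := mem_biUnion.1 hB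
      split_ifs at hB with h
      · exact (mem_switchers.1 hB).1
      · simp at hB
    · intro A hA
      obtain ⟨y, hy, rfl⟩ := mem_image.1 hA
      refine (h1 y hy).trans ?_
      have : G.switchers s {l} {y} ⊆ Y.biUnion fun y' => if ({y} : Finset V) = {y'} then
          G.switchers s {l} {y'} else ∅ := by
        intro B hB
        exact mem_biUnion.2 ⟨y, hy, by rw [if_pos rfl]; exact hB⟩
      exact_mod_cast card_le_card this
    · simp; linarith
    · intro A hA B hB hAB hBF
      obtain ⟨y, hy, rfl⟩ := mem_image.1 hA
      obtain ⟨y', hy', hB⟩ := mem_biUnion.1 hB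
      split_ifs at hB with h
      swap
      · simp at hB
      rw [singleton_inj] at h
      subst h
      have hyB : y ∉ B := by simpa using hAB
      have hBc := (mem_switchers.1 hB).1
      have he : (({y} : Finset V) ∪ B).erase y = B := by
        rw [singleton_union, erase_insert hyB]
      rw [h𝒞, mem_filter]
      refine ⟨mem_univ _, ?_, ?_, y, hy, by simp, ?_⟩
      · rw [card_union_of_disjoint hAB, hBc, card_singleton]; ring
      · rw [mem_union, mem_singleton, not_or]
        exact ⟨fun h => hxY (h ▸ hy), by simpa using hBF⟩
      · rw [he]; exact hB
  have hch : ∀ C ∈ 𝒞, ∃ y ∈ Y, y ∈ C ∧ C.erase y ∈ G.switchers s {l} {y} := fun C hC =>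
    (mem_filter.1 hC).2.2.2
  have : Nonempty V := ⟨l⟩
  choose! f hf using hch
  have := card_combine_ge (α := ρ * β / 2 ^ (1 + s + 1)) (β := β') (s := 1 + s) (t := t) 𝒞
    (fun C hC => by rw [(mem_filter.1 hC).2.1]; ring) hfirst
    (fun C => G.switchers t {f C} {x}) (fun C hC B hB => (mem_switchers.1 hB).1)
    (fun C hC => h2 _ (hf C hC).1) hβ'0 {l} ?_ hn (G.switchers (s + t + 1) {l} {x}) ?_
  · have e1 : 1 + s + 1 = s + 2 := by ring
    have e2 : 1 + s + t = s + t + 1 := by ring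
    rw [e1, e2] at this
    exact this
  · rw [card_singleton]; push_cast; linarith
  · intro C hC B hB hCB hBl
    obtain ⟨hyY, hyC, hsw⟩ := hf C hC
    set y := f C
    have hC' := (mem_filter.1 hC).2
    rw [mem_switchers] at hsw hB ⊢
    obtain ⟨a1, a2, a3, a4, a5⟩ := hsw
    obtain ⟨b1, b2, b3, b4, b5⟩ := hB
    set A := C.erase y with hA
    have hCA : C = insert y A := (insert_erase hyC).symm
    have hyA : y ∉ A := notMem_erase y C
    simp only [disjoint_singleton_right] at a2 a3 b2 b3 hBl
    have hly : l ≠ y := fun h => hlY (h ▸ hyY)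
    have hxy : x ≠ y := fun h => hxY (h ▸ hyY)
    have hxC := hC'.2.1
    have hxA : x ∉ A := fun h => hxC (mem_of_mem_erase h)
    have hAB : Disjoint A B := disjoint_of_subset_left (erase_subset _ _) hCB
    refine ⟨?_, ?_, ?_, ?_, ?_⟩
    · rw [card_union_of_disjoint hCB, hC'.1, b1]; ring
    · rw [disjoint_singleton_right, mem_union, not_or]
      refine ⟨?_, hBl⟩
      rw [hCA, mem_insert, not_or]; exact ⟨hly, a2⟩
    · rw [disjoint_singleton_right, mem_union, not_or]; exact ⟨hxC, b3⟩
    · have : C ∪ B ∪ {l} = (A ∪ {l}) ∪ (B ∪ {y}) := by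
        rw [hCA]; ext v; simp only [mem_union, mem_insert, mem_singleton]; tauto
      rw [this]
      refine a4.union b4 ?_
      rw [disjoint_union_left, disjoint_union_right, disjoint_union_right]
      simp only [disjoint_singleton_right, disjoint_singleton_left, mem_singleton]
      exact ⟨⟨hAB, hyA⟩, hBl, hly.symm⟩
    · have : C ∪ B ∪ {x} = (A ∪ {y}) ∪ (B ∪ {x}) := by
        rw [hCA]; ext v; simp only [mem_union, mem_insert, mem_singleton]; tauto
      rw [this]
      refine a5.union b5 ?_
      rw [disjoint_union_left, disjoint_union_right, disjoint_union_right]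
      simp only [disjoint_singleton_right, disjoint_singleton_left, mem_singleton]
      exact ⟨⟨hAB, hxA⟩, b2, hxy⟩

/-- A disjoint tile can be added to a switcher without affecting its property. Steps of five bring
switchers from chains of different lengths (`4`, `9` and `14`) to the common size `14`. -/
theorem switchers_pad {t : ℕ} {β τ : ℝ} (hτ0 : 0 ≤ τ) {L X : Finset V}
    (h1 : β * (Fintype.card V : ℝ) ^ t ≤ (G.switchers t L X).card)
    (h2 : τ * (Fintype.card V : ℝ) ^ 5 ≤ G.tSets.card)
    (hn' : 2 * ((t : ℝ) + (L ∪ X).card) ≤ τ * Fintype.card V) (hn : 0 < Fintype.card V) :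
    β * τ / 2 ^ (t + 5 + 1) * (Fintype.card V : ℝ) ^ (t + 5) ≤
      (G.switchers (t + 5) L X).card := by
  refine card_combine_ge (G.switchers t L X) (fun A hA => (mem_switchers.1 hA).1) h1
    (fun _ => G.tSets) (fun _ _ B hB => (mem_tSets.1 hB).card) (fun _ _ => h2) hτ0 (L ∪ X) hn' hn
    _ ?_
  intro A hA B hB hAB hBF
  rw [mem_switchers] at hA ⊢
  rw [mem_tSets] at hB
  rw [disjoint_union_right] at hBF
  obtain ⟨a1, a2, a3, a4, a5⟩ := hA
  refine ⟨by rw [card_union_of_disjoint hAB, a1, hB.card], disjoint_union_left.2 ⟨a2, hBF.1⟩,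
    disjoint_union_left.2 ⟨a3, hBF.2⟩, ?_, ?_⟩
  · have : A ∪ B ∪ L = B ∪ (A ∪ L) := by ext v; simp only [mem_union]; tauto
    rw [this]
    exact Til.add hB a4 (disjoint_union_right.2 ⟨hAB.symm, hBF.1⟩)
  · have : A ∪ B ∪ X = B ∪ (A ∪ X) := by ext v; simp only [mem_union]; tauto
    rw [this]
    exact Til.add hB a5 (disjoint_union_right.2 ⟨hAB.symm, hBF.2⟩)

/-- Disjoint switchers act independently. Both avoidance steps are needed: the first set must miss
`L' ∪ X'` and the second must miss `L ∪ X`. -/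
theorem switchers_union {s t : ℕ} {α β : ℝ} (hβ0 : 0 ≤ β) {L X L' X' : Finset V}
    (h1 : α * (Fintype.card V : ℝ) ^ s ≤ (G.switchers s L X).card)
    (h2 : β * (Fintype.card V : ℝ) ^ t ≤ (G.switchers t L' X').card)
    (hdis : Disjoint (L ∪ X) (L' ∪ X'))
    (hn1 : 2 * ((L' ∪ X').card : ℝ) ≤ α * Fintype.card V)
    (hn2 : 2 * ((s : ℝ) + (L ∪ X).card) ≤ β * Fintype.card V) (hn : 0 < Fintype.card V) :
    α / 2 * β / 2 ^ (s + t + 1) * (Fintype.card V : ℝ) ^ (s + t) ≤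
      (G.switchers (s + t) (L ∪ L') (X ∪ X')).card := by
  have h3 := card_avoiding_ge (G.switchers s L X) (fun A hA => (mem_switchers.1 hA).1) (L' ∪ X')
    h1 hn1 hn
  refine card_combine_ge _ (fun A hA => (mem_switchers.1 (mem_filter.1 hA).1).1) h3
    (fun _ => G.switchers t L' X') (fun _ _ B hB => (mem_switchers.1 hB).1) (fun _ _ => h2) hβ0
    (L ∪ X) hn2 hn _ ?_
  intro A hA B hB hAB hBF
  rw [mem_filter, mem_switchers] at hA
  rw [mem_switchers] at hB ⊢
  obtain ⟨⟨a1, a2, a3, a4, a5⟩, hAF⟩ := hA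
  obtain ⟨b1, b2, b3, b4, b5⟩ := hB
  simp only [disjoint_union_right, disjoint_union_left] at hAF hBF hdis ⊢
  refine ⟨by rw [card_union_of_disjoint hAB, a1, b1], ⟨⟨a2, hBF.1⟩, hAF.1, b2⟩,
    ⟨⟨a3, hBF.2⟩, hAF.2, b3⟩, ?_, ?_⟩
  · rw [union_union_union_comm]
    refine a4.union b4 ?_
    simp only [disjoint_union_right, disjoint_union_left]
    exact ⟨⟨hAB, hBF.1.symm⟩, hAF.1, hdis.1.1⟩
  · rw [union_union_union_comm]
    refine a5.union b5 ?_
    simp only [disjoint_union_right, disjoint_union_left]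
    exact ⟨⟨hAB, hBF.2.symm⟩, hAF.2, hdis.2.2⟩

/-- The vertices of `L` are matched with those of `X`, and one switcher of size `14` is spent on
each matched pair. -/
theorem exists_switchers_sets {β : ℝ} (hβ0 : 0 < β) (k : ℕ) :
    ∃ β' > 0, ∃ N : ℕ, ∀ (V : Type u) [Fintype V] (G : TriGraph V), N ≤ Fintype.card V →
      (∀ l x : V, l ≠ x → β * (Fintype.card V : ℝ) ^ 14 ≤ (G.switchers 14 {l} {x}).card) →
      ∀ L X : Finset V, Disjoint L X → L.card = k → X.card = k →
        β' * (Fintype.card V : ℝ) ^ (14 * k) ≤ (G.switchers (14 * k) L X).card := by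
  induction k with
  | zero =>
    refine ⟨1, one_pos, 0, fun V _ G _ _ L X _ hL hX => ?_⟩
    rw [card_eq_zero] at hL hX
    subst hL hX
    have : (∅ : Finset V) ∈ G.switchers (14 * 0) ∅ ∅ := by
      simp only [mem_switchers]; simpa using Til.empty
    have := card_pos.2 ⟨_, this⟩
    simp only [mul_zero, pow_zero, mul_one]
    exact_mod_cast this
  | succ k ih =>
    obtain ⟨β', hβ'0, N, h⟩ := ih
    obtain ⟨M, hM⟩ := exists_nat_ge (max (2 * 2 / β') (max (2 * (14 * k + 2 * k) / β) 1))
    refine ⟨β' / 2 * β / 2 ^ (14 * k + 14 + 1), by positivity, max N M,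
      fun V _ G hNV hs L X hdis hL hX => ?_⟩
    have hM' : (M : ℝ) ≤ Fintype.card V := by exact_mod_cast (le_max_right N M).trans hNV
    simp only [max_le_iff] at hM
    obtain ⟨l, hl⟩ : L.Nonempty := card_pos.1 (by omega)
    obtain ⟨x, hx⟩ : X.Nonempty := card_pos.1 (by omega)
    have hlx : l ≠ x := fun e => disjoint_left.1 hdis hl (e ▸ hx)
    have hcl : (L.erase l).card = k := by rw [card_erase_of_mem hl, hL]; rfl
    have hcx : (X.erase x).card = k := by rw [card_erase_of_mem hx, hX]; rfl
    have h1 := h V G ((le_max_left N M).trans hNV) hs (L.erase l) (X.erase x)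
      (hdis.mono (erase_subset _ _) (erase_subset _ _)) hcl hcx
    have hcu : ((L.erase l ∪ X.erase x).card : ℝ) ≤ 2 * k := by
      have := card_union_le (L.erase l) (X.erase x)
      rw [hcl, hcx] at this
      have : ((L.erase l ∪ X.erase x).card : ℝ) ≤ k + k := by exact_mod_cast this
      linarith
    have key := switchers_union hβ0.le h1 (hs l x hlx) (L' := {l}) (X' := {x}) ?_ ?_ ?_ ?_
    · rw [union_comm (L.erase l), union_comm (X.erase x), ← insert_eq, ← insert_eq, insert_erase hl,
        insert_erase hx] at key
      exact key
    · simp only [disjoint_union_right, disjoint_singleton_right, mem_union, mem_erase, not_or]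
      exact ⟨⟨by simp, fun h => disjoint_left.1 hdis hl h.2⟩,
        fun h => disjoint_left.1 hdis h.2 hx, by simp⟩
    · have h2 := (div_le_iff₀ hβ'0).1 (hM.1.trans hM')
      have h3 : (({l} ∪ {x} : Finset V).card : ℝ) ≤ 2 := by
        exact_mod_cast (card_union_le _ _).trans (by simp)
      linarith
    · have h2 := (div_le_iff₀ hβ0).1 (hM.2.1.trans hM')
      push_cast
      linarith
    · have h2 : (1 : ℝ) ≤ Fintype.card V := hM.2.2.trans hM'
      exact_mod_cast h2

/-- If all pairs of vertices have many switchers then all `5`-sets have many absorbers. -/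
theorem exists_many_absorbers {β τ : ℝ} (hβ0 : 0 < β) (hτ0 : 0 < τ) :
    ∃ β' > 0, ∃ N : ℕ, ∀ (V : Type u) [Fintype V] (G : TriGraph V), N ≤ Fintype.card V →
      (∀ l x : V, l ≠ x → β * (Fintype.card V : ℝ) ^ 14 ≤ (G.switchers 14 {l} {x}).card) →
      τ * (Fintype.card V : ℝ) ^ 5 ≤ G.tSets.card →
      ∀ L : Finset V, L.card = 5 → β' * (Fintype.card V : ℝ) ^ 75 ≤ (G.absorbers L).card := by
  obtain ⟨β₁, hβ₁0, N, h⟩ := exists_switchers_sets.{u} hβ0 5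
  obtain ⟨M, hM⟩ := exists_nat_ge (max (2 * 5 / τ) (max (2 * (5 + 5) / β₁) 1))
  refine ⟨τ / 2 * β₁ / 2 ^ (5 + 70 + 1), by positivity, max N M,
    fun V _ G hNV hs hT L hL => ?_⟩
  have hM' : (M : ℝ) ≤ Fintype.card V := by exact_mod_cast (le_max_right N M).trans hNV
  simp only [max_le_iff] at hM
  have hn : 0 < Fintype.card V := by
    have h2 : (1 : ℝ) ≤ Fintype.card V := hM.2.2.trans hM'
    exact_mod_cast h2
  have h1 := card_avoiding_ge G.tSets (fun A hA => (mem_tSets.1 hA).card) L hT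
    (by rw [hL]; have := (div_le_iff₀ hτ0).1 (hM.1.trans hM'); push_cast; linarith) hn
  refine card_combine_ge (s := 5) (t := 70) _
    (fun A hA => (mem_tSets.1 (mem_filter.1 hA).1).card) h1
    (fun X => G.switchers (14 * 5) L X) (fun _ _ B hB => (mem_switchers.1 hB).1)
    (fun X hX => ?_) hβ₁0.le L ?_ hn _ ?_
  · rw [mem_filter, mem_tSets] at hX
    exact h V G ((le_max_left N M).trans hNV) hs L X hX.2.symm hL hX.1.card
  · rw [hL]; have := (div_le_iff₀ hβ₁0).1 (hM.2.1.trans hM'); push_cast; linarith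
  -- An absorber is a tile `X` with a switcher `A` of size `70` between `L` and `X`. Alone it is
  -- tiled as `A ∪ X`; together with `L`, the tile `X` stands by itself and `A ∪ L` is tileable.
  · intro X hX A hA hXA hAL
    rw [mem_filter, mem_tSets] at hX
    rw [mem_switchers] at hA
    rw [mem_absorbers]
    refine ⟨by rw [card_union_of_disjoint hXA, hX.1.card, hA.1],
      disjoint_union_left.2 ⟨hX.2, hAL⟩, ?_, ?_⟩
    · rw [union_comm]; exact hA.2.2.2.2
    · rw [union_assoc]
      exact Til.add hX.1 hA.2.2.2.1 (disjoint_union_right.2 ⟨hXA, hX.2⟩)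

end TriGraph

/-! ### Counting configurations one vertex at a time. -/

section Extension

variable {V : Type u} {α : Type*}

theorem card_ext_eq (S : Finset α) (D : α → Finset V) (Q : Finset (α × V))
    (hQ : ∀ a v, (a, v) ∈ Q ↔ a ∈ S ∧ v ∈ D a) : Q.card = ∑ a ∈ S, (D a).card := by
  rw [card_eq_sum_ones, sum_finset_product Q S D fun p => hQ p.1 p.2]
  simp

theorem card_ext_ge (S : Finset α) (D : α → Finset V) (Q : Finset (α × V))
    (hQ : ∀ a v, (a, v) ∈ Q ↔ a ∈ S ∧ v ∈ D a) {k : ℝ} (h : ∀ a ∈ S, k ≤ (D a).card) :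
    S.card * k ≤ Q.card := by
  rw [card_ext_eq S D Q hQ]
  push_cast
  calc S.card * k = ∑ a ∈ S, k := by rw [sum_const, nsmul_eq_mul]
    _ ≤ _ := sum_le_sum h

theorem card_ext_le (S : Finset α) (D : α → Finset V) (Q : Finset (α × V))
    (hQ : ∀ a v, (a, v) ∈ Q → a ∈ S ∧ v ∈ D a) {k : ℝ} (h : ∀ a ∈ S, (D a).card ≤ k) :
    (Q.card : ℝ) ≤ S.card * k := by
  have h1 : Q.card ≤ ((S ×ˢ S.biUnion D).filter fun p => p.2 ∈ D p.1).card := by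
    refine card_le_card ?_
    rintro ⟨a, v⟩ hp
    have := hQ a v hp
    simp only [mem_filter, mem_product, mem_biUnion]
    exact ⟨⟨this.1, a, this⟩, this.2⟩
  rw [card_ext_eq S D ((S ×ˢ S.biUnion D).filter fun p => p.2 ∈ D p.1) (by
    intro a v; simp only [mem_filter, mem_product, mem_biUnion]
    exact ⟨fun h => ⟨h.1.1, h.2⟩, fun h => ⟨⟨h.1, a, h⟩, h.2⟩⟩)] at h1
  calc (Q.card : ℝ) ≤ ∑ a ∈ S, ((D a).card : ℝ) := by exact_mod_cast h1
    _ ≤ ∑ a ∈ S, k := sum_le_sum h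
    _ = S.card * k := by rw [sum_const, nsmul_eq_mul]

theorem card_sdiff_real_ge {A B : Finset V} {k : ℝ} (h : (B.card : ℝ) ≤ k) :
    (A.card : ℝ) - k ≤ (A \ B).card := by
  have h1 := le_card_sdiff B A
  have h2 : A.card ≤ (A \ B).card + B.card := by omega
  have : (A.card : ℝ) ≤ (A \ B).card + B.card := by exact_mod_cast h2
  linarith

/-- The number of pairs of distinct members of `S` with the same first coordinate. -/
theorem card_cherries_ge (S : Finset (α × V)) (Z : Finset α) (hZ : ∀ p ∈ S, p.1 ∈ Z)
    (Q : Finset ((α × V) × V)) (hQ : ∀ p v, (p, v) ∈ Q ↔ p ∈ S ∧ (p.1, v) ∈ S ∧ v ≠ p.2) :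
    (S.card : ℝ) ^ 2 ≤ Z.card * (Q.card + S.card) := by
  set D : α → Finset V := fun a => (S.filter fun p => p.1 = a).image Prod.snd with hD
  have hmem : ∀ a v, v ∈ D a ↔ (a, v) ∈ S := by
    intro a v
    simp only [hD, mem_image, mem_filter]
    constructor
    · rintro ⟨⟨a', v'⟩, ⟨h, rfl⟩, rfl⟩; exact h
    · intro h; exact ⟨(a, v), ⟨h, rfl⟩, rfl⟩
  have hS : ∀ p : α × V, p ∈ S ↔ p.1 ∈ Z ∧ p.2 ∈ D p.1 := by
    intro p; rw [hmem]; exact ⟨fun h => ⟨hZ p h, h⟩, fun h => h.2⟩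
  have hSc : (S.card : ℝ) = ∑ a ∈ Z, ((D a).card : ℝ) := by
    rw [card_ext_eq Z D S fun a v => hS (a, v)]; push_cast; rfl
  have hQc : (Q.card : ℝ) = ∑ a ∈ Z, ∑ v ∈ D a, (((D a).erase v).card : ℝ) := by
    rw [card_ext_eq S (fun p => (D p.1).erase p.2) Q (by
      intro p v; rw [hQ, mem_erase, hmem]; tauto), sum_finset_product S Z D hS]
    push_cast; rfl
  have hsq : ∀ a ∈ Z, ((D a).card : ℝ) ^ 2 =
      ∑ v ∈ D a, (((D a).erase v).card : ℝ) + (D a).card := by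
    intro a _
    have h1 : ∀ v ∈ D a, (((D a).erase v).card : ℝ) = (D a).card - 1 := fun v hv => by
      rw [card_erase_of_mem hv, Nat.cast_sub (card_pos.2 ⟨v, hv⟩)]; simp
    rw [sum_congr rfl h1, sum_const, nsmul_eq_mul]; ring
  calc (S.card : ℝ) ^ 2 = (∑ a ∈ Z, ((D a).card : ℝ)) ^ 2 := by rw [hSc]
    _ ≤ Z.card * ∑ a ∈ Z, ((D a).card : ℝ) ^ 2 := sq_sum_le_card_mul_sum_sq
    _ = Z.card * (Q.card + S.card) := by rw [hQc, hSc, sum_congr rfl hsq, sum_add_distrib]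

/-- If every member of `Q` has its four entries forming a set in `𝒮`, then `𝒮` is large. -/
theorem card_quadruples_le (Q : Finset (((V × V) × V) × V)) (𝒮 : Finset (Finset V))
    (h : ∀ q ∈ Q, ({q.1.1.1, q.1.1.2, q.1.2, q.2} : Finset V) ∈ 𝒮) :
    Q.card ≤ 256 * 𝒮.card := by
  refine card_le_mul_card_image_of_maps_to (f := fun q : ((V × V) × V) × V =>
    ({q.1.1.1, q.1.1.2, q.1.2, q.2} : Finset V)) h _ fun A _ => ?_
  by_cases hA : A.card ≤ 4
  · have : (Q.filter fun q => ({q.1.1.1, q.1.1.2, q.1.2, q.2} : Finset V) = A) ⊆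
        ((A ×ˢ A) ×ˢ A) ×ˢ A := by
      intro q hq
      rw [mem_filter] at hq
      simp only [mem_product, ← hq.2, mem_insert, mem_singleton]
      tauto
    refine (card_le_card this).trans ?_
    simp only [card_product]
    calc A.card * A.card * A.card * A.card ≤ 4 * 4 * 4 * 4 := by gcongr
      _ = 256 := rfl
  · have : (Q.filter fun q => ({q.1.1.1, q.1.1.2, q.1.2, q.2} : Finset V) = A) = ∅ := by
      refine filter_eq_empty_iff.2 fun q _ hq => hA ?_
      rw [← hq]; exact card_le_four
    rw [this]; simp

theorem card_quintuples_le (Q : Finset ((((V × V) × V) × V) × V)) (𝒮 : Finset (Finset V))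
    (h : ∀ q ∈ Q, ({q.1.1.1.1, q.1.1.1.2, q.1.1.2, q.1.2, q.2} : Finset V) ∈ 𝒮) :
    Q.card ≤ 3125 * 𝒮.card := by
  refine card_le_mul_card_image_of_maps_to (f := fun q : (((V × V) × V) × V) × V =>
    ({q.1.1.1.1, q.1.1.1.2, q.1.1.2, q.1.2, q.2} : Finset V)) h _ fun A _ => ?_
  by_cases hA : A.card ≤ 5
  · have : (Q.filter fun q => ({q.1.1.1.1, q.1.1.1.2, q.1.1.2, q.1.2, q.2} : Finset V) = A) ⊆
        (((A ×ˢ A) ×ˢ A) ×ˢ A) ×ˢ A := by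
      intro q hq
      rw [mem_filter] at hq
      simp only [mem_product, ← hq.2, mem_insert, mem_singleton]
      tauto
    refine (card_le_card this).trans ?_
    simp only [card_product]
    calc A.card * A.card * A.card * A.card * A.card ≤ 5 * 5 * 5 * 5 * 5 := by gcongr
      _ = 3125 := rfl
  · have : (Q.filter fun q => ({q.1.1.1.1, q.1.1.1.2, q.1.1.2, q.1.2, q.2} : Finset V) = A) = ∅ := by
      refine filter_eq_empty_iff.2 fun q _ hq => hA ?_
      rw [← hq]; exact card_le_five
    rw [this]; simp

end Extension

/-! ### Switchers from common links. -/

namespace TriGraph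

variable {V : Type u} [Fintype V]

/-- The ordered pairs in the common link of `l` and `x`. -/
noncomputable def common (G : TriGraph V) (l x : V) : Finset (V × V) :=
  univ.filter fun p => G.adj l p.1 p.2 ∧ G.adj x p.1 p.2

/-- The ordered pairs in the link of `l`. -/
noncomputable def link (G : TriGraph V) (l : V) : Finset (V × V) :=
  univ.filter fun p => G.adj l p.1 p.2

variable {G : TriGraph V}

@[simp] theorem mem_common {l x : V} {p : V × V} :
    p ∈ G.common l x ↔ G.adj l p.1 p.2 ∧ G.adj x p.1 p.2 := by simp [common]

@[simp] theorem mem_link {l : V} {p : V × V} : p ∈ G.link l ↔ G.adj l p.1 p.2 := by simp [link]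

theorem switchers_comm (t : ℕ) (L X : Finset V) : G.switchers t L X = G.switchers t X L := by
  ext A; simp only [mem_switchers]; tauto

theorem card_link_ge (hδ : ∀ x y : V, x ≠ y → 2 / 5 * (Fintype.card V : ℝ) ≤ (G.nb x y).card)
    (l : V) : 2 / 5 * (Fintype.card V : ℝ) * (Fintype.card V - 1) ≤ (G.link l).card := by
  rw [card_ext_eq univ (G.nb l) (G.link l) (by simp)]
  push_cast
  have h2 : ∑ a ∈ univ.erase l, 2 / 5 * (Fintype.card V : ℝ) ≤ ∑ a : V, ((G.nb l a).card : ℝ) :=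
    (sum_le_sum fun a ha => hδ l a (ne_of_mem_erase ha).symm).trans
      (sum_le_sum_of_subset_of_nonneg (erase_subset _ _) fun _ _ _ => Nat.cast_nonneg _)
  rw [sum_const, card_erase_of_mem (mem_univ l), nsmul_eq_mul, card_univ,
    Nat.cast_sub (Fintype.card_pos_iff.2 ⟨l⟩)] at h2
  push_cast at h2
  linarith

/-- Each link has about `2/5 * n ^ 2` ordered pairs, so three links exceed `n ^ 2` by about `n ^ 2 /
5` and one of the three overlaps receives a third of that. -/
theorem exists_common_ge (hδ : ∀ x y : V, x ≠ y → 2 / 5 * (Fintype.card V : ℝ) ≤ (G.nb x y).card)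
    (hn : (100 : ℝ) ≤ Fintype.card V) (x y z : V) :
    1 / 20 * (Fintype.card V : ℝ) ^ 2 ≤ (G.common x y).card ∨
    1 / 20 * (Fintype.card V : ℝ) ^ 2 ≤ (G.common x z).card ∨
    1 / 20 * (Fintype.card V : ℝ) ^ 2 ≤ (G.common y z).card := by
  by_contra! hcon
  obtain ⟨h1, h2, h3⟩ := hcon
  have e : ∀ a b, G.link a ∩ G.link b = G.common a b := fun a b => by
    ext p; simp only [mem_inter, mem_link, mem_common]
  have c1 := card_union_add_card_inter (G.link x) (G.link y)
  have c2 := card_union_add_card_inter (G.link x ∪ G.link y) (G.link z)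
  have c3 : ((G.link x ∪ G.link y) ∩ G.link z).card ≤ (G.common x z).card + (G.common y z).card := by
    rw [union_inter_distrib_right, e, e]; exact card_union_le _ _
  have c4 : (G.link x ∪ G.link y ∪ G.link z).card ≤ Fintype.card V * Fintype.card V := by
    rw [← Fintype.card_prod]; exact card_le_univ _
  rw [e] at c1
  have k : (G.link x).card + (G.link y).card + (G.link z).card ≤ Fintype.card V * Fintype.card V +
    (G.common x y).card + (G.common x z).card + (G.common y z).card := by omega
  have k' : ((G.link x).card : ℝ) + (G.link y).card + (G.link z).card ≤ Fintype.card V *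
    Fintype.card V + (G.common x y).card + (G.common x z).card + (G.common y z).card := by
    exact_mod_cast k
  have := card_link_ge hδ x; have := card_link_ge hδ y; have := card_link_ge hδ z
  nlinarith

/-- Two vertices whose links share many pairs have many switchers. -/
theorem switchers_of_common
    (hδ : ∀ x y : V, x ≠ y → 2 / 5 * (Fintype.card V : ℝ) ≤ (G.nb x y).card)
    {c : ℝ} (hc : 0 < c) {l x : V} (h : c * (Fintype.card V : ℝ) ^ 2 ≤ (G.common l x).card)
    (hn1 : 100 ≤ (Fintype.card V : ℝ)) (hn2 : 2 ≤ c ^ 2 * Fintype.card V) :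
    c ^ 2 / 2560 * (Fintype.card V : ℝ) ^ 4 ≤ (G.switchers 4 {l} {x}).card := by
  set n : ℝ := (Fintype.card V : ℝ) with hndef
  -- cherries `c - b - d` in the common link
  set S2 : Finset ((V × V) × V) := (G.common l x ×ˢ univ).filter
    fun p => (p.1.1, p.2) ∈ G.common l x ∧ p.2 ≠ p.1.2 with hS2
  have hS2c : c ^ 2 / 2 * n ^ 3 ≤ S2.card := by
    have e1 := card_cherries_ge (G.common l x) univ (fun _ _ => mem_univ _) S2 (by
      intro p v; simp only [hS2, mem_filter, mem_product, mem_univ, and_true])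
    rw [card_univ, ← hndef] at e1
    have e2 : (c * n ^ 2) ^ 2 ≤ ((G.common l x).card : ℝ) ^ 2 :=
      pow_le_pow_left₀ (by positivity) h 2
    have e3 : ((G.common l x).card : ℝ) ≤ n * n := by
      rw [hndef]; exact_mod_cast (card_le_univ _).trans (Fintype.card_prod V V).le
    have e4 : n * (c ^ 2 * n ^ 3) ≤ n * (S2.card + n * n) := by
      calc n * (c ^ 2 * n ^ 3) = (c * n ^ 2) ^ 2 := by ring
        _ ≤ n * (S2.card + (G.common l x).card) := e2.trans e1
        _ ≤ _ := by gcongr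
    have e5 := le_of_mul_le_mul_left e4 (by linarith)
    have e6 : 2 * n ^ 2 ≤ c ^ 2 * n * n ^ 2 := by gcongr
    nlinarith
  set S3 : Finset (((V × V) × V) × V) := (S2 ×ˢ univ).filter
    fun p => G.adj p.1.1.2 p.1.2 p.2 ∧ p.2 ∉ ({l, x, p.1.1.1} : Finset V) with hS3
  have hS3c : S2.card * (n / 5) ≤ S3.card := by
    refine card_ext_ge S2 (fun p => G.nb p.1.2 p.2 \ {l, x, p.1.1}) S3 (by
      intro a v; simp only [hS3, mem_filter, mem_product, mem_univ, mem_sdiff, mem_nb]; tauto) ?_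
    intro p hp
    have hne := (mem_filter.1 hp).2.2
    have h1 := hδ p.1.2 p.2 hne.symm
    have h3 : ((({l, x, p.1.1} : Finset V).card : ℕ) : ℝ) ≤ 3 := by exact_mod_cast card_le_three
    have := card_sdiff_real_ge (A := G.nb p.1.2 p.2) h3
    linarith
  have hfin := card_quadruples_le S3 (G.switchers 4 {l} {x}) ?_
  · have hfin' : (S3.card : ℝ) ≤ 256 * (G.switchers 4 {l} {x}).card := by exact_mod_cast hfin
    have : c ^ 2 / 2 * n ^ 3 * (n / 5) ≤ S2.card * (n / 5) := by gcongr
    nlinarith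
  · rintro ⟨⟨⟨b, c'⟩, d⟩, e⟩ hq
    simp only [hS3, hS2, mem_filter, mem_product, mem_univ, mem_common, mem_insert,
      mem_singleton, not_or, and_true] at hq
    obtain ⟨⟨⟨hlc, hxc⟩, ⟨hld, hxd⟩, hdc⟩, hcde, hel, hex, heb⟩ := hq
    -- Both `l` and `x` can play the role of `a`: the cherry at `b` lies in both links and the edge
    -- `c'de` involves neither.
    have tl : G.IsT l b c' d e := ⟨hlc, hld, hcde, hel, heb⟩
    have tx : G.IsT x b c' d e := ⟨hxc, hxd, hcde, hex, heb⟩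
    have hcl := tl.card
    have hlA : l ∉ ({b, c', d, e} : Finset V) := by
      simp only [mem_insert, mem_singleton, not_or]
      exact ⟨G.ne12 hlc, ne13 hlc, ne13 hld, fun h => hel h.symm⟩
    have hxA : x ∉ ({b, c', d, e} : Finset V) := by
      simp only [mem_insert, mem_singleton, not_or]
      exact ⟨G.ne12 hxc, ne13 hxc, ne13 hxd, fun h => hex h.symm⟩
    rw [mem_switchers]
    refine ⟨?_, by simpa using hlA, by simpa using hxA, ?_, ?_⟩
    · rw [card_insert_of_notMem hlA] at hcl; exact Nat.succ_injective hcl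
    · refine TSet.til ⟨l, b, c', d, e, tl, ?_⟩
      rw [union_comm]; rfl
    · refine TSet.til ⟨x, b, c', d, e, tx, ?_⟩
      rw [union_comm]; rfl

/-- The vertices `a, b, c, d, e` are chosen in this order: the first two freely, each later one from
the neighbourhood of a pair already chosen. -/
theorem card_tSets_ge (hδ : ∀ x y : V, x ≠ y → 2 / 5 * (Fintype.card V : ℝ) ≤ (G.nb x y).card)
    (hn : 100 ≤ (Fintype.card V : ℝ)) :
    1 / 1000000 * (Fintype.card V : ℝ) ^ 5 ≤ G.tSets.card := by
  set n : ℝ := (Fintype.card V : ℝ) with hndef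
  set S1 : Finset (V × V) := (univ ×ˢ univ).filter fun p => p.1 ≠ p.2 with hS1
  have h1 : n * (n / 2) ≤ S1.card := by
    have := card_ext_ge (univ : Finset V) (fun a => univ \ {a}) S1
      (by simp [hS1, eq_comm]) (k := n / 2) fun a _ => by
      have h := card_sdiff_real_ge (A := (univ : Finset V)) (B := {a}) (k := 1) (by simp)
      rw [card_univ] at h
      linarith
    rwa [card_univ] at this
  set S2 : Finset ((V × V) × V) := (S1 ×ˢ univ).filter fun p => G.adj p.1.1 p.1.2 p.2 with hS2
  have h2 : S1.card * (n / 5) ≤ S2.card := by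
    refine card_ext_ge S1 (fun p => G.nb p.1 p.2) S2 (by simp [hS2]) fun p hp => ?_
    have := hδ p.1 p.2 (mem_filter.1 hp).2
    linarith
  set S3 : Finset (((V × V) × V) × V) := (S2 ×ˢ univ).filter
    fun p => G.adj p.1.1.1 p.1.1.2 p.2 ∧ p.2 ≠ p.1.2 with hS3
  have h3 : S2.card * (n / 5) ≤ S3.card := by
    refine card_ext_ge S2 (fun p => G.nb p.1.1 p.1.2 \ {p.2}) S3 (by simp [hS3]) fun p hp => ?_
    have h0 := (mem_filter.1 (mem_product.1 (mem_filter.1 hp).1).1).2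
    have := hδ p.1.1 p.1.2 h0
    have h := card_sdiff_real_ge (A := G.nb p.1.1 p.1.2) (B := {p.2}) (k := 1) (by simp)
    linarith
  set S4 : Finset ((((V × V) × V) × V) × V) := (S3 ×ˢ univ).filter
    fun p => G.adj p.1.1.2 p.1.2 p.2 ∧ p.2 ∉ ({p.1.1.1.1, p.1.1.1.2} : Finset V) with hS4
  have h4 : S3.card * (n / 5) ≤ S4.card := by
    refine card_ext_ge S3 (fun p => G.nb p.1.2 p.2 \ {p.1.1.1, p.1.1.2}) S4
      (by simp [hS4]) fun p hp => ?_
    have h0 := (mem_filter.1 hp).2.2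
    have := hδ p.1.2 p.2 h0.symm
    have h := card_sdiff_real_ge (A := G.nb p.1.2 p.2) (B := {p.1.1.1, p.1.1.2}) (k := 2)
      (by exact_mod_cast card_le_two)
    linarith
  have h5 := card_quintuples_le S4 G.tSets ?_
  · have h5' : (S4.card : ℝ) ≤ 3125 * G.tSets.card := by exact_mod_cast h5
    have n5 : 0 ≤ n / 5 := by linarith
    have k1 : n * (n / 2) * (n / 5) * (n / 5) * (n / 5) ≤ S4.card := by
      refine le_trans ?_ h4
      refine mul_le_mul_of_nonneg_right (le_trans ?_ h3) n5
      refine mul_le_mul_of_nonneg_right (le_trans ?_ h2) n5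
      exact mul_le_mul_of_nonneg_right h1 n5
    have k2 : n * (n / 2) * (n / 5) * (n / 5) * (n / 5) = n ^ 5 / 250 := by ring
    have k3 : 0 ≤ n ^ 5 := by positivity
    linarith
  · rintro ⟨⟨⟨⟨a, b⟩, c⟩, d⟩, e⟩ hq
    simp only [hS4, hS3, hS2, mem_filter, mem_product, mem_univ, mem_insert,
      mem_singleton, not_or, and_true] at hq
    exact mem_tSets.2 ⟨a, b, c, d, e, ⟨hq.1.1.2, hq.1.2.1, hq.2.1, hq.2.2.1, hq.2.2.2⟩, rfl⟩

end TriGraph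

/-! ### Two vertex classes: common links across them and pure edges. -/

namespace TriGraph

variable {V : Type u} {G : TriGraph V}

theorem card_inter_real_ge {A B P : Finset V} {k m : ℝ} (hA : k ≤ (A ∩ P).card)
    (hB : k ≤ (B ∩ P).card) (hP : (P.card : ℝ) ≤ m) : 2 * k - m ≤ (A ∩ B ∩ P).card := by
  have h1 := card_union_add_card_inter (A ∩ P) (B ∩ P)
  have h2 : (A ∩ P ∪ B ∩ P).card ≤ P.card :=
    card_le_card (union_subset inter_subset_right inter_subset_right)
  have h3 : A ∩ P ∩ (B ∩ P) = A ∩ B ∩ P := by ext; simp only [mem_inter]; tauto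
  rw [h3] at h1
  have h4 : (A ∩ P).card + (B ∩ P).card ≤ P.card + (A ∩ B ∩ P).card := by omega
  have h5 : ((A ∩ P).card : ℝ) + (B ∩ P).card ≤ P.card + (A ∩ B ∩ P).card := by exact_mod_cast h4
  linarith

variable [Fintype V]

/-- The pairs of vertices from `P × Q` together with the pairs in their common link. -/
noncomputable def crossCommon (G : TriGraph V) (P Q : Finset V) : Finset ((V × V) × (V × V)) :=
  ((P ×ˢ Q) ×ˢ univ).filter fun t => t.2 ∈ G.common t.1.1 t.1.2

/-- The pairs with many neighbours in both `P` and `Q`. -/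
noncomputable def impure (G : TriGraph V) (P Q : Finset V) (k : ℝ) : Finset (V × V) :=
  univ.filter fun z => k ≤ (G.nb z.1 z.2 ∩ P).card ∧ k ≤ (G.nb z.1 z.2 ∩ Q).card

/-- Double counting: neighbours `y ∈ P` and `y' ∈ Q` of an impure pair have that pair in their
common link, so each impure pair contributes at least `k * k` members. -/
theorem card_impure_le (P Q : Finset V) {k : ℝ} (hk : 0 ≤ k) :
    (G.impure P Q k).card * (k * k) ≤ (G.crossCommon P Q).card := by
  set X : Finset ((V × V) × (V × V)) := ((G.impure P Q k) ×ˢ univ).filter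
    fun t => t.2 ∈ (G.nb t.1.1 t.1.2 ∩ P) ×ˢ (G.nb t.1.1 t.1.2 ∩ Q) with hX
  have h1 := card_ext_ge (G.impure P Q k)
    (fun z => (G.nb z.1 z.2 ∩ P) ×ˢ (G.nb z.1 z.2 ∩ Q)) X (by
      intro z w; simp only [hX, mem_filter, mem_product (s := G.impure P Q k), mem_univ, and_true])
    (k := k * k) (by
      intro z hz
      have := (mem_filter.1 hz).2
      rw [card_product]; push_cast
      exact mul_le_mul this.1 this.2 hk (Nat.cast_nonneg _))
  refine h1.trans ?_
  have h2 : X.card ≤ (G.crossCommon P Q).card := by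
    refine card_le_card_of_injOn Prod.swap ?_ (Prod.swap_injective.injOn)
    rintro ⟨⟨u, v⟩, ⟨y, y'⟩⟩ ht
    simp only [hX, mem_coe, mem_filter, mem_product, mem_inter, mem_nb] at ht
    simp only [crossCommon, mem_coe, mem_filter, mem_product, mem_univ, mem_common,
      Prod.fst_swap, Prod.snd_swap]
    exact ⟨⟨⟨ht.2.1.2, ht.2.2.2⟩, trivial⟩, rot' ht.2.1.1, rot' ht.2.2.1⟩
  exact_mod_cast h2

/-- The edges with two vertices in `P` and one in `Q`. -/
noncomputable def crossEdges (G : TriGraph V) (P Q : Finset V) : Finset ((V × V) × V) :=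
  ((P ×ˢ P) ×ˢ Q).filter fun t => G.adj t.1.1 t.1.2 t.2

/-- The edges `pqr` with `p, q ∈ P` and `r ∈ Q` all of whose pairs are pure with many neighbours. -/
noncomputable def pureEdges (G : TriGraph V) (P Q : Finset V) (k : ℝ) : Finset ((V × V) × V) :=
  (G.crossEdges P Q).filter fun t =>
    k ≤ (G.nb t.1.1 t.2 ∩ P).card ∧ k ≤ (G.nb t.1.2 t.2 ∩ P).card ∧
    (t.1.1, t.2) ∉ G.impure P Q k ∧ (t.1.2, t.2) ∉ G.impure P Q k

/-- An edge that is not pure has a pair from `P × Q` that is impure or has fewer than `k` neighbours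
in `P`. The third vertex lies in `P`, so a pair of the latter kind accounts for at most `k` edges.
-/
theorem card_crossEdges_le (P Q : Finset V) {k : ℝ} (hk : 0 ≤ k) :
    ((G.crossEdges P Q).card : ℝ) ≤ (G.pureEdges P Q k).card +
      2 * (Fintype.card V : ℝ) ^ 2 * k + 2 * (G.impure P Q k).card * Fintype.card V := by
  set E := G.crossEdges P Q with hE
  set I := G.impure P Q k with hI
  set n : ℝ := (Fintype.card V : ℝ) with hn
  have hEmem : ∀ p q r, ((p, q), r) ∈ E → p ∈ P ∧ q ∈ P ∧ r ∈ Q ∧ G.adj p q r := by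
    intro p q r h
    simp only [hE, crossEdges, mem_filter, mem_product] at h
    tauto
  have huu : ((univ : Finset (V × V)).card : ℝ) = n ^ 2 := by
    rw [card_univ, Fintype.card_prod, hn]; push_cast; ring
  have b1 : ((E.filter fun t => ((G.nb t.1.1 t.2 ∩ P).card : ℝ) < k).card : ℝ) ≤ n ^ 2 * k := by
    set S := E.filter fun t => ((G.nb t.1.1 t.2 ∩ P).card : ℝ) < k with hS
    have hinj : Function.Injective fun t : (V × V) × V => ((t.1.1, t.2), t.1.2) := by
      rintro ⟨⟨a, b⟩, c⟩ ⟨⟨a', b'⟩, c'⟩ h; simp at h; simp [h]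
    rw [← card_image_of_injective S hinj]
    have := card_ext_le (univ.filter fun z : V × V => ((G.nb z.1 z.2 ∩ P).card : ℝ) < k)
      (fun z => G.nb z.1 z.2 ∩ P) (S.image fun t => ((t.1.1, t.2), t.1.2)) (k := k) (by
        intro z v h
        obtain ⟨⟨⟨p, q⟩, r⟩, ht, he⟩ := mem_image.1 h
        obtain ⟨rfl, rfl⟩ := Prod.mk.inj he
        rw [hS, mem_filter] at ht
        obtain ⟨hp, hq, hr, hadj⟩ := hEmem _ _ _ ht.1
        exact ⟨mem_filter.2 ⟨mem_univ _, ht.2⟩, mem_inter.2 ⟨mem_nb.2 (G.swap23 hadj), hq⟩⟩)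
      (fun z hz => (mem_filter.1 hz).2.le)
    refine this.trans (mul_le_mul_of_nonneg_right ?_ hk)
    rw [← huu]; exact_mod_cast card_filter_le _ _
  have b2 : ((E.filter fun t => ((G.nb t.1.2 t.2 ∩ P).card : ℝ) < k).card : ℝ) ≤ n ^ 2 * k := by
    set S := E.filter fun t => ((G.nb t.1.2 t.2 ∩ P).card : ℝ) < k with hS
    have hinj : Function.Injective fun t : (V × V) × V => ((t.1.2, t.2), t.1.1) := by
      rintro ⟨⟨a, b⟩, c⟩ ⟨⟨a', b'⟩, c'⟩ h; simp at h; simp [h]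
    rw [← card_image_of_injective S hinj]
    have := card_ext_le (univ.filter fun z : V × V => ((G.nb z.1 z.2 ∩ P).card : ℝ) < k)
      (fun z => G.nb z.1 z.2 ∩ P) (S.image fun t => ((t.1.2, t.2), t.1.1)) (k := k) (by
        intro z v h
        obtain ⟨⟨⟨p, q⟩, r⟩, ht, he⟩ := mem_image.1 h
        obtain ⟨rfl, rfl⟩ := Prod.mk.inj he
        rw [hS, mem_filter] at ht
        obtain ⟨hp, hq, hr, hadj⟩ := hEmem _ _ _ ht.1
        exact ⟨mem_filter.2 ⟨mem_univ _, ht.2⟩, mem_inter.2 ⟨mem_nb.2 (rot hadj), hp⟩⟩)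
      (fun z hz => (mem_filter.1 hz).2.le)
    refine this.trans (mul_le_mul_of_nonneg_right ?_ hk)
    rw [← huu]; exact_mod_cast card_filter_le _ _
  have b3 : ((E.filter fun t => (t.1.1, t.2) ∈ I).card : ℝ) ≤ I.card * n := by
    set S := E.filter fun t => (t.1.1, t.2) ∈ I with hS
    have hinj : Function.Injective fun t : (V × V) × V => ((t.1.1, t.2), t.1.2) := by
      rintro ⟨⟨a, b⟩, c⟩ ⟨⟨a', b'⟩, c'⟩ h; simp at h; simp [h]
    rw [← card_image_of_injective S hinj]
    refine card_ext_le I (fun _ => univ) _ (by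
        intro z v h
        obtain ⟨⟨⟨p, q⟩, r⟩, ht, he⟩ := mem_image.1 h
        obtain ⟨rfl, rfl⟩ := Prod.mk.inj he
        exact ⟨(mem_filter.1 ht).2, mem_univ _⟩) (fun z _ => by rw [card_univ])
  have b4 : ((E.filter fun t => (t.1.2, t.2) ∈ I).card : ℝ) ≤ I.card * n := by
    set S := E.filter fun t => (t.1.2, t.2) ∈ I with hS
    have hinj : Function.Injective fun t : (V × V) × V => ((t.1.2, t.2), t.1.1) := by
      rintro ⟨⟨a, b⟩, c⟩ ⟨⟨a', b'⟩, c'⟩ h; simp at h; simp [h]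
    rw [← card_image_of_injective S hinj]
    refine card_ext_le I (fun _ => univ) _ (by
        intro z v h
        obtain ⟨⟨⟨p, q⟩, r⟩, ht, he⟩ := mem_image.1 h
        obtain ⟨rfl, rfl⟩ := Prod.mk.inj he
        exact ⟨(mem_filter.1 ht).2, mem_univ _⟩) (fun z _ => by rw [card_univ])
  have hsub : E ⊆ G.pureEdges P Q k ∪ ((E.filter fun t => ((G.nb t.1.1 t.2 ∩ P).card : ℝ) < k) ∪
      (E.filter fun t => ((G.nb t.1.2 t.2 ∩ P).card : ℝ) < k) ∪
      (E.filter fun t => (t.1.1, t.2) ∈ I) ∪ (E.filter fun t => (t.1.2, t.2) ∈ I)) := by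
    intro t ht
    simp only [pureEdges, ← hE, ← hI, mem_union, mem_filter, ← not_le]
    tauto
  have h1 := (card_le_card hsub).trans ((card_union_le _ _).trans (add_le_add le_rfl
    ((card_union_le _ _).trans (add_le_add ((card_union_le _ _).trans (add_le_add
      (card_union_le _ _) le_rfl)) le_rfl))))
  have h2 : (E.card : ℝ) ≤ _ := Nat.cast_le.2 h1
  push_cast at h2
  linarith

/-- The quadruples `p, q, r, s` such that `pqr` and `pqs` are pure edges. -/
noncomputable def pureQuads (G : TriGraph V) (P Q : Finset V) (k : ℝ) :
    Finset (((V × V) × V) × V) :=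
  (G.pureEdges P Q k ×ˢ univ).filter fun t => (t.1.1, t.2) ∈ G.pureEdges P Q k ∧ t.2 ≠ t.1.2

theorem mem_pureQuads {P Q : Finset V} {k : ℝ} {p q r s : V}
    (h : (((p, q), r), s) ∈ G.pureQuads P Q k) :
    (p ∈ P ∧ q ∈ P ∧ r ∈ Q ∧ s ∈ Q ∧ r ≠ s) ∧ (G.adj p q r ∧ G.adj p q s) ∧
      (k ≤ (G.nb p r ∩ P).card ∧ (p, r) ∉ G.impure P Q k) ∧
      (k ≤ (G.nb q s ∩ P).card ∧ (q, s) ∉ G.impure P Q k) := by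
  simp only [pureQuads, pureEdges, crossEdges, mem_filter, mem_product] at h
  tauto

theorem card_nb_inter_ge {P Q : Finset V} {k m : ℝ}
    (hδ : ∀ x y : V, x ≠ y → 2 / 5 * (Fintype.card V : ℝ) ≤ (G.nb x y).card)
    (hR : ((univ \ (P ∪ Q)).card : ℝ) ≤ m) {x y : V} (hxy : x ≠ y)
    (h : ((G.nb x y ∩ Q).card : ℝ) ≤ k) :
    2 / 5 * (Fintype.card V : ℝ) - k - m ≤ (G.nb x y ∩ P).card := by
  have h1 : (G.nb x y).card ≤ (G.nb x y ∩ P).card + (G.nb x y ∩ Q).card +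
      (univ \ (P ∪ Q)).card := by
    refine (card_le_card (t := (G.nb x y ∩ P) ∪ (G.nb x y ∩ Q) ∪ (univ \ (P ∪ Q))) ?_).trans
      ((card_union_le _ _).trans (add_le_add (card_union_le _ _) le_rfl))
    intro v hv
    simp only [mem_union, mem_inter, mem_sdiff, mem_univ, true_and, hv]
    tauto
  have h2 : ((G.nb x y).card : ℝ) ≤ (G.nb x y ∩ P).card + (G.nb x y ∩ Q).card +
      (univ \ (P ∪ Q)).card := by exact_mod_cast h1
  have := hδ x y hxy
  linarith

/-- A quadruple of pure edges whose pair `rs` has only few neighbours in `Q` contributes to the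
common links of `P` and `Q`. -/
theorem card_quads_le_crossCommon {P Q : Finset V} {n : ℝ} (hn : n = Fintype.card V)
    (hδ : ∀ x y : V, x ≠ y → 2 / 5 * (Fintype.card V : ℝ) ≤ (G.nb x y).card)
    (hPQ : Disjoint P Q)
    (hR : ((univ \ (P ∪ Q)).card : ℝ) ≤ n / 100) (hP : (P.card : ℝ) ≤ 61 / 100 * n) :
    (((G.pureQuads P Q (n / 1000)).filter
      fun t => ((G.nb t.1.2 t.2 ∩ Q).card : ℝ) < n / 1000).card : ℝ) * (n / 10) ≤
      (G.crossCommon P Q).card * n := by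
  set S := (G.pureQuads P Q (n / 1000)).filter
      fun t => ((G.nb t.1.2 t.2 ∩ Q).card : ℝ) < n / 1000 with hS
  have hn0 : 0 ≤ n := by rw [hn]; positivity
  set X : Finset ((((V × V) × V) × V) × V) := (S ×ˢ univ).filter
    fun t => t.2 ∈ G.nb t.1.1.1.1 t.1.1.2 ∩ G.nb t.1.1.2 t.1.2 ∩ P with hX
  have h1 := card_ext_ge S (fun t => G.nb t.1.1.1 t.1.2 ∩ G.nb t.1.2 t.2 ∩ P) X (by
      intro t v; simp only [hX, mem_filter, mem_product, mem_univ, and_true]) (k := n / 10) (by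
      rintro ⟨⟨⟨p, q⟩, r⟩, s⟩ ht
      rw [hS, mem_filter] at ht
      obtain ⟨⟨hp, hq, hr, hs, hrs⟩, _, ⟨h1, h2⟩, _⟩ := mem_pureQuads ht.1
      have hpr : p ≠ r := fun h => disjoint_left.1 hPQ hp (h ▸ hr)
      have h3 : ((G.nb p r ∩ Q).card : ℝ) ≤ n / 1000 := by
        by_contra hcon
        exact h2 (mem_filter.2 ⟨mem_univ _, h1, (not_le.1 hcon).le⟩)
      have a1 := card_nb_inter_ge hδ hR hpr h3
      have a2 := card_nb_inter_ge hδ hR hrs ht.2.le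
      rw [← hn] at a1 a2
      -- Both neighbourhoods have at least `0.389 * n` vertices in `P`, which has at most `0.61 *
      -- n`, so they share at least `0.168 * n` vertices there.
      have := card_inter_real_ge a1 a2 hP
      simp only
      linarith)
  refine h1.trans ?_
  have h2 : X.card ≤ (G.crossCommon P Q ×ˢ (univ : Finset V)).card := by
    -- A vertex `t` adjacent to `pr` and to `rs` puts the pair `(t, r)` into the common link of `p ∈
    -- P` and `s ∈ Q`; the vertex `q` remains as a free coordinate.
    refine card_le_card_of_injOn (fun t => (((t.1.1.1.1, t.1.2), (t.2, t.1.1.2)), t.1.1.1.2)) ?_ ?_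
    · rintro ⟨⟨⟨⟨p, q⟩, r⟩, s⟩, t⟩ ht
      simp only [hX, hS, mem_coe, mem_filter, mem_product, mem_univ, and_true, mem_inter,
        mem_nb] at ht
      obtain ⟨⟨hp, hq, hr, hs, hrs⟩, _⟩ := mem_pureQuads ht.1.1
      simp only [crossCommon, mem_coe, mem_filter, mem_product, mem_univ, mem_common, and_true]
      exact ⟨⟨hp, hs⟩, G.swap23 ht.2.1.1, rot ht.2.1.2⟩
    · rintro ⟨⟨⟨⟨p, q⟩, r⟩, s⟩, t⟩ _ ⟨⟨⟨⟨p', q'⟩, r'⟩, s'⟩, t'⟩ _ h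
      simp at h; simp [h]
  rw [card_product, card_univ] at h2
  rw [hn]; exact_mod_cast h2

end TriGraph

/-! ### Many reachable pairs between two large classes. -/

namespace TriGraph

variable {V : Type u} [Fintype V] {G : TriGraph V}

/-- This is a switcher whose two vertices need not share link pairs. With `y'` the tile has edges
`pqr`, `pqs`, `rsy'`, so `y'` takes the role of `e`; with `y` it has edges `pry`, `prq`, `yqs`, so
`y` takes the role of `c`. -/
theorem mem_switchers_of_quad {p q r s y y' : V} (h1 : G.adj p q r) (h2 : G.adj p q s)
    (hy : G.adj p r y) (hy2 : G.adj q s y) (hy' : G.adj r s y') (n1 : y' ≠ p) (n2 : y' ≠ q) :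
    ({p, q, r, s} : Finset V) ∈ G.switchers 4 {y} {y'} := by
  have hT' : G.IsT p q r s y' := ⟨h1, h2, hy', n1, n2⟩
  have hrs := G.ne12 hy'
  have t : G.IsT p r y q s := ⟨hy, G.swap23 h1, rot' hy2, (ne13 h2).symm, hrs.symm⟩
  have hyA : y ∉ ({p, q, r, s} : Finset V) := by
    simp only [mem_insert, mem_singleton, not_or]
    exact ⟨(ne13 hy).symm, (ne13 hy2).symm, (ne23 hy).symm, (ne23 hy2).symm⟩
  have hyA' : y' ∉ ({p, q, r, s} : Finset V) := by
    simp only [mem_insert, mem_singleton, not_or]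
    exact ⟨n1, n2, (ne13 hy').symm, (ne23 hy').symm⟩
  have he' : ({p, q, r, s} : Finset V) ∪ {y'} = {p, q, r, s, y'} := by
    ext v; simp only [mem_union, mem_insert, mem_singleton]; tauto
  have e : ({p, q, r, s} : Finset V) ∪ {y} = {p, r, y, q, s} := by
    ext v; simp only [mem_union, mem_insert, mem_singleton]; tauto
  rw [mem_switchers]
  refine ⟨?_, by simpa using hyA, by simpa using hyA', ?_, ?_⟩
  · have h := hT'.card
    rw [← he', card_union_of_disjoint (by simpa using hyA'), card_singleton] at h
    omega
  · exact TSet.til ⟨_, _, _, _, _, t, e⟩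
  · exact TSet.til ⟨_, _, _, _, _, hT', he'⟩

/-- The pairs in `P × Q` with many switchers of size four. -/
noncomputable def reachable (G : TriGraph V) (P Q : Finset V) (β : ℝ) : Finset (V × V) :=
  (P ×ˢ Q).filter fun z => β * (Fintype.card V : ℝ) ^ 4 ≤ (G.switchers 4 {z.1} {z.2}).card

/-- By `switchers_of_common` a pair that is not reachable has fewer than `c * n ^ 2` pairs in its
common link; a reachable one is given the trivial bound `n ^ 2`. -/
theorem card_crossCommon_le
    (hδ : ∀ x y : V, x ≠ y → 2 / 5 * (Fintype.card V : ℝ) ≤ (G.nb x y).card)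
    {c : ℝ} (hc : 0 < c) (P Q : Finset V) (hn1 : 100 ≤ (Fintype.card V : ℝ))
    (hn2 : 2 ≤ c ^ 2 * Fintype.card V) :
    ((G.crossCommon P Q).card : ℝ) ≤
      ((G.reachable P Q (c ^ 2 / 2560)).card + c * (Fintype.card V : ℝ) ^ 2) *
        (Fintype.card V : ℝ) ^ 2 := by
  set n : ℝ := (Fintype.card V : ℝ) with hn
  set Rc := G.reachable P Q (c ^ 2 / 2560) with hRc
  have h1 := card_ext_eq (P ×ˢ Q) (fun z => G.common z.1 z.2) (G.crossCommon P Q) (by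
    intro a v; simp only [crossCommon, mem_filter, mem_product (s := P ×ˢ Q), mem_univ, and_true])
  have huu : ∀ S : Finset (V × V), (S.card : ℝ) ≤ n ^ 2 := by
    intro S
    have := card_le_univ S
    rw [Fintype.card_prod] at this
    rw [hn, sq]; exact_mod_cast this
  have h2 : ∀ z ∈ P ×ˢ Q, ((G.common z.1 z.2).card : ℝ) ≤
      (if z ∈ Rc then n ^ 2 else 0) + c * n ^ 2 := by
    intro z hz
    split_ifs with h
    · have := huu (G.common z.1 z.2)
      nlinarith [mul_nonneg hc.le (sq_nonneg n)]
    · by_contra hcon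
      push Not at hcon
      refine h (mem_filter.2 ⟨hz, ?_⟩)
      exact switchers_of_common hδ hc (by linarith) hn1 hn2
  rw [h1]
  push_cast
  refine (sum_le_sum h2).trans ?_
  rw [sum_add_distrib, sum_ite_mem, sum_const, sum_const, nsmul_eq_mul, nsmul_eq_mul]
  have h3 : (((P ×ˢ Q) ∩ Rc).card : ℝ) ≤ Rc.card := by
    exact_mod_cast card_le_card inter_subset_right
  have h4 := huu (P ×ˢ Q)
  have : (((P ×ˢ Q) ∩ Rc).card : ℝ) * n ^ 2 ≤ Rc.card * n ^ 2 := by gcongr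
  have : ((P ×ˢ Q).card : ℝ) * (c * n ^ 2) ≤ n ^ 2 * (c * n ^ 2) := by gcongr
  linarith

/-- Each quadruple extends by `y ∈ P` adjacent to both `pr` and `qs`, and by `y' ∈ Q` adjacent to
`rs`, and is then a switcher for `y, y'`. Counting the extensions by their pair `(y, y')`, the
unreachable pairs account for few of them. -/
theorem card_quads_le_reachable {P Q : Finset V} {n β : ℝ} (hn : n = Fintype.card V)
    (hδ : ∀ x y : V, x ≠ y → 2 / 5 * (Fintype.card V : ℝ) ≤ (G.nb x y).card)
    (hPQ : Disjoint P Q) (hβ : 0 ≤ β)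
    (hR : ((univ \ (P ∪ Q)).card : ℝ) ≤ n / 100) (hP : (P.card : ℝ) ≤ 61 / 100 * n) :
    (((G.pureQuads P Q (n / 1000)).filter
      fun t => n / 1000 ≤ ((G.nb t.1.2 t.2 ∩ Q).card : ℝ)).card : ℝ) * (n / 10) * (n / 1000) ≤
      ((G.reachable P Q β).card + 256 * β * n ^ 2) * n ^ 4 := by
  set S := (G.pureQuads P Q (n / 1000)).filter
      fun t => n / 1000 ≤ ((G.nb t.1.2 t.2 ∩ Q).card : ℝ) with hS
  have hn0 : 0 ≤ n := by rw [hn]; positivity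
  set X : Finset ((((V × V) × V) × V) × V) := (S ×ˢ univ).filter
    fun t => t.2 ∈ G.nb t.1.1.1.1 t.1.1.2 ∩ G.nb t.1.1.1.2 t.1.2 ∩ P with hX
  have h1 := card_ext_ge S (fun t => G.nb t.1.1.1 t.1.2 ∩ G.nb t.1.1.2 t.2 ∩ P) X (by
      intro t v; simp only [hX, mem_filter, mem_product, mem_univ, and_true]) (k := n / 10) (by
      rintro ⟨⟨⟨p, q⟩, r⟩, s⟩ ht
      rw [hS, mem_filter] at ht
      obtain ⟨⟨hp, hq, hr, hs, hrs⟩, _, ⟨h1, h2⟩, ⟨h3, h4⟩⟩ := mem_pureQuads ht.1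
      have hpr : p ≠ r := fun h => disjoint_left.1 hPQ hp (h ▸ hr)
      have hqs : q ≠ s := fun h => disjoint_left.1 hPQ hq (h ▸ hs)
      have h5 : ((G.nb p r ∩ Q).card : ℝ) ≤ n / 1000 := by
        by_contra hcon
        exact h2 (mem_filter.2 ⟨mem_univ _, h1, (not_le.1 hcon).le⟩)
      have h6 : ((G.nb q s ∩ Q).card : ℝ) ≤ n / 1000 := by
        by_contra hcon
        exact h4 (mem_filter.2 ⟨mem_univ _, h3, (not_le.1 hcon).le⟩)
      have a1 := card_nb_inter_ge hδ hR hpr h5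
      have a2 := card_nb_inter_ge hδ hR hqs h6
      rw [← hn] at a1 a2
      have := card_inter_real_ge a1 a2 hP
      simp only
      linarith)
  set Y : Finset (((((V × V) × V) × V) × V) × V) := (X ×ˢ univ).filter
    fun t => t.2 ∈ G.nb t.1.1.1.2 t.1.1.2 ∩ Q with hY
  have h2 := card_ext_ge X (fun t => G.nb t.1.1.2 t.1.2 ∩ Q) Y (by
      intro t v; simp only [hY, mem_filter, mem_product, mem_univ, and_true]) (k := n / 1000) (by
      intro t ht
      exact (mem_filter.1 (mem_product.1 (mem_filter.1 ht).1).1).2)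
  have h3 : (S.card : ℝ) * (n / 10) * (n / 1000) ≤ Y.card :=
    (mul_le_mul_of_nonneg_right h1 (by linarith)).trans h2
  refine h3.trans ?_
  -- regroup by the last two coordinates
  set f : ((((V × V) × V) × V) × V) × V → (V × V) × (((V × V) × V) × V) :=
    fun t => ((t.1.2, t.2), t.1.1) with hf
  have hfinj : Function.Injective f := by
    rintro ⟨⟨⟨⟨⟨p, q⟩, r⟩, s⟩, t⟩, v⟩ ⟨⟨⟨⟨⟨p', q'⟩, r'⟩, s'⟩, t'⟩, v'⟩ h
    simp [hf] at h; simp [h]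
  set D : V × V → Finset (((V × V) × V) × V) := fun z => univ.filter fun t => (z, t) ∈ Y.image f
    with hD
  have hYmem : ∀ z t, (z, t) ∈ Y.image f → z ∈ P ×ˢ Q ∧
      ({t.1.1.1, t.1.1.2, t.1.2, t.2} : Finset V) ∈ G.switchers 4 {z.1} {z.2} := by
    rintro z t hzt
    obtain ⟨⟨⟨⟨⟨⟨p, q⟩, r⟩, s⟩, y⟩, y'⟩, ht, he⟩ := mem_image.1 hzt
    obtain ⟨rfl, rfl⟩ := Prod.mk.inj he
    simp only [hY, hX, hS, mem_filter, mem_product, mem_univ, and_true, mem_inter, mem_nb] at ht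
    obtain ⟨⟨⟨hS1, _⟩, ⟨hy1, hy2⟩, hyP⟩, hy3, hyQ⟩ := ht
    obtain ⟨⟨hp, hq, hr, hs, hrs⟩, ⟨e1, e2⟩, _⟩ := mem_pureQuads hS1
    refine ⟨mem_product.2 ⟨hyP, hyQ⟩, ?_⟩
    exact mem_switchers_of_quad e1 e2 hy1 hy2 hy3
      (fun h : y' = p => disjoint_left.1 hPQ hp (h ▸ hyQ))
      (fun h : y' = q => disjoint_left.1 hPQ hq (h ▸ hyQ))
  have h4 := card_ext_eq (P ×ˢ Q) D (Y.image f) (by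
    intro z t
    simp only [hD, mem_filter, mem_univ, true_and]
    exact ⟨fun h => ⟨(hYmem z t h).1, h⟩, fun h => h.2⟩)
  rw [card_image_of_injective _ hfinj] at h4
  rw [h4]
  push_cast
  set Rc := G.reachable P Q β with hRc
  have h5 : ∀ z ∈ P ×ˢ Q, ((D z).card : ℝ) ≤ (if z ∈ Rc then n ^ 4 else 0) + 256 * β * n ^ 4 := by
    intro z hz
    have hpos : 0 ≤ 256 * β * n ^ 4 := by positivity
    split_ifs with h
    · have := card_le_univ (D z)
      rw [Fintype.card_prod, Fintype.card_prod, Fintype.card_prod] at this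
      have : ((D z).card : ℝ) ≤ n * n * n * n := by rw [hn]; exact_mod_cast this
      nlinarith
    · have h6 := card_quadruples_le (D z) (G.switchers 4 {z.1} {z.2}) fun t ht =>
        (hYmem z t (mem_filter.1 ht).2).2
      have h7 : ((D z).card : ℝ) ≤ 256 * (G.switchers 4 {z.1} {z.2}).card := by exact_mod_cast h6
      have h8 : ((G.switchers 4 {z.1} {z.2}).card : ℝ) ≤ β * n ^ 4 := by
        by_contra hcon
        refine h (mem_filter.2 ⟨hz, ?_⟩)
        rw [← hn]; exact (not_le.1 hcon).le
      linarith
  refine (sum_le_sum h5).trans ?_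
  rw [sum_add_distrib, sum_ite_mem, sum_const, sum_const, nsmul_eq_mul, nsmul_eq_mul]
  have h6 : (((P ×ˢ Q) ∩ Rc).card : ℝ) ≤ Rc.card := by
    exact_mod_cast card_le_card inter_subset_right
  have h7 : ((P ×ˢ Q).card : ℝ) ≤ n ^ 2 := by
    have := card_le_univ (P ×ˢ Q)
    rw [Fintype.card_prod] at this
    rw [hn, sq]; exact_mod_cast this
  have : (((P ×ˢ Q) ∩ Rc).card : ℝ) * n ^ 4 ≤ Rc.card * n ^ 4 := by gcongr
  have : ((P ×ˢ Q).card : ℝ) * (256 * β * n ^ 4) ≤ n ^ 2 * (256 * β * n ^ 4) := by gcongr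
  linarith

/-- If many edges have two vertices in `P` and one in `Q` then many pairs in `P × Q` are
reachable. -/
theorem card_reachable_ge {P Q : Finset V}
    (hδ : ∀ x y : V, x ≠ y → 2 / 5 * (Fintype.card V : ℝ) ≤ (G.nb x y).card)
    (hPQ : Disjoint P Q)
    (hR : ((univ \ (P ∪ Q)).card : ℝ) ≤ (Fintype.card V : ℝ) / 100)
    (hP : (P.card : ℝ) ≤ 61 / 100 * Fintype.card V)
    (hE : 1 / 50 * (Fintype.card V : ℝ) ^ 3 ≤ (G.crossEdges P Q).card)
    (hn1 : (10 : ℝ) ^ 21 ≤ Fintype.card V) :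
    (1 / 10 ^ 24 : ℝ) * (Fintype.card V : ℝ) ^ 2 ≤ (G.reachable P Q (1 / 10 ^ 24)).card := by
  -- With few reachable pairs the common links across `P × Q` are sparse. Hence few pairs are
  -- impure, most crossing edges are pure, and there are about `n ^ 4` pure quadruples. According to
  -- the number of neighbours of `rs` in `Q`, each quadruple falls under one of the two preceding
  -- bounds, which together allow too few.
  by_contra hcon
  push Not at hcon
  set n : ℝ := (Fintype.card V : ℝ) with hn
  have hn0 : 0 < n := by linarith [show (0 : ℝ) < 10 ^ 21 by norm_num]
  have hn100 : (100 : ℝ) ≤ n := by linarith [show (100 : ℝ) ≤ 10 ^ 21 by norm_num]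
  -- This `c` is small enough to make impure pairs rare and large enough for `c ^ 2 / 2560 ≥ 1 / 10
  -- ^ 24`.
  have hX1 := card_crossCommon_le hδ (c := 1 / 10 ^ 10) (by positivity) P Q hn100
    (by rw [← hn]; norm_num; linarith)
  have hsub : (G.reachable P Q ((1 / 10 ^ 10) ^ 2 / 2560)).card ≤
      (G.reachable P Q (1 / 10 ^ 24)).card := by
    refine card_le_card fun z hz => ?_
    rw [reachable, mem_filter] at hz ⊢
    refine ⟨hz.1, le_trans ?_ hz.2⟩
    refine mul_le_mul_of_nonneg_right ?_ (by positivity)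
    norm_num
  have hsub' : ((G.reachable P Q ((1 / 10 ^ 10) ^ 2 / 2560)).card : ℝ) ≤
      (G.reachable P Q (1 / 10 ^ 24)).card := by exact_mod_cast hsub
  have hX : ((G.crossCommon P Q).card : ℝ) ≤ 1 / 10 ^ 9 * n ^ 4 := by
    refine hX1.trans ?_
    have : ((G.reachable P Q ((1 / 10 ^ 10) ^ 2 / 2560)).card : ℝ) + 1 / 10 ^ 10 * n ^ 2 ≤
        1 / 10 ^ 9 * n ^ 2 := by
      have e1 : (1 / 10 ^ 24 : ℝ) * n ^ 2 ≤ 1 / 10 ^ 10 * n ^ 2 :=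
        mul_le_mul_of_nonneg_right (by norm_num) (sq_nonneg n)
      have e2 : (1 / 10 ^ 9 : ℝ) * n ^ 2 = 10 * (1 / 10 ^ 10 * n ^ 2) := by ring
      have e3 : (0 : ℝ) ≤ 1 / 10 ^ 10 * n ^ 2 := by positivity
      linarith
    calc _ ≤ (1 / 10 ^ 9 * n ^ 2) * n ^ 2 := mul_le_mul_of_nonneg_right this (sq_nonneg n)
      _ = _ := by ring
  set k : ℝ := n / 1000 with hk
  have hI : ((G.impure P Q k).card : ℝ) ≤ 1 / 1000 * n ^ 2 := by
    have h1 := (card_impure_le (G := G) P Q (k := k) (by positivity)).trans hX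
    rw [hk] at h1
    by_contra hc
    push Not at hc
    have : 1 / 1000 * n ^ 2 * (n / 1000 * (n / 1000)) <
        (G.impure P Q (n / 1000)).card * (n / 1000 * (n / 1000)) := by gcongr
    nlinarith [pow_pos hn0 4]
  have hpure : 1 / 100 * n ^ 3 ≤ (G.pureEdges P Q k).card := by
    have h1 := card_crossEdges_le (G := G) P Q (k := k) (by positivity)
    rw [← hn, hk] at h1
    have h2 : ((G.impure P Q (n / 1000)).card : ℝ) * n ≤ 1 / 1000 * n ^ 2 * n := by gcongr
    have h3 : 0 ≤ n ^ 3 := by positivity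
    rw [hk]
    nlinarith
  have hquad : 9 / 100000 * n ^ 4 ≤ (G.pureQuads P Q k).card := by
    have h1 := card_cherries_ge (G.pureEdges P Q k) univ (fun _ _ => mem_univ _)
      (G.pureQuads P Q k) (by
        intro p v; simp only [pureQuads, mem_filter, mem_product, mem_univ, and_true])
    have huu : ((univ : Finset (V × V)).card : ℝ) = n ^ 2 := by
      rw [card_univ, Fintype.card_prod, hn]; push_cast; ring
    rw [huu] at h1
    have h2 : ((G.pureEdges P Q k).card : ℝ) ≤ n ^ 3 := by
      have := card_le_univ (G.pureEdges P Q k)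
      rw [Fintype.card_prod, Fintype.card_prod] at this
      have : ((G.pureEdges P Q k).card : ℝ) ≤ n * n * n := by rw [hn]; exact_mod_cast this
      linarith [show n * n * n = n ^ 3 by ring]
    have h3 : (1 / 100 * n ^ 3) ^ 2 ≤ n ^ 2 * ((G.pureQuads P Q k).card + n ^ 3) := by
      refine (pow_le_pow_left₀ (by positivity) hpure 2).trans (h1.trans ?_)
      gcongr
    have h4 : n ^ 2 * (1 / 10000 * n ^ 4) ≤ n ^ 2 * ((G.pureQuads P Q k).card + n ^ 3) := by
      refine le_trans (le_of_eq ?_) h3; ring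
    have h5 := le_of_mul_le_mul_left h4 (by positivity)
    have h6 : 10 ^ 21 * n ^ 3 ≤ n * n ^ 3 := by gcongr
    have h7 : 0 ≤ n ^ 3 := by positivity
    nlinarith
  have h1 := card_quads_le_crossCommon hn hδ hPQ hR hP
  have h2 := card_quads_le_reachable hn hδ hPQ (β := 1 / 10 ^ 24) (by positivity) hR hP
  have h3 : ((G.pureQuads P Q k).filter fun t => ((G.nb t.1.2 t.2 ∩ Q).card : ℝ) < n / 1000).card +
      ((G.pureQuads P Q k).filter fun t => n / 1000 ≤ ((G.nb t.1.2 t.2 ∩ Q).card : ℝ)).card =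
      (G.pureQuads P Q k).card := by
    simp only [← not_lt]
    exact card_filter_add_card_filter_not _
  rw [← hk] at h1 h2 h3
  set a : ℝ := (((G.pureQuads P Q k).filter
    fun t => ((G.nb t.1.2 t.2 ∩ Q).card : ℝ) < k).card : ℝ) with ha
  set b : ℝ := (((G.pureQuads P Q k).filter
    fun t => k ≤ ((G.nb t.1.2 t.2 ∩ Q).card : ℝ)).card : ℝ) with hb
  have h3' : a + b = (G.pureQuads P Q k).card := by rw [ha, hb]; exact_mod_cast h3
  have n4 : 0 < n ^ 4 := by positivity
  have ha' : a ≤ 1 / 10 ^ 8 * n ^ 4 := by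
    have : n * (a / 10) ≤ n * (1 / 10 ^ 9 * n ^ 4) := by nlinarith
    have := le_of_mul_le_mul_left this hn0
    norm_num at this ⊢
    linarith
  have hb' : 8 / 100000 * n ^ 4 ≤ b := by
    norm_num at ha'
    linarith
  have hb2 : b / 10000 ≤ 1 / 10 ^ 20 * n ^ 4 := by
    have e1 : ((G.reachable P Q (1 / 10 ^ 24)).card : ℝ) + 256 * (1 / 10 ^ 24) * n ^ 2 ≤
        1 / 10 ^ 20 * n ^ 2 := by
      have := sq_nonneg n
      norm_num at hcon ⊢
      linarith
    have e2 : n ^ 2 * (b / 10000) ≤ n ^ 2 * (1 / 10 ^ 20 * n ^ 4) := by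
      calc n ^ 2 * (b / 10000) = b * (n / 10) * k := by rw [hk]; ring
        _ ≤ _ := h2
        _ ≤ (1 / 10 ^ 20 * n ^ 2) * n ^ 4 := mul_le_mul_of_nonneg_right e1 n4.le
        _ = _ := by ring
    exact le_of_mul_le_mul_left e2 (by positivity)
  norm_num at hb2
  linarith

end TriGraph

/-! ### Switchers for every pair of vertices. -/

theorem sum_le_card_heavy {V : Type u} (P : Finset V) (f : V → ℝ) {k M : ℝ} (hk : 0 ≤ k)
    (hM : ∀ y ∈ P, f y ≤ M) :
    ∑ y ∈ P, f y ≤ (P.filter fun y => k ≤ f y).card * M + P.card * k := by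
  rw [← sum_filter_add_sum_filter_not P (fun y => k ≤ f y)]
  refine add_le_add ?_ ?_
  · rw [← nsmul_eq_mul]
    exact sum_le_card_nsmul _ _ _ fun y hy => hM y (mem_filter.1 hy).1
  · refine (sum_le_card_nsmul _ _ k fun y hy => (not_le.1 (mem_filter.1 hy).2).le).trans ?_
    rw [nsmul_eq_mul]
    refine mul_le_mul_of_nonneg_right ?_ hk
    exact_mod_cast card_le_card (filter_subset _ _)

namespace TriGraph

variable {V : Type u} [Fintype V] {G : TriGraph V}

/-- Two vertices with at least `n⁴ / 10²⁴` switchers of size four. -/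
def Near (G : TriGraph V) (l x : V) : Prop :=
  (1 / 10 ^ 24 : ℝ) * (Fintype.card V : ℝ) ^ 4 ≤ (G.switchers 4 {l} {x}).card

theorem Near.symm {l x : V} (h : G.Near l x) : G.Near x l := by
  rw [Near, switchers_comm]; exact h

theorem near_of_common
    (hδ : ∀ x y : V, x ≠ y → 2 / 5 * (Fintype.card V : ℝ) ≤ (G.nb x y).card)
    (hn : (10 : ℝ) ^ 100 ≤ Fintype.card V) {l x : V}
    (h : 1 / 1000 * (Fintype.card V : ℝ) ^ 2 ≤ (G.common l x).card) : G.Near l x := by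
  have := switchers_of_common hδ (c := 1 / 1000) (by norm_num) h
    (le_trans (by norm_num) hn) (by
      have : (10 : ℝ) ^ 7 ≤ Fintype.card V := le_trans (by norm_num) hn
      linarith)
  refine le_trans (mul_le_mul_of_nonneg_right ?_ (by positivity)) this
  norm_num

/-- A chain of two steps of size four through a middle vertex, whence `4 + 4 + 1`. -/
theorem switchers_nine_of_near {l x : V} (Y : Finset V) (hl : l ∉ Y) (hx : x ∉ Y)
    (hn : (10 : ℝ) ^ 100 ≤ Fintype.card V)
    (hY : (1 / 10 ^ 25 : ℝ) * Fintype.card V ≤ Y.card) (h1 : ∀ y ∈ Y, G.Near l y)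
    (h2 : ∀ y ∈ Y, G.Near y x) :
    (1 / 10 ^ 80 : ℝ) * (Fintype.card V : ℝ) ^ 9 ≤ (G.switchers 9 {l} {x}).card := by
  have hn28 : (10 : ℝ) ^ 28 ≤ Fintype.card V := le_trans (by norm_num) hn
  have h := switchers_chain (s := 4) (t := 4) (ρ := 1 / 10 ^ 25) (β := 1 / 10 ^ 24)
    (β' := 1 / 10 ^ 24) (by positivity) (by positivity) Y hl hx hY h1 h2 (by linarith)
    (by push_cast; linarith) (by
      have : (0 : ℝ) < Fintype.card V := lt_of_lt_of_le (by positivity) hn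
      exact_mod_cast this)
  refine le_trans (mul_le_mul_of_nonneg_right ?_ (by positivity)) h
  norm_num

theorem switchers_fourteen_of_nine
    (hδ : ∀ x y : V, x ≠ y → 2 / 5 * (Fintype.card V : ℝ) ≤ (G.nb x y).card)
    (hn : (10 : ℝ) ^ 100 ≤ Fintype.card V) {l x : V}
    (h : (1 / 10 ^ 80 : ℝ) * (Fintype.card V : ℝ) ^ 9 ≤ (G.switchers 9 {l} {x}).card) :
    (1 / 10 ^ 200 : ℝ) * (Fintype.card V : ℝ) ^ 14 ≤ (G.switchers 14 {l} {x}).card := by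
  have hn28 : (10 : ℝ) ^ 28 ≤ Fintype.card V := le_trans (by norm_num) hn
  have hc : ((({l} : Finset V) ∪ {x}).card : ℝ) ≤ 2 := by
    have := card_union_le ({l} : Finset V) {x}
    simp only [card_singleton] at this
    exact_mod_cast this
  have h' := switchers_pad (τ := 1 / 1000000) (by norm_num) h
    (card_tSets_ge hδ (le_trans (by norm_num) hn)) (by push_cast; linarith) (by
      have : (0 : ℝ) < Fintype.card V := lt_of_lt_of_le (by positivity) hn
      exact_mod_cast this)
  refine le_trans (mul_le_mul_of_nonneg_right ?_ (by positivity)) h'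
  norm_num

theorem switchers_fourteen_of_near
    (hδ : ∀ x y : V, x ≠ y → 2 / 5 * (Fintype.card V : ℝ) ≤ (G.nb x y).card)
    (hn : (10 : ℝ) ^ 100 ≤ Fintype.card V) {l x : V} (h : G.Near l x) :
    (1 / 10 ^ 200 : ℝ) * (Fintype.card V : ℝ) ^ 14 ≤ (G.switchers 14 {l} {x}).card := by
  have hn28 : (10 : ℝ) ^ 28 ≤ Fintype.card V := le_trans (by norm_num) hn
  have hc : ((({l} : Finset V) ∪ {x}).card : ℝ) ≤ 2 := by
    have := card_union_le ({l} : Finset V) {x}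
    simp only [card_singleton] at this
    exact_mod_cast this
  have h' := switchers_pad (τ := 1 / 1000000) (by norm_num) h
    (card_tSets_ge hδ (le_trans (by norm_num) hn)) (by push_cast; linarith) (by
      have : (0 : ℝ) < Fintype.card V := lt_of_lt_of_le (by positivity) hn
      exact_mod_cast this)
  refine switchers_fourteen_of_nine hδ hn
    (le_trans (mul_le_mul_of_nonneg_right ?_ (by positivity)) h')
  norm_num

/-- Chains of three steps through `P` and `Q`. -/
theorem switchers_fourteen_of_reachable (hn : (10 : ℝ) ^ 100 ≤ Fintype.card V)
    {l x : V} {P Q : Finset V} (hP : ∀ y ∈ P, G.Near l y)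
    (hQ : ∀ y ∈ Q, G.Near x y) (hPQ : Disjoint P Q) (hlP : l ∉ P) (hlQ : l ∉ Q) (hxQ : x ∉ Q)
    (hR : (1 / 10 ^ 24 : ℝ) * (Fintype.card V : ℝ) ^ 2 ≤ (G.reachable P Q (1 / 10 ^ 24)).card) :
    (1 / 10 ^ 200 : ℝ) * (Fintype.card V : ℝ) ^ 14 ≤ (G.switchers 14 {l} {x}).card := by
  set n : ℝ := (Fintype.card V : ℝ) with hndef
  have hn0 : 0 < n := lt_of_lt_of_le (by positivity) hn
  have hcard : ∀ S : Finset V, (S.card : ℝ) ≤ n := fun S => by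
    rw [hndef]; exact_mod_cast card_le_univ S
  set D : V → Finset V := fun y' => P.filter fun y => G.Near y y' with hD
  have h1 := card_ext_eq Q D ((G.reachable P Q (1 / 10 ^ 24)).image fun z => (z.2, z.1)) (by
    intro a v
    simp only [mem_image, reachable, mem_filter, mem_product, hD, Prod.mk.injEq, Prod.exists]
    constructor
    · rintro ⟨y, y', ⟨⟨hy, hy'⟩, h⟩, rfl, rfl⟩; exact ⟨hy', hy, h⟩
    · rintro ⟨hy', hy, h⟩; exact ⟨v, a, ⟨⟨hy, hy'⟩, h⟩, rfl, rfl⟩)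
  rw [card_image_of_injective _ (fun z w h => by
    simp only [Prod.mk.injEq] at h; exact Prod.ext h.2 h.1)] at h1
  have h2 := sum_le_card_heavy Q (fun y' => ((D y').card : ℝ)) (k := 1 / 10 ^ 25 * n) (M := n)
    (by positivity) fun y _ => hcard _
  rw [h1] at hR
  push_cast at hR
  set Y' := Q.filter fun y' => 1 / 10 ^ 25 * n ≤ ((D y').card : ℝ) with hY'
  have h3 : (1 / 10 ^ 25 : ℝ) * n ≤ Y'.card := by
    have h4 : (Q.card : ℝ) * (1 / 10 ^ 25 * n) ≤ n * (1 / 10 ^ 25 * n) := by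
      gcongr; exact hcard Q
    have h5 : (1 / 10 ^ 25 * n) * n ≤ Y'.card * n := by
      have e : (1 / 10 ^ 24 : ℝ) * n ^ 2 = 10 * (1 / 10 ^ 25 * n * n) := by ring
      have : 0 ≤ 1 / 10 ^ 25 * n * n := by positivity
      have := hR.trans h2
      linarith
    exact le_of_mul_le_mul_right h5 hn0
  have h9 : ∀ y' ∈ Y', (1 / 10 ^ 80 : ℝ) * (Fintype.card V : ℝ) ^ 9 ≤
      (G.switchers 9 {l} {y'}).card := by
    intro y' hy'
    rw [hY', mem_filter] at hy'
    refine switchers_nine_of_near (D y') (fun h => hlP (mem_filter.1 h).1)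
      (fun h => disjoint_left.1 hPQ (mem_filter.1 h).1 hy'.1) hn hy'.2
      (fun y hy => hP y (mem_filter.1 hy).1) fun y hy => (mem_filter.1 hy).2
  have hn28 : (10 : ℝ) ^ 28 ≤ n := le_trans (by norm_num) hn
  have hn82 : (10 : ℝ) ^ 82 ≤ n := le_trans (by norm_num) hn
  have h := switchers_chain (s := 9) (t := 4) (ρ := 1 / 10 ^ 25) (β := 1 / 10 ^ 80)
    (β' := 1 / 10 ^ 24) (by positivity) (by positivity) Y'
    (fun h => hlQ (mem_filter.1 h).1) (fun h => hxQ (mem_filter.1 h).1) h3 h9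
    (fun y hy => (hQ y (mem_filter.1 hy).1).symm) (by rw [← hndef]; linarith)
    (by push_cast; rw [← hndef]; linarith) (by rw [hndef] at hn0; exact_mod_cast hn0)
  refine le_trans (mul_le_mul_of_nonneg_right ?_ (by positivity)) h
  norm_num

/-- There are at least `0.35 ^ 2 * n ^ 2` pairs in `P × Q`, each with at least `0.39 * n` neighbours
in `P ∪ Q`. Each such triple is of type `PPQ` or `QQP`, so one type makes up half the total, more
than `n ^ 3 / 50`. -/
theorem card_crossEdges_ge {P Q : Finset V}
    (hδ : ∀ x y : V, x ≠ y → 2 / 5 * (Fintype.card V : ℝ) ≤ (G.nb x y).card)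
    (hPQ : Disjoint P Q)
    (hR : ((univ \ (P ∪ Q)).card : ℝ) ≤ (Fintype.card V : ℝ) / 100)
    (hP : 35 / 100 * (Fintype.card V : ℝ) ≤ P.card)
    (hQ : 35 / 100 * (Fintype.card V : ℝ) ≤ Q.card) :
    1 / 50 * (Fintype.card V : ℝ) ^ 3 ≤ (G.crossEdges P Q).card ∨
      1 / 50 * (Fintype.card V : ℝ) ^ 3 ≤ (G.crossEdges Q P).card := by
  set n : ℝ := (Fintype.card V : ℝ) with hndef
  have hn0 : 0 ≤ n := by positivity
  set S : Finset ((V × V) × V) := ((P ×ˢ Q) ×ˢ univ).filter fun t =>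
    G.adj t.1.1 t.1.2 t.2 ∧ t.2 ∈ P ∪ Q with hS
  have h1 := card_ext_ge (P ×ˢ Q) (fun z => G.nb z.1 z.2 ∩ (P ∪ Q)) S (by
    intro a v; simp only [hS, mem_filter, mem_product, mem_univ, and_true, mem_inter, mem_nb])
    (k := 39 / 100 * n) (by
      intro z hz
      have hne : z.1 ≠ z.2 := fun h =>
        disjoint_left.1 hPQ (mem_product.1 hz).1 (h ▸ (mem_product.1 hz).2)
      have h2 := card_sdiff_real_ge (A := G.nb z.1 z.2) hR
      have h3 : G.nb z.1 z.2 \ (univ \ (P ∪ Q)) = G.nb z.1 z.2 ∩ (P ∪ Q) := by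
        ext v
        simp only [mem_sdiff, mem_inter, mem_univ, true_and, not_not]
      rw [h3] at h2
      have := hδ _ _ hne
      linarith)
  have h2 : S.card ≤ (G.crossEdges P Q).card + (G.crossEdges Q P).card := by
    rw [← card_filter_add_card_filter_not (s := S) (fun t => t.2 ∈ P)]
    refine add_le_add ?_ ?_
    · refine card_le_card_of_injOn (fun t => ((t.1.1, t.2), t.1.2)) ?_ ?_
      · intro t ht
        simp only [hS, coe_filter, Set.mem_ofPred_eq, mem_filter, mem_product] at ht
        simp only [crossEdges, coe_filter, Set.mem_ofPred_eq, mem_product]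
        exact ⟨⟨⟨ht.1.1.1.1, ht.2⟩, ht.1.1.1.2⟩, G.swap23 ht.1.2.1⟩
      · rintro ⟨⟨a, b⟩, c⟩ _ ⟨⟨a', b'⟩, c'⟩ _ h
        simp only [Prod.mk.injEq] at h ⊢
        tauto
    · refine card_le_card_of_injOn (fun t => ((t.1.2, t.2), t.1.1)) ?_ ?_
      · intro t ht
        simp only [hS, coe_filter, Set.mem_ofPred_eq, mem_filter, mem_product, mem_union] at ht
        simp only [crossEdges, coe_filter, Set.mem_ofPred_eq, mem_product]
        exact ⟨⟨⟨ht.1.1.1.2, ht.1.2.2.resolve_left ht.2⟩, ht.1.1.1.1⟩, rot ht.1.2.1⟩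
      · rintro ⟨⟨a, b⟩, c⟩ _ ⟨⟨a', b'⟩, c'⟩ _ h
        simp only [Prod.mk.injEq] at h ⊢
        tauto
  have h2' : (S.card : ℝ) ≤ (G.crossEdges P Q).card + (G.crossEdges Q P).card := by
    exact_mod_cast h2
  have h3 : (35 / 100 * n) * (35 / 100 * n) * (39 / 100 * n) ≤ S.card := by
    refine le_trans ?_ h1
    rw [card_product]
    push_cast
    gcongr
  by_contra! hcon
  have : 0 ≤ n ^ 3 := by positivity
  nlinarith [hcon.1, hcon.2]

/-- If `P` is large then `x` is near to many of its vertices. -/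
theorem card_near_ge
    (hδ : ∀ x y : V, x ≠ y → 2 / 5 * (Fintype.card V : ℝ) ≤ (G.nb x y).card)
    (hn : (10 : ℝ) ^ 100 ≤ Fintype.card V) (x : V) {P : Finset V}
    (hP : 61 / 100 * (Fintype.card V : ℝ) ≤ P.card) :
    (1 / 10 ^ 25 : ℝ) * Fintype.card V ≤ (P.filter fun y => G.Near x y).card := by
  set n : ℝ := (Fintype.card V : ℝ) with hndef
  have hn100 : 100 ≤ n := le_trans (by norm_num) hn
  have hn0 : 0 < n := by linarith
  set S : Finset ((V × V) × V) := (G.link x ×ˢ P).filter fun t => G.adj t.1.1 t.1.2 t.2 with hS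
  have h1 := card_ext_ge (G.link x) (fun z => G.nb z.1 z.2 ∩ P) S (by
    intro a v; simp only [hS, mem_filter, mem_product, mem_inter, mem_nb]; tauto)
    (k := 1 / 100 * n) (by
      intro z hz
      have hd := hδ z.1 z.2 (ne23 (mem_link.1 hz))
      -- As `0.40 + 0.61 > 1`, every pair in the link of `x` has at least `n / 100` neighbours in
      -- `P`; these neighbours have the pair in common with `x`.
      have e := card_union_add_card_inter (G.nb z.1 z.2) P
      have e' : ((G.nb z.1 z.2 ∪ P).card : ℝ) + (G.nb z.1 z.2 ∩ P).card =
        (G.nb z.1 z.2).card + P.card := by exact_mod_cast e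
      have : ((G.nb z.1 z.2 ∪ P).card : ℝ) ≤ n := by rw [hndef]; exact_mod_cast card_le_univ _
      linarith)
  have h2 := card_ext_eq P (fun y => G.common x y) (S.image fun t => (t.2, t.1)) (by
    intro a v
    simp only [hS, mem_image, mem_filter, mem_product, mem_common, mem_link, Prod.mk.injEq,
      Prod.exists]
    constructor
    · rintro ⟨p, q, c, ⟨⟨h1, h2⟩, h3⟩, rfl, rfl⟩; exact ⟨h2, h1, rot' h3⟩
    · rintro ⟨h1, h2, h3⟩; exact ⟨v.1, v.2, a, ⟨⟨h2, h1⟩, rot h3⟩, rfl, rfl⟩)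
  rw [card_image_of_injective _ (fun z w h => by
    simp only [Prod.mk.injEq] at h; exact Prod.ext h.2 h.1)] at h2
  have h3 := sum_le_card_heavy P (fun y => ((G.common x y).card : ℝ)) (k := 1 / 1000 * n ^ 2)
    (M := n ^ 2) (by positivity) fun y _ => by
      have := card_le_univ (G.common x y)
      rw [Fintype.card_prod] at this
      rw [hndef, sq]; exact_mod_cast this
  have h4 : ((P.filter fun y => 1 / 1000 * n ^ 2 ≤ ((G.common x y).card : ℝ)).card : ℝ) ≤
      (P.filter fun y => G.Near x y).card := by
    refine Nat.cast_le.2 (card_le_card fun y hy => ?_)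
    rw [mem_filter] at hy ⊢
    exact ⟨hy.1, near_of_common hδ hn hy.2⟩
  have h5 := card_link_ge hδ x
  rw [← hndef] at h5
  have h6 : 39 / 100 * n ^ 2 * (1 / 100 * n) ≤ S.card := by
    refine le_trans ?_ h1
    gcongr
    nlinarith
  rw [h2] at h6
  push_cast at h6
  have h7 : (P.card : ℝ) ≤ n := by rw [hndef]; exact_mod_cast card_le_univ P
  have h8 : (P.card : ℝ) * (1 / 1000 * n ^ 2) ≤ n * (1 / 1000 * n ^ 2) := by gcongr
  have h9 : n ^ 2 * (1 / 1000 * n) ≤ n ^ 2 * (P.filter fun y => G.Near x y).card := by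
    have h10 : ((P.filter fun y => 1 / 1000 * n ^ 2 ≤ ((G.common x y).card : ℝ)).card : ℝ) * n ^ 2
      ≤ (P.filter fun y => G.Near x y).card * n ^ 2 := by gcongr
    have : 0 ≤ n ^ 3 := by positivity
    nlinarith
  have h10 := le_of_mul_le_mul_left h9 (by positivity)
  refine le_trans (mul_le_mul_of_nonneg_right ?_ hn0.le) h10
  norm_num

/-- If `l` and `x` are not near, then every other vertex is near one of them. A linear set near both
gives a two-step chain; this includes the case of a class of size `0.61 * n` near one of them, by
`card_near_ge`. Otherwise the vertices near only `l` and those near only `x` form two classes of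
comparable size, and a reachable pair between the classes supplies the middle step of a three-step
chain. -/
theorem card_switchers_fourteen_ge
    (hδ : ∀ x y : V, x ≠ y → 2 / 5 * (Fintype.card V : ℝ) ≤ (G.nb x y).card)
    (hn : (10 : ℝ) ^ 100 ≤ Fintype.card V) (l x : V) :
    (1 / 10 ^ 200 : ℝ) * (Fintype.card V : ℝ) ^ 14 ≤ (G.switchers 14 {l} {x}).card := by
  by_cases hW : G.Near l x
  · exact switchers_fourteen_of_near hδ hn hW
  set n : ℝ := (Fintype.card V : ℝ) with hndef
  have hn4 : (10 : ℝ) ^ 4 ≤ n := le_trans (by norm_num) hn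
  have hn21 : (10 : ℝ) ^ 21 ≤ n := le_trans (by norm_num) hn
  have hn0 : 0 < n := by linarith
  set U : Finset V := univ \ {l, x} with hU
  have hlU : l ∉ U := by simp [hU]
  have hxU : x ∉ U := by simp [hU]
  set P₀ := U.filter fun y => G.Near l y with hP₀
  set Q₀ := U.filter fun y => G.Near x y with hQ₀
  have hPU : P₀ ⊆ U := filter_subset _ _
  have hQU : Q₀ ⊆ U := filter_subset _ _
  -- Among `l`, `x`, `y` two have a large common link, and by assumption these are not `l` and `x`.
  have hcov : ∀ y, G.Near l y ∨ G.Near x y := by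
    intro y
    rcases exists_common_ge hδ (le_trans (by norm_num) hn) l x y with h | h | h
    · exact absurd (near_of_common hδ hn (le_trans (by gcongr; norm_num) h)) hW
    · exact Or.inl (near_of_common hδ hn (le_trans (by gcongr; norm_num) h))
    · exact Or.inr (near_of_common hδ hn (le_trans (by gcongr; norm_num) h))
  have two : ∀ Y ⊆ U, (1 / 10 ^ 25 : ℝ) * n ≤ Y.card → (∀ y ∈ Y, G.Near l y) →
      (∀ y ∈ Y, G.Near x y) → (1 / 10 ^ 200 : ℝ) * n ^ 14 ≤ (G.switchers 14 {l} {x}).card := by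
    intro Y hY hc h1 h2
    exact switchers_fourteen_of_nine hδ hn (switchers_nine_of_near Y (fun h => hlU (hY h))
      (fun h => hxU (hY h)) hn hc h1 fun y hy => (h2 y hy).symm)
  by_cases hI : (1 / 10 ^ 25 : ℝ) * n ≤ (P₀ ∩ Q₀).card
  · exact two _ (inter_subset_left.trans hPU) hI (fun y hy => (mem_filter.1 (mem_inter.1 hy).1).2)
      fun y hy => (mem_filter.1 (mem_inter.1 hy).2).2
  push Not at hI
  by_cases hP1 : 61 / 100 * n ≤ (P₀ \ Q₀).card
  · refine two _ ?_ (card_near_ge hδ hn x hP1) ?_ ?_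
    · exact (filter_subset _ _).trans (sdiff_subset.trans hPU)
    · exact fun y hy => (mem_filter.1 (mem_sdiff.1 (mem_filter.1 hy).1).1).2
    · exact fun y hy => (mem_filter.1 hy).2
  by_cases hQ1 : 61 / 100 * n ≤ (Q₀ \ P₀).card
  · refine two _ ?_ (card_near_ge hδ hn l hQ1) ?_ ?_
    · exact (filter_subset _ _).trans (sdiff_subset.trans hQU)
    · exact fun y hy => (mem_filter.1 hy).2
    · exact fun y hy => (mem_filter.1 (mem_sdiff.1 (mem_filter.1 hy).1).1).2
  push Not at hP1 hQ1
  set P := P₀ \ Q₀ with hP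
  set Q := Q₀ \ P₀ with hQ
  have hPQ : Disjoint P Q := disjoint_left.2 fun v h1 h2 =>
    (mem_sdiff.1 h1).2 (mem_sdiff.1 h2).1
  have hR : ((univ \ (P ∪ Q)).card : ℝ) ≤ n / 100 := by
    have hsub : univ \ (P ∪ Q) ⊆ (P₀ ∩ Q₀) ∪ {l, x} := by
      intro v hv
      simp only [hP, hQ, hP₀, hQ₀, hU, mem_sdiff, mem_union, mem_filter, mem_univ, mem_inter,
        mem_insert, mem_singleton, true_and] at hv ⊢
      have := hcov v
      tauto
    have h1 := (card_le_card hsub).trans (card_union_le _ _)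
    have h2 : ({l, x} : Finset V).card ≤ 2 := card_le_two
    have h3 : ((univ \ (P ∪ Q)).card : ℝ) ≤ (P₀ ∩ Q₀).card + 2 := by
      exact_mod_cast h1.trans (by omega)
    have h4 : (1 / 10 ^ 25 : ℝ) * n ≤ 1 / 1000 * n :=
      mul_le_mul_of_nonneg_right (by norm_num) hn0.le
    linarith
  have hPQc : n ≤ P.card + Q.card + n / 100 := by
    have h1 := card_sdiff_add_card_inter (univ : Finset V) (P ∪ Q)
    rw [univ_inter, card_union_of_disjoint hPQ, card_univ] at h1
    have : ((univ \ (P ∪ Q)).card : ℝ) + (P.card + Q.card) = n := by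
      rw [hndef]; exact_mod_cast h1
    linarith
  have hNP : ∀ y ∈ P, G.Near l y := fun y hy => (mem_filter.1 (mem_sdiff.1 hy).1).2
  have hNQ : ∀ y ∈ Q, G.Near x y := fun y hy => (mem_filter.1 (mem_sdiff.1 hy).1).2
  have hPU' : P ⊆ U := sdiff_subset.trans hPU
  have hQU' : Q ⊆ U := sdiff_subset.trans hQU
  -- The count of reachable pairs is not symmetric in the classes, so the orientation of the chain
  -- follows the prevalent type of crossing edge.
  rcases card_crossEdges_ge hδ hPQ hR (by linarith) (by linarith) with hE | hE
  · exact switchers_fourteen_of_reachable hn hNP hNQ hPQ (fun h => hlU (hPU' h))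
      (fun h => hlU (hQU' h)) (fun h => hxU (hQU' h)) (card_reachable_ge hδ hPQ hR hP1.le hE hn21)
  · rw [switchers_comm]
    exact switchers_fourteen_of_reachable hn hNQ hNP hPQ.symm (fun h => hxU (hQU' h))
      (fun h => hxU (hPU' h)) (fun h => hlU (hPU' h))
      (card_reachable_ge hδ hPQ.symm (by rwa [union_comm]) hQ1.le hE hn21)

end TriGraph

/-! ### Greedy construction of the absorbing set. -/

section

variable {V : Type u} [Fintype V]

/-- Greedy selection of pairwise disjoint sets hitting each of the dense families `𝒜 L` often. -/
theorem exists_hitting_family {ι : Type*} (I : Finset ι) (hI : I.Nonempty) {t : ℕ} (ht : 0 < t)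
    (𝒜 : ι → Finset (Finset V)) (h𝒜 : ∀ L ∈ I, ∀ A ∈ 𝒜 L, A.card = t) {β : ℝ} (hβ0 : 0 < β)
    (hβ : ∀ L ∈ I, β * (Fintype.card V : ℝ) ^ t ≤ (𝒜 L).card) (hn : 0 < Fintype.card V) (m : ℕ)
    (hm : 2 * ((t * m : ℕ) : ℝ) ≤ β * Fintype.card V) :
    ∃ F : Finset (Finset V), F.card = m ∧ (∀ A ∈ F, ∀ B ∈ F, A ≠ B → Disjoint A B) ∧
      (∀ A ∈ F, ∃ L ∈ I, A ∈ 𝒜 L) ∧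
      ∑ L ∈ I, (1 / 2 : ℝ) ^ (F.filter fun A => A ∈ 𝒜 L).card ≤ I.card * (1 - β / 4) ^ m := by
  induction m with
  | zero => exact ⟨∅, by simp, by simp, by simp, by simp⟩
  | succ m ih =>
    have hm' : 2 * ((t * m : ℕ) : ℝ) ≤ β * Fintype.card V := by
      refine le_trans ?_ hm
      gcongr
      omega
    obtain ⟨F, hFm, hFd, hFI, hFW⟩ := ih hm'
    set Z : Finset V := F.biUnion id with hZ
    have hZc : Z.card ≤ t * m := by
      have := card_biUnion_le_card_mul F id t fun A hA => by
        obtain ⟨L, hL, hAL⟩ := hFI A hA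
        exact (h𝒜 L hL A hAL).le
      rw [hFm, mul_comm] at this
      exact this
    -- The weight of `L` halves with each hit, so the total plays the role of a conditional
    -- expectation in a derandomised random choice.
    set w : ι → ℝ := fun L => (1 / 2 : ℝ) ^ (F.filter fun A => A ∈ 𝒜 L).card with hw
    have hw0 : ∀ L, 0 < w L := fun L => by positivity
    set n : ℝ := (Fintype.card V : ℝ) with hndef
    have hn0 : 0 < n := by rw [hndef]; exact_mod_cast hn
    have hav : ∀ L ∈ I, β / 2 * n ^ t ≤ ((𝒜 L).filter fun A => Disjoint A Z).card := by
      intro L hL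
      refine card_avoiding_ge (𝒜 L) (h𝒜 L hL) Z (hβ L hL) (le_trans ?_ hm') hn
      have : (Z.card : ℝ) ≤ ((t * m : ℕ) : ℝ) := by exact_mod_cast hZc
      linarith
    set Ω : Finset (Finset V) := I.biUnion fun L => (𝒜 L).filter fun A => Disjoint A Z with hΩ
    have hΩc : (Ω.card : ℝ) ≤ n ^ t := by
      have := card_sets_le_pow Ω (t := t) fun A hA => by
        obtain ⟨L, hL, hA⟩ := mem_biUnion.1 hA
        exact h𝒜 L hL A (mem_filter.1 hA).1
      rw [hndef]; exact_mod_cast this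
    have hΩne : Ω.Nonempty := by
      obtain ⟨L, hL⟩ := hI
      have h1 := hav L hL
      have : 0 < β / 2 * n ^ t := by positivity
      have h2 : 0 < ((𝒜 L).filter fun A => Disjoint A Z).card := by
        have := this.trans_le h1; exact_mod_cast this
      obtain ⟨A, hA⟩ := card_pos.1 h2
      exact ⟨A, mem_biUnion.2 ⟨L, hL, hA⟩⟩
    set W : ℝ := ∑ L ∈ I, w L with hWdef
    have hW0 : 0 < W := sum_pos (fun L _ => hw0 L) hI
    -- Averaging over `Ω`: each `L` is served by at least `β / 2 * n ^ t` of at most `n ^ t`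
    -- candidates, so some candidate serves a `β / 2` share of the weight.
    have hex : ∃ A ∈ Ω, β / 2 * W ≤ ∑ L ∈ I, if A ∈ 𝒜 L then w L else 0 := by
      refine exists_le_of_sum_le hΩne ?_
      rw [sum_const, nsmul_eq_mul, sum_comm]
      calc (Ω.card : ℝ) * (β / 2 * W) ≤ n ^ t * (β / 2 * W) := by gcongr
        _ = ∑ L ∈ I, β / 2 * n ^ t * w L := by rw [← mul_sum]; ring
        _ ≤ _ := by
          refine sum_le_sum fun L hL => ?_
          rw [← sum_filter, sum_const, nsmul_eq_mul]
          refine mul_le_mul_of_nonneg_right ((hav L hL).trans ?_) (hw0 L).le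
          refine Nat.cast_le.2 (card_le_card fun A hA => ?_)
          exact mem_filter.2 ⟨mem_biUnion.2 ⟨L, hL, hA⟩, (mem_filter.1 hA).1⟩
    obtain ⟨A, hAΩ, hA⟩ := hex
    obtain ⟨L₀, hL₀, hAL₀⟩ := mem_biUnion.1 hAΩ
    rw [mem_filter] at hAL₀
    have hAne : A.Nonempty := by rw [← card_pos, h𝒜 L₀ hL₀ A hAL₀.1]; exact ht
    have hAF : ∀ B ∈ F, Disjoint A B := fun B hB =>
      disjoint_of_subset_right (subset_biUnion_of_mem id hB) hAL₀.2
    have hAnF : A ∉ F := fun h => by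
      have := hAF A h
      rw [disjoint_self_iff_empty] at this
      exact hAne.ne_empty this
    refine ⟨insert A F, by rw [card_insert_of_notMem hAnF, hFm], ?_, ?_, ?_⟩
    · intro B hB C hC hne
      rcases mem_insert.1 hB with rfl | hB' <;> rcases mem_insert.1 hC with rfl | hC'
      · exact absurd rfl hne
      · exact hAF C hC'
      · exact (hAF B hB').symm
      · exact hFd B hB' C hC' hne
    · intro B hB
      rcases mem_insert.1 hB with rfl | hB'
      · exact ⟨L₀, hL₀, hAL₀.1⟩
      · exact hFI B hB'
    · have hstep : ∀ L, (1 / 2 : ℝ) ^ ((insert A F).filter fun B => B ∈ 𝒜 L).card =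
          w L - 1 / 2 * (if A ∈ 𝒜 L then w L else 0) := by
        intro L
        by_cases h : A ∈ 𝒜 L
        · rw [filter_insert, if_pos h, if_pos h, card_insert_of_notMem (fun h' =>
            hAnF (mem_filter.1 h').1), pow_succ]
          ring
        · rw [filter_insert, if_neg h, if_neg h, mul_zero, sub_zero]
      have h1 : 0 ≤ 1 - β / 4 := by
        obtain ⟨L, hL⟩ := hI
        have h2 := card_sets_le_pow (𝒜 L) (h𝒜 L hL)
        have h3 : ((𝒜 L).card : ℝ) ≤ n ^ t := by rw [hndef]; exact_mod_cast h2
        have h4 : β * n ^ t ≤ 1 * n ^ t := by linarith [hβ L hL]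
        have := le_of_mul_le_mul_right h4 (by positivity)
        linarith
      calc _ = W - 1 / 2 * ∑ L ∈ I, (if A ∈ 𝒜 L then w L else 0) := by
            rw [sum_congr rfl fun L _ => hstep L, sum_sub_distrib, ← mul_sum]
        _ ≤ (1 - β / 4) * W := by linarith
        _ ≤ (1 - β / 4) * (I.card * (1 - β / 4) ^ m) := by gcongr
        _ = _ := by ring

end

namespace TriGraph

theorem til_biUnion {V : Type u} {G : TriGraph V} (F : Finset (Finset V))
    (hT : ∀ A ∈ F, G.Til A) (hd : ∀ A ∈ F, ∀ B ∈ F, A ≠ B → Disjoint A B) :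
    G.Til (F.biUnion id) := by
  induction F using Finset.induction_on with
  | empty => simpa using Til.empty
  | insert A F hA ih =>
    rw [biUnion_insert]
    refine (hT A (mem_insert_self A F)).union (ih (fun B hB => hT B (mem_insert_of_mem hB))
      fun B hB C hC => hd B (mem_insert_of_mem hB) C (mem_insert_of_mem hC)) ?_
    rw [disjoint_biUnion_right]
    intro B hB
    exact hd A (mem_insert_self A F) B (mem_insert_of_mem hB) fun h => hA (h ▸ hB)

variable {V : Type u} [Fintype V] {G : TriGraph V}

/-- The set `W` is absorbed five vertices at a time. Using up one absorber lowers the supply for any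
other `5`-set by at most one, so a supply of `k` lasts for `k` rounds. -/
theorem til_biUnion_union (k : ℕ) : ∀ (F : Finset (Finset V)) (W : Finset V),
    (∀ A ∈ F, G.Til A) → (∀ A ∈ F, ∀ B ∈ F, A ≠ B → Disjoint A B) →
    W.card = 5 * k → Disjoint (F.biUnion id) W →
    (∀ L ⊆ W, L.card = 5 → k ≤ (F.filter fun A => A ∈ G.absorbers L).card) →
    G.Til (F.biUnion id ∪ W) := by
  induction k with
  | zero =>
    intro F W hT hd hW _ _
    rw [mul_zero, card_eq_zero] at hW
    rw [hW, union_empty]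
    exact til_biUnion F hT hd
  | succ k ih =>
    intro F W hT hd hW hFW hL
    obtain ⟨L, hLW, hL5⟩ := exists_subset_card_eq (s := W) (n := 5) (by omega)
    have h1 := hL L hLW hL5
    obtain ⟨A, hA⟩ := card_pos.1 (Nat.succ_pos k |>.trans_le h1)
    rw [mem_filter, mem_absorbers] at hA
    obtain ⟨hAF, _, hAL, _, hTAL⟩ := hA
    have hFA : F = insert A (F.erase A) := (insert_erase hAF).symm
    have hAd : Disjoint A ((F.erase A).biUnion id) := by
      rw [disjoint_biUnion_right]
      intro B hB
      exact hd A hAF B (mem_of_mem_erase hB) (ne_of_mem_erase hB).symm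
    have hsub : (F.erase A).biUnion id ⊆ F.biUnion id :=
      biUnion_subset_biUnion_of_subset_left _ (erase_subset _ _)
    have h2 := ih (F.erase A) (W \ L) (fun B hB => hT B (mem_of_mem_erase hB))
      (fun B hB C hC => hd B (mem_of_mem_erase hB) C (mem_of_mem_erase hC))
      (by rw [card_sdiff_of_subset hLW]; omega)
      (disjoint_of_subset_left hsub (disjoint_of_subset_right sdiff_subset hFW)) (by
        intro L' hL' hc
        have h3 := hL L' (hL'.trans sdiff_subset) hc
        have h4 : (F.filter fun A => A ∈ G.absorbers L').card ≤
            ((F.erase A).filter fun A => A ∈ G.absorbers L').card + 1 := by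
          refine (card_le_card (t := insert A ((F.erase A).filter fun A => A ∈ G.absorbers L'))
            fun B hB => ?_).trans (card_insert_le _ _)
          rw [mem_filter] at hB
          by_cases hBA : B = A
          · exact hBA ▸ mem_insert_self _ _
          · exact mem_insert_of_mem (mem_filter.2 ⟨mem_erase.2 ⟨hBA, hB.1⟩, hB.2⟩)
        omega)
    have hAW : Disjoint A W := disjoint_of_subset_left (subset_biUnion_of_mem id hAF) hFW
    have h3 := hTAL.union h2 (by
      rw [disjoint_union_left, disjoint_union_right, disjoint_union_right]
      refine ⟨⟨hAd, disjoint_of_subset_right sdiff_subset hAW⟩, ?_, disjoint_sdiff⟩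
      exact (disjoint_of_subset_left hsub (disjoint_of_subset_right hLW hFW)).symm)
    have e : F.biUnion id ∪ W = A ∪ L ∪ ((F.erase A).biUnion id ∪ W \ L) := by
      conv_lhs => rw [hFA, biUnion_insert]
      ext v
      simp only [mem_union, mem_sdiff, id]
      have := @hLW v
      tauto
    rw [e]; exact h3

/-- After `m ≈ ρ * n` greedy choices the potential is at most `n ^ 5 * exp (-β * m / 4)`. Since it
is at least `2 ^ (-h)` for a `5`-set with `h` absorbers chosen, every `h` is at least linear in `n`.
-/
theorem exists_absorbing_set {β σ : ℝ} (hβ0 : 0 < β) (hσ0 : 0 < σ) :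
    ∃ κ > 0, ∃ N : ℕ, ∀ (V : Type u) [Fintype V] (G : TriGraph V), N ≤ Fintype.card V →
      (∀ L : Finset V, L.card = 5 → β * (Fintype.card V : ℝ) ^ 75 ≤ (G.absorbers L).card) →
      ∃ Z : Finset V, (Z.card : ℝ) ≤ σ * Fintype.card V ∧ ∀ W : Finset V, Disjoint Z W →
        5 ∣ W.card → (W.card : ℝ) ≤ κ * Fintype.card V → G.Til (Z ∪ W) := by
  -- The first bound leaves room for disjoint choices (`2 * 75 * m ≤ β * n`), the second keeps the
  -- union of `75`-sets below `σ * n`.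
  set ρ : ℝ := min (β / 150) (σ / 75) with hρ
  have hρ0 : 0 < ρ := by positivity
  have hlog : ∀ᶠ n : ℕ in Filter.atTop, 5 * Real.log n + β / 4 ≤ β * ρ / 8 * n := by
    have h1 : ∀ᶠ x : ℝ in Filter.atTop, ‖Real.log x‖ ≤ β * ρ / 80 * ‖x‖ :=
      Real.isLittleO_log_id_atTop.def (by positivity)
    have h2 := tendsto_natCast_atTop_atTop (R := ℝ) |>.eventually h1
    have h3 := tendsto_natCast_atTop_atTop (R := ℝ) |>.eventually_ge_atTop (4 / ρ)
    filter_upwards [h2, h3] with n hn hn3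
    rw [Real.norm_of_nonneg (Nat.cast_nonneg n)] at hn
    have h4 := (le_abs_self _).trans hn
    rw [div_le_iff₀ hρ0] at hn3
    nlinarith
  obtain ⟨N, hN⟩ := Filter.eventually_atTop.1 hlog
  refine ⟨β * ρ / 8, by positivity, max N 5, fun V _ G hNV hab => ?_⟩
  have hn5 : 5 ≤ Fintype.card V := (le_max_right _ _).trans hNV
  have hlogn := hN _ ((le_max_left _ _).trans hNV)
  set n : ℝ := (Fintype.card V : ℝ) with hndef
  have hn0 : 0 < n := by rw [hndef]; exact_mod_cast (by omega : 0 < Fintype.card V)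
  set m : ℕ := ⌊ρ * n⌋₊ with hm
  have hm1 : (m : ℝ) ≤ ρ * n := Nat.floor_le (by positivity)
  have hm2 : ρ * n - 1 ≤ m := (Nat.sub_one_lt_floor _).le
  have hρβ : ρ ≤ β / 150 := min_le_left _ _
  have hρσ : ρ ≤ σ / 75 := min_le_right _ _
  obtain ⟨F, hFm, hFd, hFI, hFW⟩ := exists_hitting_family (powersetCard 5 (univ : Finset V))
    (powersetCard_nonempty.2 (by rwa [card_univ])) (t := 75) (by norm_num) G.absorbers
    (fun L _ A hA => (mem_absorbers.1 hA).1) hβ0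
    (fun L hL => hab L (mem_powersetCard.1 hL).2) (by omega) m (by
      push_cast; rw [← hndef]
      nlinarith)
  have hFT : ∀ A ∈ F, G.Til A := fun A hA => by
    obtain ⟨L, _, hL⟩ := hFI A hA
    exact (mem_absorbers.1 hL).2.2.1
  have hFc : ∀ A ∈ F, A.card = 75 := fun A hA => by
    obtain ⟨L, _, hL⟩ := hFI A hA
    exact (mem_absorbers.1 hL).1
  have hhit : ∀ L : Finset V, L.card = 5 →
      β * ρ / 8 * n ≤ ((F.filter fun A => A ∈ G.absorbers L).card : ℝ) := by
    intro L hL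
    set h := (F.filter fun A => A ∈ G.absorbers L).card with hh
    have h1 : (1 / 2 : ℝ) ^ h ≤ n ^ 5 * Real.exp (-(β / 4 * m)) := by
      have h2 := (single_le_sum (f := fun L => (1 / 2 : ℝ) ^ (F.filter
        fun A => A ∈ G.absorbers L).card) (fun _ _ => by positivity)
        (mem_powersetCard.2 ⟨subset_univ L, hL⟩)).trans hFW
      refine h2.trans ?_
      have hb1 : (1 - β / 4 : ℝ) ≤ Real.exp (-(β / 4)) := by
        have := Real.add_one_le_exp (-(β / 4)); linarith
      have hb0 : 0 ≤ 1 - β / 4 := by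
        have h3 := card_sets_le_pow (G.absorbers L) fun A hA => (mem_absorbers.1 hA).1
        have h4 : ((G.absorbers L).card : ℝ) ≤ n ^ 75 := by rw [hndef]; exact_mod_cast h3
        have h5 : β * n ^ 75 ≤ 1 * n ^ 75 := by linarith [hab L hL]
        have := le_of_mul_le_mul_right h5 (by positivity)
        linarith
      have hc : ((powersetCard 5 (univ : Finset V)).card : ℝ) ≤ n ^ 5 := by
        rw [card_powersetCard, card_univ, hndef]
        exact_mod_cast Nat.choose_le_pow _ _
      have he : Real.exp (-(β / 4 * m)) = Real.exp (-(β / 4)) ^ m := by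
        rw [← Real.exp_nat_mul]; congr 1; ring
      rw [he]
      gcongr
    have h2 : Real.exp (-(h : ℝ)) ≤ (1 / 2 : ℝ) ^ h := by
      have e : Real.exp (-(h : ℝ)) = Real.exp (-1) ^ h := by
        rw [← Real.exp_nat_mul]; congr 1; ring
      rw [e]
      gcongr
      rw [Real.exp_neg, inv_le_comm₀ (Real.exp_pos _) (by norm_num)]
      have := Real.add_one_le_exp (1 : ℝ)
      linarith
    have h3 : -(h : ℝ) ≤ 5 * Real.log n - β / 4 * m := by
      have h4 := Real.log_le_log (Real.exp_pos _) (h2.trans h1)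
      rw [Real.log_exp, Real.log_mul (by positivity) (Real.exp_pos _).ne', Real.log_exp,
        Real.log_pow] at h4
      push_cast at h4
      linarith
    nlinarith
  refine ⟨F.biUnion id, ?_, fun W hW h5 hWc => ?_⟩
  · have h1 := card_biUnion_le_card_mul F id 75 fun A hA => (hFc A hA).le
    rw [hFm] at h1
    have h2 : ((F.biUnion id).card : ℝ) ≤ m * 75 := by exact_mod_cast h1
    nlinarith
  · obtain ⟨k, hk⟩ := h5
    refine til_biUnion_union k F W hFT hFd hk hW fun L _ hL => ?_
    have h1 := hhit L hL
    have h2 : (W.card : ℝ) = 5 * k := by exact_mod_cast hk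
    have h3 : (k : ℝ) ≤ (F.filter fun A => A ∈ G.absorbers L).card := by
      have : (0 : ℝ) ≤ k := Nat.cast_nonneg k
      linarith
    exact_mod_cast h3

end TriGraph

/-! ### The non-extremal case. -/

namespace TriGraph

/-- The absorbing set is set aside first, so small that the rest keeps its codegree up to `ζ` and
stays non-extremal; the vertices that an almost perfect tiling of the rest misses are then absorbed.
-/
theorem exists_til_univ_of_nonextremal {ζ : ℝ} (hζ0 : 0 < ζ) (hζ : ζ ≤ 1 / 1000) :
    ∃ N : ℕ, ∀ (V : Type u) [Fintype V] (G : TriGraph V), N ≤ Fintype.card V →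
      5 ∣ Fintype.card V →
      (∀ x y : V, x ≠ y → 2 / 5 * (Fintype.card V : ℝ) ≤ (G.nb x y).card) →
      (∀ x y : V, x ≠ y → (2 / 5 + 400 * ζ) * (Fintype.card V : ℝ) ≤ (G.nb x y).card ∨
        400 * ζ * (Fintype.card V : ℝ) ^ 3 ≤ (G.tri (univ \ G.nb x y)).card) →
      G.Til univ := by
  obtain ⟨β, hβ0, N₁, hN₁⟩ := exists_many_absorbers.{u} (β := 1 / 10 ^ 200) (τ := 1 / 1000000)
    (by positivity) (by positivity)
  obtain ⟨κ, hκ0, N₂, hN₂⟩ := exists_absorbing_set.{u} (σ := ζ / 100) hβ0 (by positivity)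
  obtain ⟨N₃, hN₃⟩ := exists_almost_til.{u} hζ0 hζ hκ0
  refine ⟨max (max N₁ N₂) (max (2 * N₃) (10 ^ 100)), fun V _ G hN h5 hδ hne => ?_⟩
  simp only [max_le_iff] at hN
  obtain ⟨⟨hn1, hn2⟩, hn3, hn4⟩ := hN
  have hn : (10 : ℝ) ^ 100 ≤ Fintype.card V := by exact_mod_cast hn4
  obtain ⟨Z, hZc, hZ⟩ := hN₂ V G hn2 (hN₁ V G hn1
    (fun l x _ => card_switchers_fourteen_ge hδ hn l x)
    (card_tSets_ge hδ (le_trans (by norm_num) hn)))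
  set n : ℝ := (Fintype.card V : ℝ) with hndef
  have hn0 : 0 < n := lt_of_lt_of_le (by positivity) hn
  set U : Finset V := univ \ Z with hU
  have hUZ : U.card + Z.card = Fintype.card V := by
    rw [hU, card_sdiff_add_card_eq_card (subset_univ Z), card_univ]
  have hUZ' : (U.card : ℝ) + Z.card = n := by rw [hndef]; exact_mod_cast hUZ
  have hUn : (U.card : ℝ) ≤ n := by linarith [(Nat.cast_nonneg Z.card : (0 : ℝ) ≤ _)]
  have hUh : n / 2 ≤ U.card := by nlinarith
  have hnbU : ∀ x y, ((G.nb x y).card : ℝ) - ζ / 100 * n ≤ (G.nb x y ∩ U).card := by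
    intro x y
    have e : G.nb x y ∩ U = G.nb x y \ Z := by
      ext v; simp only [hU, mem_inter, mem_sdiff, mem_univ, true_and]
    rw [e]; exact card_sdiff_real_ge hZc
  obtain ⟨W, hWU, hWc, hT⟩ := hN₃ V G U (by
      have h1 : ((2 * N₃ : ℕ) : ℝ) ≤ n := by rw [hndef]; exact_mod_cast hn3
      have h2 : (N₃ : ℝ) ≤ U.card := by push_cast at h1; linarith
      exact_mod_cast h2) (by
      intro x _ y _ hxy
      have h1 := hδ x y hxy
      have h2 := hnbU x y
      have h3 : (2 / 5 - ζ / 20) * (U.card : ℝ) ≤ (2 / 5 - ζ / 20) * n := by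
        gcongr; linarith
      nlinarith) (by
      intro x _ y _ hxy
      rcases hne x y hxy with h | h
      · left
        have h2 := hnbU x y
        have h3 : (2 / 5 + 200 * ζ) * (U.card : ℝ) ≤ (2 / 5 + 200 * ζ) * n := by gcongr
        nlinarith
      · right
        have h2 := card_tri_le_add (G := G) (S := univ \ G.nb x y) (S' := U \ G.nb x y)
          (U := univ) (subset_univ _)
        have h3 : ((univ \ G.nb x y) \ (U \ G.nb x y)).card ≤ Z.card := by
          refine card_le_card fun v hv => ?_
          simp only [hU, mem_sdiff, mem_univ, true_and] at hv
          tauto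
        have h4 : ((((univ \ G.nb x y) \ (U \ G.nb x y)).card : ℕ) : ℝ) ≤ ζ / 100 * n := by
          refine le_trans ?_ hZc
          exact_mod_cast h3
        have h5 : ((G.tri (univ \ G.nb x y)).card : ℝ) ≤ (G.tri (U \ G.nb x y)).card +
            3 * (((univ \ G.nb x y) \ (U \ G.nb x y)).card : ℕ) * n ^ 2 := by
          rw [card_univ] at h2
          rw [hndef]; exact_mod_cast h2
        have h6 : 3 * ((((univ \ G.nb x y) \ (U \ G.nb x y)).card : ℕ) : ℝ) * n ^ 2 ≤
            3 * (ζ / 100 * n) * n ^ 2 := by gcongr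
        have h7 : 200 * ζ * (U.card : ℝ) ^ 3 ≤ 200 * ζ * n ^ 3 := by gcongr
        have : 0 < ζ * n ^ 3 := by positivity
        nlinarith)
  -- Absorbing the empty set shows that `Z` is tileable. With `5 ∣ |U \ W|` this yields the
  -- divisibility of `|W|` needed to absorb `W`.
  have hZT := (hZ ∅ (disjoint_empty_right _) (by simp) (by simp; positivity)).dvd_card
  rw [union_empty] at hZT
  have h6 := hT.dvd_card
  rw [card_sdiff_of_subset hWU] at h6
  have hWle := card_le_card hWU
  have hZW : Disjoint Z W := disjoint_of_subset_right hWU disjoint_sdiff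
  have hW := hZ W hZW (by omega) (hWc.trans (by gcongr))
  have h7 := hW.union hT (by
    rw [disjoint_union_left]
    exact ⟨disjoint_of_subset_right sdiff_subset disjoint_sdiff, disjoint_sdiff⟩)
  have e : Z ∪ W ∪ U \ W = univ := by
    ext v
    simp only [hU, mem_union, mem_sdiff, mem_univ, true_and, iff_true]
    tauto
  rwa [e] at h7

end TriGraph

/-! ### Perfect matchings in dense five-partite five-graphs. -/

section

variable {m : ℕ}

theorem exists_cover_fin_five : ∀ p q r : Fin 5, p ≠ q → p ≠ r → q ≠ r →
    ∃ s t : Fin 5, s ≠ p ∧ s ≠ q ∧ s ≠ r ∧ t ≠ p ∧ t ≠ q ∧ t ≠ r ∧ s ≠ t ∧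
      ∀ j, j = p ∨ j = q ∨ j = r ∨ j = s ∨ j = t := by
  decide

/-- Tuples with one prescribed coordinate and a restricted pair of further coordinates. -/
theorem card_tuples_le_of_pairs (S : Finset (Fin 5 → Fin m)) (R : Finset (Fin m × Fin m))
    (k a b c d : Fin 5) (i₀ : Fin m) (hS : ∀ f ∈ S, f k = i₀ ∧ (f a, f b) ∈ R)
    (hcov : ∀ j, j = k ∨ j = a ∨ j = b ∨ j = c ∨ j = d) : S.card ≤ R.card * m ^ 2 := by
  have h : S.card ≤ (R ×ˢ (univ : Finset (Fin m × Fin m))).card := by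
    refine card_le_card_of_injOn (fun f => ((f a, f b), (f c, f d))) ?_ ?_
    · intro f hf
      simp only [coe_product, coe_univ, Set.mem_prod, Set.mem_univ, and_true, mem_coe]
      exact (hS f hf).2
    · intro f hf g hg hfg
      simp only [Prod.mk.injEq] at hfg
      have h1 := (hS f hf).1
      have h2 := (hS g hg).1
      funext j
      rcases hcov j with rfl | rfl | rfl | rfl | rfl
      · rw [h1, h2]
      · exact hfg.1.1
      · exact hfg.1.2
      · exact hfg.2.1
      · exact hfg.2.2
  rw [card_product, card_univ, Fintype.card_prod, Fintype.card_fin] at h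
  rw [sq]; exact h

/-- Tuples with one prescribed coordinate and a restricted triple of further coordinates. -/
theorem card_tuples_le_of_triples (S : Finset (Fin 5 → Fin m))
    (R : Finset (Fin m × Fin m × Fin m)) (k a b c d : Fin 5) (i₀ : Fin m)
    (hS : ∀ f ∈ S, f k = i₀ ∧ (f a, f b, f c) ∈ R)
    (hcov : ∀ j, j = k ∨ j = a ∨ j = b ∨ j = c ∨ j = d) : S.card ≤ R.card * m := by
  have h : S.card ≤ (R ×ˢ (univ : Finset (Fin m))).card := by
    refine card_le_card_of_injOn (fun f => ((f a, f b, f c), f d)) ?_ ?_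
    · intro f hf
      simp only [coe_product, coe_univ, Set.mem_prod, Set.mem_univ, and_true, mem_coe]
      exact (hS f hf).2
    · intro f hf g hg hfg
      simp only [Prod.mk.injEq] at hfg
      have h1 := (hS f hf).1
      have h2 := (hS g hg).1
      funext j
      rcases hcov j with rfl | rfl | rfl | rfl | rfl
      · rw [h1, h2]
      · exact hfg.1.1
      · exact hfg.1.2.1
      · exact hfg.1.2.2
      · exact hfg.2
  rwa [card_product, card_univ, Fintype.card_fin] at h

/-- If every slice of a ternary relation is sparse then few tuples with one prescribed coordinate
satisfy it in the coordinates `p`, `q`, `r`. -/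
theorem card_tuples_le_of_slices (R : Fin m → Fin m → Fin m → Prop) {c : ℝ}
    (h1 : ∀ i, ((univ.filter fun z : Fin m × Fin m => R i z.1 z.2).card : ℝ) ≤ c * (m : ℝ) ^ 2)
    (h2 : ∀ i, ((univ.filter fun z : Fin m × Fin m => R z.1 i z.2).card : ℝ) ≤ c * (m : ℝ) ^ 2)
    (h3 : ∀ i, ((univ.filter fun z : Fin m × Fin m => R z.1 z.2 i).card : ℝ) ≤ c * (m : ℝ) ^ 2)
    {p q r : Fin 5} (hpq : p ≠ q) (hpr : p ≠ r) (hqr : q ≠ r) (k : Fin 5) (i₀ : Fin m) :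
    ((univ.filter fun f : Fin 5 → Fin m => f k = i₀ ∧ R (f p) (f q) (f r)).card : ℝ) ≤
      c * (m : ℝ) ^ 4 := by
  obtain ⟨s, t, -, -, -, -, -, -, -, hcov⟩ := exists_cover_fin_five p q r hpq hpr hqr
  set S := univ.filter fun f : Fin 5 → Fin m => f k = i₀ ∧ R (f p) (f q) (f r) with hS
  have fin2 : ∀ T : Finset (Fin m × Fin m), (T.card : ℝ) ≤ c * (m : ℝ) ^ 2 →
      S.card ≤ T.card * m ^ 2 → (S.card : ℝ) ≤ c * (m : ℝ) ^ 4 := by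
    intro T hT hST
    have : (S.card : ℝ) ≤ T.card * (m : ℝ) ^ 2 := by exact_mod_cast hST
    refine this.trans ((mul_le_mul_of_nonneg_right hT (by positivity)).trans (le_of_eq ?_))
    ring
  set T3 := univ.filter fun z : Fin m × Fin m × Fin m => R z.1 z.2.1 z.2.2 with hT3
  have hT3c : (T3.card : ℝ) ≤ c * (m : ℝ) ^ 3 := by
    have h := card_ext_le (univ : Finset (Fin m))
      (fun i => univ.filter fun z : Fin m × Fin m => R i z.1 z.2) T3 (by
        intro a v hv; simpa [hT3] using hv) fun i _ => h1 i
    rw [card_univ, Fintype.card_fin] at h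
    refine h.trans (le_of_eq ?_)
    ring
  have fin3 : S.card ≤ T3.card * m → (S.card : ℝ) ≤ c * (m : ℝ) ^ 4 := by
    intro hST
    have : (S.card : ℝ) ≤ T3.card * (m : ℝ) := by exact_mod_cast hST
    refine this.trans ((mul_le_mul_of_nonneg_right hT3c (by positivity)).trans (le_of_eq ?_))
    ring
  -- If the prescribed coordinate is one of `p, q, r`, a slice is used directly; otherwise all
  -- slices are summed and one coordinate fewer remains free.
  rcases hcov k with hk | hk | hk | hk | hk
  · refine fin2 _ (h1 i₀) (card_tuples_le_of_pairs S _ k q r s t i₀ (fun f hf => ?_)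
      fun j => by rw [hk]; exact hcov j)
    simp only [hS, mem_filter, mem_univ, true_and] at hf ⊢
    refine ⟨hf.1, ?_⟩
    have := hf.2
    rwa [← hk, hf.1] at this
  · refine fin2 _ (h2 i₀) (card_tuples_le_of_pairs S _ k p r s t i₀ (fun f hf => ?_)
      fun j => by rw [hk]; have := hcov j; tauto)
    simp only [hS, mem_filter, mem_univ, true_and] at hf ⊢
    refine ⟨hf.1, ?_⟩
    have := hf.2
    rwa [← hk, hf.1] at this
  · refine fin2 _ (h3 i₀) (card_tuples_le_of_pairs S _ k p q s t i₀ (fun f hf => ?_)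
      fun j => by rw [hk]; have := hcov j; tauto)
    simp only [hS, mem_filter, mem_univ, true_and] at hf ⊢
    refine ⟨hf.1, ?_⟩
    have := hf.2
    rwa [← hk, hf.1] at this
  · refine fin3 (card_tuples_le_of_triples S _ k p q r t i₀ (fun f hf => ?_)
      fun j => by rw [hk]; have := hcov j; tauto)
    simpa [hS, hT3] using hf
  · refine fin3 (card_tuples_le_of_triples S _ k p q r s i₀ (fun f hf => ?_)
      fun j => by rw [hk]; have := hcov j; tauto)
    simpa [hS, hT3] using hf

/-- Tuples of four indices with two prescribed coordinates equal. -/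
theorem card_not_injective_le (i₀ : Fin m) :
    (univ.filter fun g : Fin 5 → Fin m => g 0 = i₀ ∧ ¬ Function.Injective g).card ≤ 25 * m ^ 3 := by
  have hsub : (univ.filter fun g : Fin 5 → Fin m => g 0 = i₀ ∧ ¬ Function.Injective g) ⊆
      (univ : Finset (Fin 5 × Fin 5)).biUnion fun z =>
        univ.filter fun g : Fin 5 → Fin m => g 0 = i₀ ∧ z.1 ≠ z.2 ∧ g z.1 = g z.2 := by
    intro g hg
    obtain ⟨-, h0, hg⟩ := mem_filter.1 hg
    rw [Function.Injective] at hg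
    push Not at hg
    obtain ⟨a, b, hab, hne⟩ := hg
    simp only [mem_biUnion, mem_filter, mem_univ, true_and]
    exact ⟨(a, b), h0, hne, hab⟩
  refine (card_le_card hsub).trans (card_biUnion_le_card_mul _ _ (m ^ 3) fun z _ => ?_)
  obtain ⟨a, b⟩ := z
  by_cases hab : a = b
  · simp [hab]
  have hcov : ∀ a b : Fin 5, a ≠ b → ∃ c d e : Fin 5,
      ∀ j, j = c ∨ j = d ∨ j = e ∨ (j = 0) ∨ ((j = a ∧ (b = 0 ∨ b = c ∨ b = d ∨ b = e)) ∨
        (j = b ∧ (a = 0 ∨ a = c ∨ a = d ∨ a = e))) := by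
    decide
  obtain ⟨c, d, e, hcde⟩ := hcov a b hab
  have : (univ.filter fun g : Fin 5 → Fin m => g 0 = i₀ ∧ a ≠ b ∧ g a = g b).card ≤
      (univ : Finset (Fin m × Fin m × Fin m)).card := by
    refine card_le_card_of_injOn (fun g => (g c, g d, g e)) (fun _ _ => mem_coe.2 (mem_univ _)) ?_
    intro f hf g hg hfg
    simp only [coe_filter, mem_univ, true_and, Set.mem_ofPred_eq] at hf hg
    simp only [Prod.mk.injEq] at hfg
    obtain ⟨f0, _, fab⟩ := hf
    obtain ⟨g0, _, gab⟩ := hg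
    have hz : ∀ j, (j = 0 ∨ j = c ∨ j = d ∨ j = e) → f j = g j := by
      rintro j (rfl | rfl | rfl | rfl)
      · rw [f0, g0]
      · exact hfg.1
      · exact hfg.2.1
      · exact hfg.2.2
    funext j
    rcases hcde j with h | h | h | h | ⟨h, h'⟩ | ⟨h, h'⟩
    · exact hz j (by tauto)
    · exact hz j (by tauto)
    · exact hz j (by tauto)
    · exact hz j (by tauto)
    · rw [h, fab, gab]; exact hz b h'
    · rw [h, ← fab, ← gab]; exact hz a h'
  refine this.trans (le_of_eq ?_)
  rw [card_univ, Fintype.card_prod, Fintype.card_prod, Fintype.card_fin]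
  ring

/-- A dense `5`-partite `5`-graph whose five parts have the same size has a perfect matching. -/
theorem exists_perms_of_dense (Q : (Fin 5 → Fin m) → Prop) (hm : 100 ≤ m)
    (hQ : ∀ (k : Fin 5) (i : Fin m),
      10 * (univ.filter fun f : Fin 5 → Fin m => f k = i ∧ ¬ Q f).card ≤ m ^ 4) :
    ∃ π : Fin 5 → Equiv.Perm (Fin m), ∀ i, Q fun j => π j i := by
  -- Permutations with the most good rows are taken. A bad row would be repaired by shifting entries
  -- cyclically among five rows, a contradiction.
  obtain ⟨π, -, hπ⟩ := exists_max_image (univ : Finset (Fin 5 → Equiv.Perm (Fin m)))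
    (fun π => (univ.filter fun i => Q fun j => π j i).card) ⟨1, mem_univ _⟩
  refine ⟨π, ?_⟩
  by_contra! hbad
  obtain ⟨i₀, hi₀⟩ := hbad
  -- choose indices `g 0 = i₀, g 1, …, g 4` such that all shifted rows are good
  have hex : ∃ g : Fin 5 → Fin m, g 0 = i₀ ∧ Function.Injective g ∧
      ∀ k, Q fun j => π j (g (k + j)) := by
    by_contra! hcon
    have hsub : (univ.filter fun g : Fin 5 → Fin m => g 0 = i₀) ⊆
        (univ.filter fun g : Fin 5 → Fin m => g 0 = i₀ ∧ ¬ Function.Injective g) ∪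
        (univ : Finset (Fin 5)).biUnion fun k => univ.filter fun g : Fin 5 → Fin m =>
          g 0 = i₀ ∧ ¬ Q fun j => π j (g (k + j)) := by
      intro g hg
      simp only [mem_filter, mem_univ, true_and, mem_union, mem_biUnion] at hg ⊢
      by_cases hinj : Function.Injective g
      · obtain ⟨k, hk⟩ := hcon g hg hinj
        exact Or.inr ⟨k, hg, hk⟩
      · exact Or.inl ⟨hg, hinj⟩
    have hrow : ∀ k : Fin 5, (univ.filter fun g : Fin 5 → Fin m =>
        g 0 = i₀ ∧ ¬ Q fun j => π j (g (k + j))).card ≤ m ^ 4 / 10 := by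
      intro k
      have h1 : (univ.filter fun g : Fin 5 → Fin m =>
          g 0 = i₀ ∧ ¬ Q fun j => π j (g (k + j))).card ≤
          -- Row `k` takes its coordinate `-k` from the old row `g 0 = i₀`, so every shifted row
          -- passes through a fixed vertex and the degree hypothesis applies.
          (univ.filter fun f : Fin 5 → Fin m => f (-k) = π (-k) i₀ ∧ ¬ Q f).card := by
        refine card_le_card_of_injOn (fun g j => π j (g (k + j))) ?_ ?_
        · intro g hg
          simp only [coe_filter, mem_univ, true_and, Set.mem_ofPred_eq] at hg ⊢
          refine ⟨?_, hg.2⟩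
          rw [add_neg_cancel, hg.1]
        · intro g _ g' _ h
          funext j
          have := congrFun h (j - k)
          simp only [EmbeddingLike.apply_eq_iff_eq, add_sub_cancel] at this
          exact this
      have := hQ (-k) (π (-k) i₀)
      omega
    have hall : m ^ 4 ≤ (univ.filter fun g : Fin 5 → Fin m => g 0 = i₀).card := by
      have : (univ : Finset (Fin 4 → Fin m)).card ≤
          (univ.filter fun g : Fin 5 → Fin m => g 0 = i₀).card := by
        refine card_le_card_of_injOn (fun h => Fin.cons i₀ h) ?_ ?_
        · intro h _
          simp
        · intro h _ h' _ e
          exact (Fin.cons_injective2 e).2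
      rwa [card_univ, Fintype.card_fun, Fintype.card_fin, Fintype.card_fin] at this
    have h1 := (card_le_card hsub).trans (card_union_le _ _)
    have h2 := card_biUnion_le_card_mul (univ : Finset (Fin 5)) (fun k =>
      univ.filter fun g : Fin 5 → Fin m => g 0 = i₀ ∧ ¬ Q fun j => π j (g (k + j))) _
      fun k _ => hrow k
    rw [card_univ, Fintype.card_fin] at h2
    have h3 := card_not_injective_le i₀
    -- Non-injective choices number at most `m ^ 4 / 4` and the five shifted rows exclude at most `m
    -- ^ 4 / 2`, short of all `m ^ 4` choices.
    have h4 : 100 * m ^ 3 ≤ m ^ 4 := by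
      rw [pow_succ m 3, mul_comm]; exact Nat.mul_le_mul_left _ hm
    have h5 : 0 < m ^ 4 := by positivity
    omega
  obtain ⟨g, hg0, hginj, hgQ⟩ := hex
  -- the shift by `j` on the chosen indices
  have hshift : ∀ j : Fin 5, ∃ σ : Equiv.Perm (Fin m), (∀ k, σ (g k) = g (k + j)) ∧
      ∀ i, i ∉ Set.range g → σ i = i := by
    intro j
    refine ⟨Equiv.Perm.extendDomain (Equiv.addRight j) (Equiv.ofInjective g hginj), ?_, ?_⟩
    · intro k
      have := Equiv.Perm.extendDomain_apply_image (Equiv.addRight j)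
        (Equiv.ofInjective g hginj) k
      simpa using this
    · intro i hi
      exact Equiv.Perm.extendDomain_apply_not_subtype _ _ hi
  choose σ hσ1 hσ2 using hshift
  have hmax := hπ (fun j => (σ j).trans (π j)) (mem_univ _)
  have hlt : (univ.filter fun i => Q fun j => π j i).card <
      (univ.filter fun i => Q fun j => ((σ j).trans (π j)) i).card := by
    refine card_lt_card ((ssubset_iff_of_subset ?_).2 ⟨i₀, ?_, ?_⟩)
    · intro i hi
      have hi' := (mem_filter.1 hi).2
      refine mem_filter.2 ⟨mem_univ _, ?_⟩
      by_cases h : i ∈ Set.range g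
      · obtain ⟨k, rfl⟩ := h
        simp only [Equiv.trans_apply, hσ1]
        exact hgQ k
      · simp only [Equiv.trans_apply, fun j => hσ2 j i h]
        exact hi'
    · refine mem_filter.2 ⟨mem_univ _, ?_⟩
      rw [← hg0]
      simp only [Equiv.trans_apply, hσ1]
      exact hgQ 0
    · simpa using hi₀
  omega

end

/-! ### Tiling dense parts, and greedy selection of tiles. -/

namespace TriGraph

variable {V : Type u}

/-- The pairs in `S × T` forming an edge with `v`. -/
noncomputable def hit (G : TriGraph V) (S T : Finset V) (v : V) : Finset (V × V) :=
  (S ×ˢ T).filter fun p => G.adj v p.1 p.2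

/-- The pairs in `S × T` forming no edge with `v`. -/
noncomputable def miss (G : TriGraph V) (S T : Finset V) (v : V) : Finset (V × V) :=
  (S ×ˢ T).filter fun p => ¬ G.adj v p.1 p.2

variable {G : TriGraph V}

@[simp] theorem mem_hit {S T : Finset V} {v : V} {p : V × V} :
    p ∈ G.hit S T v ↔ (p.1 ∈ S ∧ p.2 ∈ T) ∧ G.adj v p.1 p.2 := by
  rw [hit, mem_filter, mem_product]

@[simp] theorem mem_miss {S T : Finset V} {v : V} {p : V × V} :
    p ∈ G.miss S T v ↔ (p.1 ∈ S ∧ p.2 ∈ T) ∧ ¬ G.adj v p.1 p.2 := by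
  rw [miss, mem_filter, mem_product]

theorem card_hit_add_card_miss (S T : Finset V) (v : V) :
    ((G.hit S T v).card : ℝ) + (G.miss S T v).card = S.card * T.card := by
  have := card_filter_add_card_filter_not (s := S ×ˢ T) fun p => G.adj v p.1 p.2
  rw [card_product] at this
  rw [hit, miss]
  exact_mod_cast this

theorem miss_subset {S T S' T' : Finset V} (hS : S ⊆ S') (hT : T ⊆ T') (v : V) :
    G.miss S T v ⊆ G.miss S' T' v := by
  intro p hp
  rw [mem_miss] at hp ⊢
  exact ⟨⟨hS hp.1.1, hT hp.1.2⟩, hp.2⟩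

theorem exists_adj_of_card_miss_lt {S T : Finset V} {v : V}
    (h : (G.miss S T v).card < S.card * T.card) : ∃ s ∈ S, ∃ t ∈ T, G.adj v s t := by
  by_contra! hcon
  refine h.not_ge ?_
  rw [← card_product]
  refine card_le_card fun p hp => ?_
  rw [mem_product] at hp
  exact mem_miss.2 ⟨hp, hcon _ hp.1 _ hp.2⟩

theorem exists_adj_adj_of_card_miss_lt {S T : Finset V} {v w : V}
    (h : (G.miss S T v).card + (G.miss S T w).card < S.card * T.card) :
    ∃ s ∈ S, ∃ t ∈ T, G.adj v s t ∧ G.adj w s t := by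
  by_contra! hcon
  refine h.not_ge ?_
  rw [← card_product]
  refine (card_le_card (t := G.miss S T v ∪ G.miss S T w) fun p hp => ?_).trans (card_union_le _ _)
  rw [mem_product] at hp
  rw [mem_union, mem_miss, mem_miss]
  have := hcon _ hp.1 _ hp.2
  tauto

theorem IsT.card_inter {a b c d e : V} (h : G.IsT a b c d e) (A : Finset V) :
    ((({a, b, c, d, e} : Finset V) ∩ A).card : ℝ) =
      (if a ∈ A then 1 else 0) + (if b ∈ A then 1 else 0) + (if c ∈ A then 1 else 0) +
        (if d ∈ A then 1 else 0) + (if e ∈ A then 1 else 0) := by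
  have := h.sum fun v => if v ∈ A then (1 : ℝ) else 0
  rw [← this, sum_ite_mem, sum_const, nsmul_eq_mul, mul_one]

/-- Five vertex classes of the same size that are almost complete with respect to the edges of the
generalised triangle can be tiled. -/
theorem til_of_dense_parts {m : ℕ} (hm : 100 ≤ m) (X : Fin 5 → Finset V)
    (hX : ∀ j, (X j).card = m) (hd : ∀ i j, i ≠ j → Disjoint (X i) (X j))
    (h : ∀ p q r : Fin 5, ((p = 0 ∧ q = 1 ∧ r = 2) ∨ (p = 0 ∧ q = 1 ∧ r = 3) ∨
        (p = 4 ∧ q = 2 ∧ r = 3)) →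
      (∀ v ∈ X p, ((G.miss (X q) (X r) v).card : ℝ) ≤ 1 / 30 * (m : ℝ) ^ 2) ∧
      (∀ v ∈ X q, ((G.miss (X p) (X r) v).card : ℝ) ≤ 1 / 30 * (m : ℝ) ^ 2) ∧
      (∀ v ∈ X r, ((G.miss (X p) (X q) v).card : ℝ) ≤ 1 / 30 * (m : ℝ) ^ 2)) :
    G.Til (univ.biUnion X) := by
  set x : ∀ j : Fin 5, Fin m → V := fun j i => ((X j).equivFinOfCardEq (hX j)).symm i with hx
  have hxX : ∀ j i, x j i ∈ X j := fun j i => (((X j).equivFinOfCardEq (hX j)).symm i).2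
  have hxinj : ∀ j, Function.Injective (x j) := fun j =>
    Subtype.val_injective.comp (Equiv.injective _)
  have hxne : ∀ i j, i ≠ j → ∀ a b, x i a ≠ x j b := fun i j hij a b hab =>
    disjoint_left.1 (hd i j hij) (hxX i a) (hab ▸ hxX j b)
  have slice : ∀ p q r : Fin 5, ((p = 0 ∧ q = 1 ∧ r = 2) ∨ (p = 0 ∧ q = 1 ∧ r = 3) ∨
        (p = 4 ∧ q = 2 ∧ r = 3)) → ∀ (k : Fin 5) (i : Fin m),
      ((univ.filter fun f : Fin 5 → Fin m => f k = i ∧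
        ¬ G.adj (x p (f p)) (x q (f q)) (x r (f r))).card : ℝ) ≤ 1 / 30 * (m : ℝ) ^ 4 := by
    intro p q r hpqr k i
    obtain ⟨h1, h2, h3⟩ := h p q r hpqr
    have key : ∀ (q r : Fin 5) (v : V) (P : Fin m × Fin m → Prop),
        (∀ z, P z → ¬ G.adj v (x q z.1) (x r z.2)) →
        (univ.filter P).card ≤ (G.miss (X q) (X r) v).card := by
      intro q r v P hP
      refine card_le_card_of_injOn (fun z => (x q z.1, x r z.2)) ?_ ?_
      · intro z hz
        rw [mem_coe, mem_miss]
        exact ⟨⟨hxX _ _, hxX _ _⟩, hP z (by simpa using hz)⟩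
      · intro z _ w _ hzw
        simp only [Prod.mk.injEq] at hzw
        exact Prod.ext (hxinj q hzw.1) (hxinj r hzw.2)
    have hne : p ≠ q ∧ p ≠ r ∧ q ≠ r := by
      rcases hpqr with ⟨rfl, rfl, rfl⟩ | ⟨rfl, rfl, rfl⟩ | ⟨rfl, rfl, rfl⟩ <;> decide
    have := card_tuples_le_of_slices (c := 1 / 30)
      (fun a b c => ¬ G.adj (x p a) (x q b) (x r c))
      (fun i => le_trans (Nat.cast_le.2 (key q r (x p i) _ fun z hz => hz)) (h1 _ (hxX p i)))
      (fun i => le_trans (Nat.cast_le.2 (key p r (x q i) _ fun z hz h => hz (G.swap12 h)))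
        (h2 _ (hxX q i)))
      (fun i => le_trans (Nat.cast_le.2 (key p q (x r i) _ fun z hz h => hz (rot h)))
        (h3 _ (hxX r i))) hne.1 hne.2.1 hne.2.2 k i
    convert this
  -- Each of the three edges fails for at most a `1/30` share of the tuples through a vertex, which
  -- adds up to the permitted `1/10`.
  obtain ⟨π, hπ⟩ := exists_perms_of_dense (m := m)
    (fun f => G.IsT (x 0 (f 0)) (x 1 (f 1)) (x 2 (f 2)) (x 3 (f 3)) (x 4 (f 4))) hm (by
      intro k i
      have s1 := slice 0 1 2 (by simp) k i
      have s2 := slice 0 1 3 (by simp) k i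
      have s3 := slice 4 2 3 (by simp) k i
      have hsub : (univ.filter fun f : Fin 5 → Fin m => f k = i ∧
          ¬ G.IsT (x 0 (f 0)) (x 1 (f 1)) (x 2 (f 2)) (x 3 (f 3)) (x 4 (f 4))) ⊆
          (univ.filter fun f : Fin 5 → Fin m => f k = i ∧
            ¬ G.adj (x 0 (f 0)) (x 1 (f 1)) (x 2 (f 2))) ∪
          ((univ.filter fun f : Fin 5 → Fin m => f k = i ∧
            ¬ G.adj (x 0 (f 0)) (x 1 (f 1)) (x 3 (f 3))) ∪
          (univ.filter fun f : Fin 5 → Fin m => f k = i ∧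
            ¬ G.adj (x 4 (f 4)) (x 2 (f 2)) (x 3 (f 3)))) := by
        intro f hf
        simp only [mem_union, mem_filter, mem_univ, true_and] at hf ⊢
        obtain ⟨hfk, hf⟩ := hf
        by_contra! hcon
        exact hf ⟨hcon.1 hfk, hcon.2.1 hfk, rot (hcon.2.2 hfk), hxne _ _ (by decide) _ _,
          hxne _ _ (by decide) _ _⟩
      have h1 := (card_le_card hsub).trans ((card_union_le _ _).trans
        (Nat.add_le_add_left (card_union_le _ _) _))
      rify
      rify at h1
      linarith)
  set tile : Fin m → Finset V := fun i => {x 0 (π 0 i), x 1 (π 1 i), x 2 (π 2 i), x 3 (π 3 i),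
    x 4 (π 4 i)} with htile
  have hmem : ∀ i v, v ∈ tile i ↔ ∃ j, v = x j (π j i) := by
    intro i v
    simp only [htile, mem_insert, mem_singleton]
    constructor
    · rintro (h | h | h | h | h)
      exacts [⟨0, h⟩, ⟨1, h⟩, ⟨2, h⟩, ⟨3, h⟩, ⟨4, h⟩]
    · rintro ⟨j, h⟩
      fin_cases j
      exacts [Or.inl h, Or.inr (Or.inl h), Or.inr (Or.inr (Or.inl h)),
        Or.inr (Or.inr (Or.inr (Or.inl h))), Or.inr (Or.inr (Or.inr (Or.inr h)))]
  have hdis : ∀ i i', i ≠ i' → Disjoint (tile i) (tile i') := by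
    intro i i' hne
    refine disjoint_left.2 fun v hv hv' => ?_
    obtain ⟨j, rfl⟩ := (hmem _ _).1 hv
    obtain ⟨j', hj'⟩ := (hmem _ _).1 hv'
    by_cases hjj : j = j'
    · subst hjj
      exact hne ((π j).injective (hxinj j hj'))
    · exact hxne _ _ hjj _ _ hj'
  have hT := til_biUnion (G := G) (univ.image tile) (by
      intro A hA
      obtain ⟨i, -, rfl⟩ := mem_image.1 hA
      exact TSet.til ⟨_, _, _, _, _, hπ i, rfl⟩) (by
      intro A hA B hB hne
      obtain ⟨i, -, rfl⟩ := mem_image.1 hA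
      obtain ⟨i', -, rfl⟩ := mem_image.1 hB
      exact hdis i i' fun h => hne (by rw [h]))
  have e : (univ.image tile).biUnion id = univ.biUnion X := by
    ext v
    simp only [mem_biUnion, mem_image, mem_univ, true_and, id]
    constructor
    · rintro ⟨_, ⟨i, rfl⟩, hv⟩
      obtain ⟨j, rfl⟩ := (hmem _ _).1 hv
      exact ⟨j, hxX _ _⟩
    · rintro ⟨j, hv⟩
      refine ⟨_, ⟨(π j).symm ((X j).equivFinOfCardEq (hX j) ⟨v, hv⟩), rfl⟩, (hmem _ _).2 ⟨j, ?_⟩⟩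
      simp [hx]
  rwa [e] at hT

/-- Greedy construction of `k` disjoint generalised triangles, each with `s` vertices in `A`. -/
theorem exists_til_greedy (A : Finset V) (s k : ℕ)
    (h : ∀ j < k, ∀ F : Finset V, F.card = 5 * j → (F ∩ A).card = s * j →
      ∃ X, G.TSet X ∧ Disjoint X F ∧ (X ∩ A).card = s) :
    ∃ R, G.Til R ∧ R.card = 5 * k ∧ (R ∩ A).card = s * k := by
  induction k with
  | zero => exact ⟨∅, Til.empty, by simp, by simp⟩
  | succ k ih =>
    obtain ⟨R, hT, hc, hA⟩ := ih fun j hj => h j (by omega)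
    obtain ⟨X, hX, hXR, hXA⟩ := h k (by omega) R hc hA
    refine ⟨X ∪ R, Til.add hX hT hXR, ?_, ?_⟩
    · rw [card_union_of_disjoint hXR, hX.card, hc]; ring
    · rw [union_inter_distrib_right, card_union_of_disjoint (disjoint_of_subset_left
        inter_subset_left (disjoint_of_subset_right inter_subset_left hXR)), hXA, hA]
      ring

/-- Greedy covering of the set `E` by disjoint generalised triangles outside `F`, each with two
vertices in `A`. -/
theorem exists_til_cover (A F E : Finset V)
    (h : ∀ v ∈ E, ∀ R : Finset V, v ∉ F ∪ R → R.card ≤ 5 * E.card →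
      ∃ X, G.TSet X ∧ v ∈ X ∧ Disjoint X (F ∪ R) ∧ (X ∩ A).card = 2) :
    ∃ R, G.Til R ∧ Disjoint R F ∧ E ⊆ F ∪ R ∧ R.card ≤ 5 * E.card ∧
      5 * (R ∩ A).card = 2 * R.card := by
  have key : ∀ E' ⊆ E, ∃ R, G.Til R ∧ Disjoint R F ∧ E' ⊆ F ∪ R ∧ R.card ≤ 5 * E'.card ∧
      5 * (R ∩ A).card = 2 * R.card := by
    intro E'
    induction E' using Finset.induction_on with
    | empty => exact fun _ => ⟨∅, Til.empty, by simp, by simp, by simp, by simp⟩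
    | insert v E' hv ih =>
      intro hE
      obtain ⟨R, hT, hRF, hER, hRc, hRA⟩ := ih ((subset_insert _ _).trans hE)
      rw [card_insert_of_notMem hv]
      by_cases hvR : v ∈ F ∪ R
      · exact ⟨R, hT, hRF, insert_subset hvR hER, by omega, hRA⟩
      · have hle := card_le_card ((subset_insert v E').trans hE)
        obtain ⟨X, hX, hvX, hXd, hXA⟩ := h v (hE (mem_insert_self _ _)) R hvR (by omega)
        rw [disjoint_union_right] at hXd
        refine ⟨X ∪ R, Til.add hX hT hXd.2, disjoint_union_left.2 ⟨hXd.1, hRF⟩, ?_, ?_, ?_⟩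
        · refine insert_subset (mem_union_right _ (mem_union_left _ hvX)) (hER.trans ?_)
          exact union_subset_union_right subset_union_right
        · rw [card_union_of_disjoint hXd.2, hX.card]; omega
        · rw [union_inter_distrib_right, card_union_of_disjoint (disjoint_of_subset_left
            inter_subset_left (disjoint_of_subset_right inter_subset_left hXd.2)), hXA,
            card_union_of_disjoint hXd.2, hX.card]
          omega
  exact key E subset_rfl

end TriGraph

/-! ### Tiles in a near-extremal partition. -/

namespace TriGraph

variable {V : Type u} [Fintype V]

/-- A partition of the vertex set that is close to the extremal one: almost all triples with one
vertex in `A` and two in `B` are edges, and the vertices of `A` outside `E` are typical. -/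
structure Split (G : TriGraph V) (A B E : Finset V) : Prop where
  disj : Disjoint A B
  cover : A ∪ B = univ
  card_le : (A.card : ℝ) ≤ (2 / 5 + 1 / 10 ^ 12) * Fintype.card V
  card_ge : (2 / 5 - 1 / 10 ^ 12) * (Fintype.card V : ℝ) ≤ A.card
  hit_ge : ∀ v ∈ A, 1 / 10 ^ 5 * (Fintype.card V : ℝ) ^ 2 ≤ (G.hit B B v).card
  hit_le : ∀ v ∈ B, ((G.hit B B v).card : ℝ) ≤ 3 / 10 ^ 5 * (Fintype.card V : ℝ) ^ 2
  miss_le : ∀ v ∈ B, ((G.miss A B v).card : ℝ) ≤ 4 / 10 ^ 5 * (Fintype.card V : ℝ) ^ 2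
  card_E : (E.card : ℝ) ≤ 1 / 10 ^ 12 * Fintype.card V
  typical : ∀ v ∈ A, v ∉ E → ((G.miss B B v).card : ℝ) ≤ 1 / 10 ^ 12 * (Fintype.card V : ℝ) ^ 2

variable {G : TriGraph V} {A B E : Finset V}

namespace Split

theorem card_add (S : G.Split A B E) : (A.card : ℝ) + B.card = Fintype.card V := by
  rw [← card_univ, ← S.cover, card_union_of_disjoint S.disj]
  push_cast; rfl

theorem notMem_A (S : G.Split A B E) {v : V} (h : v ∈ B) : v ∉ A :=
  fun h' => disjoint_left.1 S.disj h' h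

theorem exists_typical (S : G.Split A B E) (hn : (10 : ℝ) ^ 20 ≤ Fintype.card V) {F : Finset V}
    (hF : (F.card : ℝ) ≤ 1 / 10 ^ 9 * Fintype.card V) : ∃ a ∈ A, a ∉ E ∧ a ∉ F := by
  by_contra! hcon
  have h1 : A ⊆ E ∪ F := fun a ha => by
    by_cases h : a ∈ E
    · exact mem_union_left _ h
    · exact mem_union_right _ (hcon a ha h)
  have h2 : (A.card : ℝ) ≤ E.card + F.card := by
    exact_mod_cast (card_le_card h1).trans (card_union_le _ _)
  have := S.card_ge
  have := S.card_E
  linarith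

/-- A generalised triangle with three vertices in `A` and two in `B`. -/
theorem exists_tile_three (S : G.Split A B E)
    (hδ : ∀ x y : V, x ≠ y → 2 / 5 * (Fintype.card V : ℝ) ≤ (G.nb x y).card)
    (hn : (10 : ℝ) ^ 20 ≤ Fintype.card V) {F : Finset V}
    (hF : (F.card : ℝ) ≤ 1 / 10 ^ 10 * Fintype.card V) :
    ∃ X, G.TSet X ∧ Disjoint X F ∧ (X ∩ A).card = 3 := by
  set n : ℝ := (Fintype.card V : ℝ) with hndef
  have hn0 : 0 < n := by linarith [show (0 : ℝ) < 10 ^ 20 by norm_num]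
  have hins : ∀ F' : Finset V, (F'.card : ℝ) ≤ F.card + 3 → (F'.card : ℝ) ≤ 1 / 10 ^ 9 * n := by
    intro F' h; linarith
  obtain ⟨a₁, ha₁, hE₁, hF₁⟩ := S.exists_typical hn (F := F) (hins F (by linarith))
  obtain ⟨a₂, ha₂, hE₂, hF₂⟩ := S.exists_typical hn (F := insert a₁ F) (hins _ (by
    have := card_insert_le a₁ F
    have : ((insert a₁ F).card : ℝ) ≤ F.card + 1 := by exact_mod_cast this
    linarith))
  rw [mem_insert, not_or] at hF₂
  have hm₁ := S.typical a₁ ha₁ hE₁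
  have hm₂ := S.typical a₂ ha₂ hE₂
  have hBc : 59 / 100 * n ≤ B.card := by
    have := S.card_add; have := S.card_le; rw [← hndef] at *; linarith
  have hBF : 1 / 2 * n ≤ (B \ F).card := by
    have := card_sdiff_real_ge (A := B) hF; linarith
  -- An unused neighbour `e ∈ A` makes `a₁a₂e` an edge, to which two vertices of `B` are attached.
  -- Otherwise the unused neighbours of `a₁a₂` lie in `B`, and a third typical vertex closes a pair
  -- of them.
  by_cases hcase : ∃ e ∈ G.nb a₁ a₂ ∩ A, e ∉ F
  · obtain ⟨e, he, heF⟩ := hcase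
    rw [mem_inter, mem_nb] at he
    obtain ⟨b₁, hb₁, b₂, hb₂, h1, h2⟩ := exists_adj_adj_of_card_miss_lt (G := G) (S := B \ F)
      (T := B \ F) (v := a₁) (w := a₂) (by
        have e1 := card_le_card (miss_subset (G := G) (S := B \ F) (T := B \ F) sdiff_subset
          sdiff_subset a₁)
        have e2 := card_le_card (miss_subset (G := G) (S := B \ F) (T := B \ F) sdiff_subset
          sdiff_subset a₂)
        have e3 : (((G.miss (B \ F) (B \ F) a₁).card + (G.miss (B \ F) (B \ F) a₂).card : ℕ) : ℝ)
            ≤ 2 / 10 ^ 12 * n ^ 2 := by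
          rify at e1 e2; push_cast; linarith
        have e4 : (1 / 2 * n) * (1 / 2 * n) ≤ (((B \ F).card * (B \ F).card : ℕ) : ℝ) := by
          push_cast; gcongr
        have : 0 < n ^ 2 := by positivity
        have e5 : (((G.miss (B \ F) (B \ F) a₁).card + (G.miss (B \ F) (B \ F) a₂).card : ℕ) : ℝ)
            < (((B \ F).card * (B \ F).card : ℕ) : ℝ) := by nlinarith
        exact_mod_cast e5)
    rw [mem_sdiff] at hb₁ hb₂
    have hT : G.IsT b₁ b₂ a₁ a₂ e := ⟨rot h1, rot h2, he.1,
      fun h => S.notMem_A hb₁.1 (h ▸ he.2), fun h => S.notMem_A hb₂.1 (h ▸ he.2)⟩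
    refine ⟨_, ⟨_, _, _, _, _, hT, rfl⟩, ?_, ?_⟩
    · refine disjoint_left.2 fun v hv => ?_
      simp only [mem_insert, mem_singleton] at hv
      rcases hv with rfl | rfl | rfl | rfl | rfl
      exacts [hb₁.2, hb₂.2, hF₁, hF₂.2, heF]
    · have := hT.card_inter A
      rw [if_neg (S.notMem_A hb₁.1), if_neg (S.notMem_A hb₂.1), if_pos ha₁, if_pos ha₂,
        if_pos he.2] at this
      norm_num at this
      exact_mod_cast this
  · push Not at hcase
    obtain ⟨e, he, hEe, hFe⟩ := S.exists_typical hn (F := insert a₁ (insert a₂ F)) (hins _ (by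
      have h1 := card_insert_le a₁ (insert a₂ F)
      have h2 := card_insert_le a₂ F
      have : ((insert a₁ (insert a₂ F)).card : ℝ) ≤ F.card + 2 := by
        exact_mod_cast (by omega : (insert a₁ (insert a₂ F)).card ≤ F.card + 2)
      linarith))
    rw [mem_insert, mem_insert, not_or, not_or] at hFe
    set D := G.nb a₁ a₂ \ F with hD
    have hDB : D ⊆ B := by
      intro v hv
      rw [hD, mem_sdiff] at hv
      have : v ∈ A ∪ B := by rw [S.cover]; exact mem_univ v
      rcases mem_union.1 this with h | h
      · exact absurd (hcase v (mem_inter.2 ⟨hv.1, h⟩)) hv.2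
      · exact h
    have hDc : 1 / 5 * n ≤ D.card := by
      have := card_sdiff_real_ge (A := G.nb a₁ a₂) hF
      have := hδ a₁ a₂ (fun h => hF₂.1 h.symm)
      linarith
    obtain ⟨c, hc, d, hd, hcd⟩ := exists_adj_of_card_miss_lt (G := G) (S := D) (T := D) (v := e) (by
      have e1 := card_le_card (miss_subset (G := G) hDB hDB e)
      have e2 := S.typical e he hEe
      have e3 : ((G.miss D D e).card : ℝ) ≤ 1 / 10 ^ 12 * n ^ 2 := by
        rify at e1; linarith
      have e4 : (1 / 5 * n) * (1 / 5 * n) ≤ ((D.card * D.card : ℕ) : ℝ) := by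
        push_cast; gcongr
      have : 0 < n ^ 2 := by positivity
      have e5 : ((G.miss D D e).card : ℝ) < ((D.card * D.card : ℕ) : ℝ) := by nlinarith
      exact_mod_cast e5)
    have hc' := mem_sdiff.1 hc
    have hd' := mem_sdiff.1 hd
    rw [mem_nb] at hc' hd'
    have hT : G.IsT a₁ a₂ c d e := ⟨hc'.1, hd'.1, rot hcd, hFe.1, hFe.2.1⟩
    refine ⟨_, ⟨_, _, _, _, _, hT, rfl⟩, ?_, ?_⟩
    · refine disjoint_left.2 fun v hv => ?_
      simp only [mem_insert, mem_singleton] at hv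
      rcases hv with rfl | rfl | rfl | rfl | rfl
      exacts [hF₁, hF₂.2, hc'.2, hd'.2, hFe.2.2]
    · have := hT.card_inter A
      rw [if_neg (S.notMem_A (hDB hc)), if_neg (S.notMem_A (hDB hd)), if_pos ha₁, if_pos ha₂,
        if_pos he] at this
      norm_num at this
      exact_mod_cast this

/-- A generalised triangle with two vertices in `A`, one of them prescribed, and three in `B`. -/
theorem exists_tile_two (S : G.Split A B E) (hn : (10 : ℝ) ^ 20 ≤ Fintype.card V) {F : Finset V}
    (hF : (F.card : ℝ) ≤ 1 / 10 ^ 10 * Fintype.card V) {v : V} (hv : v ∈ A) (hvF : v ∉ F) :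
    ∃ X, G.TSet X ∧ v ∈ X ∧ Disjoint X F ∧ (X ∩ A).card = 2 := by
  set n : ℝ := (Fintype.card V : ℝ) with hndef
  have hn0 : 0 < n := by linarith [show (0 : ℝ) < 10 ^ 20 by norm_num]
  obtain ⟨a, ha, hEa, hFa⟩ := S.exists_typical hn (F := insert v F) (by
    have := card_insert_le v F
    have : ((insert v F).card : ℝ) ≤ F.card + 1 := by exact_mod_cast this
    rw [← hndef]
    linarith)
  rw [mem_insert, not_or] at hFa
  -- The vertex `v` may be atypical; its `n ^ 2 / 10 ^ 5` pairs still give some `b` a linear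
  -- neighbourhood, inside which a typical `a` finds a pair.
  have hex : ∃ b ∈ B \ F, 1 / 10 ^ 5 / 2 * n ≤ ((G.nb v b ∩ B) \ F).card := by
    by_contra! hcon
    have h1 := S.hit_ge v hv
    rw [← hndef] at h1
    have h2 := card_ext_eq B (fun b => G.nb v b ∩ B) (G.hit B B v) (by
      intro b c; simp only [mem_hit, mem_inter, mem_nb]; tauto)
    have h3 : ((G.hit B B v).card : ℝ) ≤ ∑ b ∈ B, ((if b ∈ F then n else 0) +
        (1 / 10 ^ 5 / 2 + 1 / 10 ^ 10) * n) := by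
      rw [h2]; push_cast
      refine sum_le_sum fun b hb => ?_
      split_ifs with hbF
      · have : ((G.nb v b ∩ B).card : ℝ) ≤ n := by rw [hndef]; exact_mod_cast card_le_univ _
        have : 0 ≤ (1 / 10 ^ 5 / 2 + 1 / 10 ^ 10) * n := by positivity
        linarith
      · have := hcon b (mem_sdiff.2 ⟨hb, hbF⟩)
        have := card_sdiff_real_ge (A := G.nb v b ∩ B) hF
        linarith
    rw [sum_add_distrib, sum_ite_mem, sum_const, sum_const, nsmul_eq_mul, nsmul_eq_mul] at h3
    have h4 : ((B ∩ F).card : ℝ) ≤ 1 / 10 ^ 10 * n := by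
      refine le_trans ?_ hF
      exact_mod_cast card_le_card inter_subset_right
    have h5 : (B.card : ℝ) ≤ n := by rw [hndef]; exact_mod_cast card_le_univ _
    have h6 : ((B ∩ F).card : ℝ) * n ≤ 1 / 10 ^ 10 * n * n := by gcongr
    have h7 : (B.card : ℝ) * ((1 / 10 ^ 5 / 2 + 1 / 10 ^ 10) * n) ≤
        n * ((1 / 10 ^ 5 / 2 + 1 / 10 ^ 10) * n) := by gcongr
    have : 0 < n ^ 2 := by positivity
    nlinarith
  obtain ⟨b, hb, hbc⟩ := hex
  set D := (G.nb v b ∩ B) \ F with hD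
  have hDB : D ⊆ B := sdiff_subset.trans inter_subset_right
  obtain ⟨c, hc, d, hd, hcd⟩ := exists_adj_of_card_miss_lt (G := G) (S := D) (T := D) (v := a) (by
    have e1 := card_le_card (miss_subset (G := G) hDB hDB a)
    have e2 := S.typical a ha hEa
    have e3 : ((G.miss D D a).card : ℝ) ≤ 1 / 10 ^ 12 * n ^ 2 := by
      rify at e1; linarith
    have e4 : (1 / 10 ^ 5 / 2 * n) * (1 / 10 ^ 5 / 2 * n) ≤ ((D.card * D.card : ℕ) : ℝ) := by
      push_cast; gcongr
    have : 0 < n ^ 2 := by positivity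
    have e5 : ((G.miss D D a).card : ℝ) < ((D.card * D.card : ℕ) : ℝ) := by nlinarith
    exact_mod_cast e5)
  have hc' := mem_sdiff.1 hc
  have hd' := mem_sdiff.1 hd
  rw [mem_inter, mem_nb] at hc' hd'
  rw [mem_sdiff] at hb
  have hT : G.IsT v b c d a := ⟨hc'.1.1, hd'.1.1, rot hcd, hFa.1,
    fun h => S.notMem_A hb.1 (h ▸ ha)⟩
  refine ⟨_, ⟨_, _, _, _, _, hT, rfl⟩, mem_insert_self _ _, ?_, ?_⟩
  · refine disjoint_left.2 fun w hw => ?_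
    simp only [mem_insert, mem_singleton] at hw
    rcases hw with rfl | rfl | rfl | rfl | rfl
    exacts [hvF, hb.2, hc'.2, hd'.2, hFa.2]
  · have := hT.card_inter A
    rw [if_neg (S.notMem_A (hDB hc)), if_neg (S.notMem_A (hDB hd)), if_neg (S.notMem_A hb.1),
      if_pos hv, if_pos ha] at this
    norm_num at this
    exact_mod_cast this

/-- A generalised triangle with one vertex in `A` and four in `B`. -/
theorem exists_tile_one (S : G.Split A B E)
    (hδ : ∀ x y : V, x ≠ y → 2 / 5 * (Fintype.card V : ℝ) ≤ (G.nb x y).card)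
    (hn : (10 : ℝ) ^ 20 ≤ Fintype.card V) {k : ℕ} (hk : 0 < k)
    (hA : (A.card : ℝ) + k ≤ 2 / 5 * Fintype.card V) {F : Finset V}
    (hF : (F.card : ℝ) ≤ 1 / 10 ^ 10 * Fintype.card V) (hFB : (F ∩ B).card ≤ 4 * k) :
    ∃ X, G.TSet X ∧ Disjoint X F ∧ (X ∩ A).card = 1 := by
  set n : ℝ := (Fintype.card V : ℝ) with hndef
  have hn0 : 0 < n := by linarith [show (0 : ℝ) < 10 ^ 20 by norm_num]
  have hBc : 59 / 100 * n ≤ B.card := by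
    have := S.card_add; have := S.card_le; rw [← hndef] at *; linarith
  have hAc : 39 / 100 * n ≤ A.card := by
    have := S.card_ge; rw [← hndef] at *; linarith
  have hBF : 1 / 2 * n ≤ (B \ F).card := by
    have := card_sdiff_real_ge (A := B) hF; linarith
  have hAF : 3 / 10 * n ≤ (A \ F).card := by
    have := card_sdiff_real_ge (A := A) hF; linarith
  have hk1 : (1 : ℝ) ≤ k := by exact_mod_cast hk
  -- The exact threshold enters here: `|A| ≤ 2n/5 - k` leaves every pair in `B` at least `k`
  -- neighbours in `B`. If all of these lay in `F`, the at most `4 * k` vertices of `F ∩ B` would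
  -- carry order `k * n ^ 2` pairs, against the small bound `hit_le` for each.
  have hedge : ∃ c ∈ B \ F, ∃ d ∈ B \ F, ∃ e ∈ B \ F, G.adj c d e := by
    by_contra! hcon
    set P : Finset (V × V) := ((B \ F) ×ˢ (B \ F)).filter fun p => p.1 ≠ p.2 with hP
    have hPc : 1 / 2 * n * (1 / 2 * n - 1) ≤ P.card := by
      have := card_ext_ge (B \ F) (fun b => (B \ F) \ {b}) P (by
        intro a v; simp only [hP, mem_filter, mem_product, mem_sdiff, mem_singleton]; tauto)
        (k := 1 / 2 * n - 1) (by
          intro b _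
          have := card_sdiff_real_ge (A := B \ F) (B := {b}) (k := 1) (by simp)
          linarith)
      refine le_trans (mul_le_mul_of_nonneg_right hBF ?_) this
      linarith
    set T : Finset ((V × V) × V) := (P ×ˢ (F ∩ B)).filter fun t => G.adj t.1.1 t.1.2 t.2 with hT
    have h1 := card_ext_ge P (fun p => G.nb p.1 p.2 ∩ (F ∩ B)) T (by
      intro a v; simp only [hT, mem_filter, mem_product, mem_inter, mem_nb]; tauto) (k := k) (by
        rintro ⟨b, b'⟩ hb
        simp only [hP, mem_filter, mem_product] at hb
        have hsub : G.nb b b' \ A ⊆ G.nb b b' ∩ (F ∩ B) := by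
          intro v hv
          rw [mem_sdiff] at hv
          have hvB : v ∈ B := by
            have : v ∈ A ∪ B := by rw [S.cover]; exact mem_univ v
            exact (mem_union.1 this).resolve_left hv.2
          refine mem_inter.2 ⟨hv.1, mem_inter.2 ⟨?_, hvB⟩⟩
          by_contra hvF
          exact hcon b hb.1.1 b' hb.1.2 v (mem_sdiff.2 ⟨hvB, hvF⟩) (mem_nb.1 hv.1)
        have h2 := card_sdiff_real_ge (A := G.nb b b') (B := A) le_rfl
        have h3 : ((G.nb b b' \ A).card : ℝ) ≤ (G.nb b b' ∩ (F ∩ B)).card := by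
          exact_mod_cast card_le_card hsub
        have := hδ b b' hb.2
        linarith)
    have h2 := card_ext_le (F ∩ B) (fun f => G.hit B B f) (T.image fun t => (t.2, t.1)) (by
      intro f p hp
      obtain ⟨⟨⟨b, b'⟩, f'⟩, ht, he⟩ := mem_image.1 hp
      simp only [Prod.mk.injEq] at he
      obtain ⟨rfl, rfl⟩ := he
      simp only [hT, hP, mem_filter, mem_product, mem_sdiff] at ht
      exact ⟨ht.1.2, mem_hit.2 ⟨⟨ht.1.1.1.1.1, ht.1.1.1.2.1⟩, rot' ht.2⟩⟩)
      (k := 3 / 10 ^ 5 * n ^ 2) fun f hf => S.hit_le f (mem_inter.1 hf).2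
    rw [card_image_of_injective _ (fun z w h => by
      simp only [Prod.mk.injEq] at h; exact Prod.ext h.2 h.1)] at h2
    have h3 : ((F ∩ B).card : ℝ) ≤ 4 * k := by exact_mod_cast hFB
    have h4 : ((F ∩ B).card : ℝ) * (3 / 10 ^ 5 * n ^ 2) ≤ 4 * k * (3 / 10 ^ 5 * n ^ 2) := by gcongr
    have h5 : 1 / 2 * n * (1 / 2 * n - 1) * k ≤ P.card * k := by gcongr
    have h6 : 1 / 2 * n * (1 / 4 * n) ≤ 1 / 2 * n * (1 / 2 * n - 1) := by gcongr; linarith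
    have h7 : 1 / 2 * n * (1 / 4 * n) * k ≤ 1 / 2 * n * (1 / 2 * n - 1) * k := by gcongr
    have : 0 < n ^ 2 * k := by positivity
    nlinarith
  obtain ⟨c, hc, d, hd, e, he, hcde⟩ := hedge
  set D := (B \ F) \ {e} with hD
  have hDc : 2 / 5 * n ≤ D.card := by
    have := card_sdiff_real_ge (A := B \ F) (B := {e}) (k := 1) (by simp)
    linarith
  rw [mem_sdiff] at hc hd he
  have hDB : D ⊆ B := sdiff_subset.trans sdiff_subset
  obtain ⟨a, ha, b, hb, h1, h2⟩ := exists_adj_adj_of_card_miss_lt (G := G) (S := A \ F)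
    (T := D) (v := c) (w := d) (by
      have e1 := card_le_card (miss_subset (G := G) (sdiff_subset : A \ F ⊆ A) hDB c)
      have e2 := card_le_card (miss_subset (G := G) (sdiff_subset : A \ F ⊆ A) hDB d)
      have e1' := S.miss_le c hc.1
      have e2' := S.miss_le d hd.1
      have e3 : (((G.miss (A \ F) D c).card + (G.miss (A \ F) D d).card : ℕ) : ℝ)
          ≤ 8 / 10 ^ 5 * n ^ 2 := by
        rify at e1 e2; push_cast; linarith
      have e4 : (3 / 10 * n) * (2 / 5 * n) ≤ (((A \ F).card * D.card : ℕ) : ℝ) := by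
        push_cast; gcongr
      have : 0 < n ^ 2 := by positivity
      have e5 : (((G.miss (A \ F) D c).card + (G.miss (A \ F) D d).card : ℕ) : ℝ)
          < (((A \ F).card * D.card : ℕ) : ℝ) := by nlinarith
      exact_mod_cast e5)
  rw [mem_sdiff] at ha
  rw [hD, mem_sdiff, mem_sdiff, mem_singleton] at hb
  have hT : G.IsT a b c d e := ⟨rot h1, rot h2, hcde, fun h => S.notMem_A he.1 (h ▸ ha.1),
    fun h => hb.2 h.symm⟩
  refine ⟨_, ⟨_, _, _, _, _, hT, rfl⟩, ?_, ?_⟩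
  · refine disjoint_left.2 fun w hw => ?_
    simp only [mem_insert, mem_singleton] at hw
    rcases hw with rfl | rfl | rfl | rfl | rfl
    exacts [ha.2, hb.1.2, hc.2, hd.2, he.2]
  · have := hT.card_inter A
    rw [if_pos ha.1, if_neg (S.notMem_A hb.1.1), if_neg (S.notMem_A hc.1),
      if_neg (S.notMem_A hd.1), if_neg (S.notMem_A he.1)] at this
    norm_num at this
    exact_mod_cast this

end Split

end TriGraph

/-! ### Tiling a near-extremal partition. -/

namespace TriGraph

variable {V : Type u} [Fintype V] {G : TriGraph V} {A B E : Finset V}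

namespace Split

theorem card_inter_add (S : G.Split A B E) (R : Finset V) :
    (R ∩ A).card + (R ∩ B).card = R.card := by
  rw [← card_union_of_disjoint (disjoint_of_subset_left inter_subset_right
    (disjoint_of_subset_right inter_subset_right S.disj)), ← inter_union_distrib_left, S.cover,
    inter_univ]

/-- Disjoint generalised triangles whose removal balances the two parts. -/
theorem exists_balancing (S : G.Split A B E)
    (hδ : ∀ x y : V, x ≠ y → 2 / 5 * (Fintype.card V : ℝ) ≤ (G.nb x y).card)
    (hn : (10 : ℝ) ^ 20 ≤ Fintype.card V) (h5 : 5 ∣ Fintype.card V) :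
    ∃ R, G.Til R ∧ (R.card : ℝ) ≤ 5 / 10 ^ 12 * Fintype.card V ∧
      5 * A.card + 2 * R.card = 5 * (R ∩ A).card + 2 * Fintype.card V := by
  obtain ⟨q, hq⟩ := h5
  have hq' : (Fintype.card V : ℝ) = 5 * q := by exact_mod_cast hq
  have hle := S.card_le
  have hge := S.card_ge
  -- A tile with three vertices (one vertex) in `A` lowers (raises) the surplus of `A` over `2/5` of
  -- the remaining vertices by one, so as many tiles are used as that surplus or deficit.
  rcases le_total (2 * q) A.card with h | h
  · obtain ⟨k, hk⟩ := Nat.exists_eq_add_of_le h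
    have hk' : (A.card : ℝ) = 2 * q + k := by exact_mod_cast hk
    have hkn : (k : ℝ) ≤ 1 / 10 ^ 12 * Fintype.card V := by linarith
    obtain ⟨R, hT, hc, hA⟩ := exists_til_greedy (G := G) A 3 k (by
      intro j hj F hFc _
      refine S.exists_tile_three hδ hn ?_
      have h1 : (F.card : ℝ) ≤ 5 * k := by exact_mod_cast (by omega : F.card ≤ 5 * k)
      linarith)
    refine ⟨R, hT, ?_, by omega⟩
    have : (R.card : ℝ) = 5 * k := by exact_mod_cast hc
    linarith
  · obtain ⟨k, hk⟩ := Nat.exists_eq_add_of_le h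
    have hk' : 2 * (q : ℝ) = A.card + k := by exact_mod_cast hk
    have hkn : (k : ℝ) ≤ 1 / 10 ^ 12 * Fintype.card V := by linarith
    obtain ⟨R, hT, hc, hA⟩ := exists_til_greedy (G := G) A 1 k (by
      intro j hj F hFc hFA
      refine S.exists_tile_one hδ hn (k := k) (by omega) (by linarith) ?_ ?_
      · have h1 : (F.card : ℝ) ≤ 5 * k := by exact_mod_cast (by omega : F.card ≤ 5 * k)
        linarith
      · have := S.card_inter_add F
        omega)
    refine ⟨R, hT, ?_, by omega⟩
    have : (R.card : ℝ) = 5 * k := by exact_mod_cast hc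
    linarith

/-- The part of a split that avoids atypical vertices and is balanced can be tiled. -/
theorem til_of_balanced (S : G.Split A B E) {W : Finset V} {m : ℕ} (hm : 100 ≤ m)
    (hA : (W ∩ A).card = 2 * m) (hB : (W ∩ B).card = 3 * m) (hE : ∀ v ∈ W ∩ A, v ∉ E)
    (hn : (Fintype.card V : ℝ) ≤ 6 * m) : G.Til W := by
  obtain ⟨X₀, hX₀, hX₀c⟩ := exists_subset_card_eq (s := W ∩ A) (n := m) (by omega)
  obtain ⟨Y₁, hY₁, hY₁c⟩ := exists_subset_card_eq (s := W ∩ B) (n := m) (by omega)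
  have hsd : ((W ∩ B) \ Y₁).card = 2 * m := by rw [card_sdiff_of_subset hY₁]; omega
  obtain ⟨Y₂, hY₂, hY₂c⟩ := exists_subset_card_eq (s := (W ∩ B) \ Y₁) (n := m) (by omega)
  set X₄ := (W ∩ A) \ X₀ with hX₄
  set Y₃ := ((W ∩ B) \ Y₁) \ Y₂ with hY₃
  have hX₄c : X₄.card = m := by rw [hX₄, card_sdiff_of_subset hX₀]; omega
  have hY₃c : Y₃.card = m := by rw [hY₃, card_sdiff_of_subset hY₂]; omega
  have hX₄' : X₄ ⊆ W ∩ A := sdiff_subset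
  have hY₂' : Y₂ ⊆ W ∩ B := hY₂.trans sdiff_subset
  have hY₃' : Y₃ ⊆ W ∩ B := sdiff_subset.trans sdiff_subset
  have hAB : ∀ {S T : Finset V}, S ⊆ W ∩ A → T ⊆ W ∩ B → Disjoint S T := fun hS hT =>
    disjoint_of_subset_left (hS.trans inter_subset_right)
      (disjoint_of_subset_right (hT.trans inter_subset_right) S.disj)
  -- The roles `a` and `e` go to `A` and the others to `B`, so that each of the three edges has one
  -- vertex in `A` and two in `B`.
  set X : Fin 5 → Finset V := ![X₀, Y₁, Y₂, Y₃, X₄] with hX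
  have hXA : ∀ p : Fin 5, p = 0 ∨ p = 4 → X p ⊆ W ∩ A := by
    rintro p (rfl | rfl)
    exacts [hX₀, hX₄']
  have hXB : ∀ p : Fin 5, p = 1 ∨ p = 2 ∨ p = 3 → X p ⊆ W ∩ B := by
    rintro p (rfl | rfl | rfl)
    exacts [hY₁, hY₂', hY₃']
  set n : ℝ := (Fintype.card V : ℝ) with hndef
  have hn2 : n ^ 2 ≤ 36 * (m : ℝ) ^ 2 := by
    have : n ^ 2 ≤ (6 * (m : ℝ)) ^ 2 := by gcongr
    linarith [show (6 * (m : ℝ)) ^ 2 = 36 * (m : ℝ) ^ 2 by ring]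
  have hT : G.Til (univ.biUnion X) := by
    refine til_of_dense_parts hm X ?_ ?_ ?_
    · intro j
      fin_cases j
      exacts [hX₀c, hY₁c, hY₂c, hY₃c, hX₄c]
    · have d04 : Disjoint X₀ X₄ := disjoint_sdiff
      have d12 : Disjoint Y₁ Y₂ := disjoint_of_subset_right hY₂ disjoint_sdiff
      have d13 : Disjoint Y₁ Y₃ := disjoint_of_subset_right sdiff_subset disjoint_sdiff
      have d23 : Disjoint Y₂ Y₃ := disjoint_sdiff
      have lt : ∀ i j : Fin 5, i < j → Disjoint (X i) (X j) := by
        intro i j hij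
        fin_cases i <;> fin_cases j <;>
          first
          | exact absurd hij (by decide)
          | exact hAB hX₀ hY₁
          | exact hAB hX₀ hY₂'
          | exact hAB hX₀ hY₃'
          | exact d04
          | exact d12
          | exact d13
          | exact d23
          | exact (hAB hX₄' hY₁).symm
          | exact (hAB hX₄' hY₂').symm
          | exact (hAB hX₄' hY₃').symm
      intro i j hij
      rcases lt_or_gt_of_ne hij with h | h
      · exact lt i j h
      · exact (lt j i h).symm
    · intro p q r hpqr
      have hp : p = 0 ∨ p = 4 := by tauto
      have hq : q = 1 ∨ q = 2 ∨ q = 3 := by tauto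
      have hr : r = 1 ∨ r = 2 ∨ r = 3 := by tauto
      have hpA := (hXA p hp).trans inter_subset_right
      have hqB := (hXB q hq).trans inter_subset_right
      have hrB := (hXB r hr).trans inter_subset_right
      have hm2 : (0 : ℝ) ≤ (m : ℝ) ^ 2 := by positivity
      have key : ∀ v ∈ B, ∀ T ⊆ B, ((G.miss (X p) T v).card : ℝ) ≤ 1 / 30 * (m : ℝ) ^ 2 := by
        intro v hv T hT
        have h1 := card_le_card (miss_subset (G := G) hpA hT v)
        have h2 := S.miss_le v hv
        rify at h1
        linarith
      refine ⟨fun v hv => ?_, fun v hv => key v (hqB hv) _ hrB, fun v hv => key v (hrB hv) _ hqB⟩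
      have h1 := card_le_card (miss_subset (G := G) hqB hrB v)
      have h2 := S.typical v (hpA hv) (hE v (hXA p hp hv))
      rify at h1
      linarith
  have e : univ.biUnion X = W := by
    refine subset_antisymm ?_ fun v hv => ?_
    · refine biUnion_subset.2 fun j _ => ?_
      have : (j = 0 ∨ j = 4) ∨ (j = 1 ∨ j = 2 ∨ j = 3) := by revert j; decide
      rcases this with h | h
      · exact (hXA j h).trans inter_subset_left
      · exact (hXB j h).trans inter_subset_left
    · have hvAB : v ∈ A ∪ B := by rw [S.cover]; exact mem_univ v
      have hor : v ∈ X₀ ∨ v ∈ Y₁ ∨ v ∈ Y₂ ∨ v ∈ Y₃ ∨ v ∈ X₄ := by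
        simp only [hX₄, hY₃, mem_sdiff, mem_inter]
        rw [mem_union] at hvAB
        tauto
      rw [mem_biUnion]
      rcases hor with h | h | h | h | h
      exacts [⟨0, mem_univ _, h⟩, ⟨1, mem_univ _, h⟩, ⟨2, mem_univ _, h⟩, ⟨3, mem_univ _, h⟩,
        ⟨4, mem_univ _, h⟩]
  rwa [e] at hT

/-- Balancing comes first; the tiles covering the atypical vertices have two vertices in `A` and
keep the ratio `2 : 3`. What remains is balanced and typical. -/
theorem til_univ (S : G.Split A B E)
    (hδ : ∀ x y : V, x ≠ y → 2 / 5 * (Fintype.card V : ℝ) ≤ (G.nb x y).card)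
    (hn : (10 : ℝ) ^ 20 ≤ Fintype.card V) (h5 : 5 ∣ Fintype.card V) : G.Til univ := by
  obtain ⟨R₁, hT₁, hc₁, hA₁⟩ := S.exists_balancing hδ hn h5
  have hEA : ((E ∩ A).card : ℝ) ≤ 1 / 10 ^ 12 * Fintype.card V :=
    le_trans (by exact_mod_cast card_le_card inter_subset_left) S.card_E
  obtain ⟨R₂, hT₂, hd, hcov, hc₂, hA₂⟩ := exists_til_cover (G := G) A R₁ (E ∩ A) (by
    intro v hv R hvR hRc
    refine S.exists_tile_two hn ?_ (mem_inter.1 hv).2 hvR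
    have h1 : ((R₁ ∪ R).card : ℝ) ≤ R₁.card + R.card := by exact_mod_cast card_union_le R₁ R
    have h2 : (R.card : ℝ) ≤ 5 * (E ∩ A).card := by exact_mod_cast hRc
    linarith)
  have hc₂' : (R₂.card : ℝ) ≤ 5 * (E ∩ A).card := by exact_mod_cast hc₂
  set R := R₁ ∪ R₂ with hR
  have hTR : G.Til R := hT₁.union hT₂ hd.symm
  have hRc : R.card = R₁.card + R₂.card := card_union_of_disjoint hd.symm
  have hRA : (R ∩ A).card = (R₁ ∩ A).card + (R₂ ∩ A).card := by
    rw [hR, union_inter_distrib_right, card_union_of_disjoint (disjoint_of_subset_left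
      inter_subset_left (disjoint_of_subset_right inter_subset_left hd.symm))]
  set W := univ \ R with hW
  have hWc : W.card + R.card = Fintype.card V := by
    rw [hW, card_sdiff_add_card_eq_card (subset_univ R), card_univ]
  have hWA : (W ∩ A).card + (R ∩ A).card = A.card := by
    have e : W ∩ A = A \ R := by
      ext v; simp only [hW, mem_inter, mem_sdiff, mem_univ, true_and]; tauto
    rw [e, inter_comm R A, card_sdiff_add_card_inter]
  have hWB := S.card_inter_add W
  obtain ⟨m, hm⟩ : 5 ∣ W.card := by
    have := hTR.dvd_card
    omega
  have hRn : (R.card : ℝ) ≤ 1 / 10 ^ 11 * Fintype.card V := by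
    have : (R.card : ℝ) = R₁.card + R₂.card := by exact_mod_cast hRc
    linarith
  have hm5 : 5 * (m : ℝ) + R.card = Fintype.card V := by exact_mod_cast hm ▸ hWc
  have hm100 : (100 : ℝ) ≤ m := by linarith
  have hTW := S.til_of_balanced (W := W) (m := m) (by exact_mod_cast hm100) (by omega) (by omega)
    (by
      intro v hv hvE
      rw [mem_inter] at hv
      exact (mem_sdiff.1 hv.1).2 (hcov (mem_inter.2 ⟨hvE, hv.2⟩))) (by linarith)
  have := hTW.union hTR sdiff_disjoint
  rwa [hW, sdiff_union_of_subset (subset_univ R)] at this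

end Split

end TriGraph

/-! ### Finding the partition in the extremal case. -/

namespace TriGraph

variable {V : Type u} {G : TriGraph V}

theorem sum_hit_eq_card_tri (S : Finset V) : ∑ v ∈ S, ((G.hit S S v).card : ℝ) = (G.tri S).card := by
  have := card_ext_eq S (G.hit S S) (G.tri S) (by
    intro a v; simp only [mem_tri, mem_hit]; tauto)
  rw [this]; push_cast; rfl

variable [Fintype V]

theorem card_square_filter_le (P : V × V → Prop) (S T : Finset V) :
    (((S ×ˢ S).filter P).card : ℝ) ≤
      ((T ×ˢ T).filter P).card + 2 * (S \ T).card * Fintype.card V := by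
  have hsub : (S ×ˢ S).filter P ⊆
      (T ×ˢ T).filter P ∪ ((S \ T) ×ˢ univ ∪ univ ×ˢ (S \ T)) := by
    intro p hp
    simp only [mem_filter, mem_product, mem_union, mem_sdiff, mem_univ, and_true, true_and] at hp ⊢
    tauto
  have h := (card_le_card hsub).trans ((card_union_le _ _).trans
    (Nat.add_le_add_left (card_union_le _ _) _))
  rw [card_product, card_product, card_univ] at h
  rify at h
  linarith

theorem card_hit_le_add (S T : Finset V) (v : V) : ((G.hit S S v).card : ℝ) ≤
    (G.hit T T v).card + 2 * (S \ T).card * Fintype.card V :=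
  card_square_filter_le _ S T

theorem card_miss_le_add (S T : Finset V) (v : V) : ((G.miss S S v).card : ℝ) ≤
    (G.miss T T v).card + 2 * (S \ T).card * Fintype.card V := by
  unfold miss
  convert card_square_filter_le (fun p => ¬ G.adj v p.1 p.2) S T

/-- If `S` spans few edges then few pairs in `S` fail to form an edge with a vertex outside. -/
theorem sum_miss_le {N : Finset V}
    (hδ : ∀ x y : V, x ≠ y → 2 / 5 * (Fintype.card V : ℝ) ≤ (G.nb x y).card)
    (hn : (10 : ℝ) ^ 40 ≤ Fintype.card V)
    (hN : (N.card : ℝ) ≤ (2 / 5 + 1 / 10 ^ 32) * Fintype.card V)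
    (htri : ((G.tri (univ \ N)).card : ℝ) ≤ 1 / 10 ^ 32 * (Fintype.card V : ℝ) ^ 3) :
    ∑ v ∈ N, ((G.miss (univ \ N) (univ \ N) v).card : ℝ) ≤
      3 / 10 ^ 32 * (Fintype.card V : ℝ) ^ 3 := by
  set n : ℝ := (Fintype.card V : ℝ) with hndef
  have hn0 : 0 < n := lt_of_lt_of_le (by positivity) hn
  set B := univ \ N with hB
  have hBn : (B.card : ℝ) ≤ n := by rw [hndef]; exact_mod_cast card_le_univ B
  have hB0 : (0 : ℝ) ≤ B.card := Nat.cast_nonneg _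
  set T : Finset ((V × V) × V) := ((B ×ˢ B) ×ˢ univ).filter fun t => G.adj t.1.1 t.1.2 t.2 with hT
  have h1 := card_ext_eq (B ×ˢ B) (fun p => G.nb p.1 p.2) T (by
    intro a v; simp only [hT, mem_filter, mem_product, mem_univ, and_true, mem_nb])
  have h2 := card_ext_eq univ (G.hit B B) (T.image fun t => (t.2, t.1)) (by
    intro v p
    simp only [hT, mem_image, mem_filter, mem_product, mem_univ, and_true, mem_hit, Prod.mk.injEq,
      Prod.exists, true_and]
    constructor
    · rintro ⟨a, b, c, ⟨h, hadj⟩, rfl, rfl⟩; exact ⟨h, rot' hadj⟩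
    · rintro ⟨h, hadj⟩; exact ⟨p.1, p.2, v, ⟨h, rot hadj⟩, rfl, rfl⟩)
  rw [card_image_of_injective _ (fun z w h => by
    simp only [Prod.mk.injEq] at h; exact Prod.ext h.2 h.1)] at h2
  have h3 : ∑ p ∈ B ×ˢ B, (2 / 5 * n - if p.1 = p.2 then 2 / 5 * n else 0) ≤ (T.card : ℝ) := by
    rw [h1]; push_cast
    refine sum_le_sum fun p _ => ?_
    split_ifs with h
    · simp
    · rw [sub_zero]; exact hδ _ _ h
  rw [sum_sub_distrib, sum_const, nsmul_eq_mul, ← sum_filter, sum_const, nsmul_eq_mul,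
    card_product] at h3
  have hdiag : (((B ×ˢ B).filter fun p => p.1 = p.2).card : ℝ) ≤ n := by
    have : ((B ×ˢ B).filter fun p => p.1 = p.2).card ≤ (univ : Finset V).card := by
      refine card_le_card_of_injOn Prod.fst (fun _ _ => mem_coe.2 (mem_univ _)) ?_
      rintro ⟨a, b⟩ h ⟨a', b'⟩ h' he
      simp only [coe_filter, Set.mem_ofPred_eq] at h h' he
      rw [Prod.mk.injEq, ← h.2, ← h'.2]
      exact ⟨he, he⟩
    rw [hndef]; exact_mod_cast this
  push_cast at h3
  have h4 : (T.card : ℝ) = ∑ v ∈ N, ((G.hit B B v).card : ℝ) + (G.tri B).card := by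
    rw [h2, ← sum_hit_eq_card_tri]
    push_cast
    rw [hB, add_comm, sum_sdiff (subset_univ N)]
  have h5 : ∑ v ∈ N, ((G.miss B B v).card : ℝ) =
      N.card * (B.card * B.card) - ∑ v ∈ N, ((G.hit B B v).card : ℝ) := by
    rw [eq_sub_iff_add_eq, ← sum_add_distrib, ← nsmul_eq_mul, ← sum_const]
    refine sum_congr rfl fun v _ => ?_
    rw [add_comm]; exact card_hit_add_card_miss B B v
  have h6 : (N.card : ℝ) * (B.card * B.card) ≤
      (2 / 5 + 1 / 10 ^ 32) * n * (B.card * B.card) := by gcongr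
  have h7 : 1 / 10 ^ 32 * n * ((B.card : ℝ) * B.card) ≤ 1 / 10 ^ 32 * n * (n * n) := by gcongr
  have h8 : (((B ×ˢ B).filter fun p => p.1 = p.2).card : ℝ) * (2 / 5 * n) ≤ n * (2 / 5 * n) := by
    gcongr
  have h9 : n * n ≤ 1 / 10 ^ 32 * n ^ 3 := by
    have : (10 : ℝ) ^ 32 ≤ n := le_trans (by norm_num) hn
    have h10 : n ^ 2 * 10 ^ 32 ≤ n ^ 2 * n := by gcongr
    have h11 : n ^ 2 * n = n ^ 3 := by ring
    rw [h11] at h10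
    have : 1 / 10 ^ 32 * (n ^ 2 * 10 ^ 32) ≤ 1 / 10 ^ 32 * n ^ 3 := by gcongr
    calc n * n = 1 / 10 ^ 32 * (n ^ 2 * 10 ^ 32) := by ring
      _ ≤ _ := this
  have h12 : 3 / 10 ^ 32 * n ^ 3 = 3 * (1 / 10 ^ 32 * n ^ 3) := by ring
  have h13 : 1 / 10 ^ 32 * n * (n * n) = 1 / 10 ^ 32 * n ^ 3 := by ring
  rw [h5, h12]
  have h14 : (2 / 5 + 1 / 10 ^ 32) * n * ((B.card : ℝ) * B.card) =
    (B.card : ℝ) * B.card * (2 / 5 * n) + 1 / 10 ^ 32 * n * ((B.card : ℝ) * B.card) := by ring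
  linarith

-- The neighbourhood `N` is only approximately the right class, so vertices are reassigned by how
-- many pairs of `B₀` they form edges with. Few vertices move: those leaving `N` miss many pairs,
-- contrary to `sum_miss_le`, and those joining it would create too many edges inside `B₀`.
set_option maxHeartbeats 1000000 in
theorem exists_split {N : Finset V}
    (hδ : ∀ x y : V, x ≠ y → 2 / 5 * (Fintype.card V : ℝ) ≤ (G.nb x y).card)
    (hn : (10 : ℝ) ^ 40 ≤ Fintype.card V)
    (hN' : 2 / 5 * (Fintype.card V : ℝ) ≤ N.card)
    (hN : (N.card : ℝ) ≤ (2 / 5 + 1 / 10 ^ 32) * Fintype.card V)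
    (htri : ((G.tri (univ \ N)).card : ℝ) ≤ 1 / 10 ^ 32 * (Fintype.card V : ℝ) ^ 3) :
    ∃ A B E, G.Split A B E := by
  have hM := sum_miss_le hδ hn hN htri
  set n : ℝ := (Fintype.card V : ℝ) with hndef
  have hn0 : 0 < n := lt_of_lt_of_le (by positivity) hn
  have hn6 : (10 : ℝ) ^ 6 ≤ n := le_trans (by norm_num) hn
  set B₀ := univ \ N with hB₀
  have hB₀c : (N.card : ℝ) + B₀.card = n := by
    have := card_sdiff_add_card_eq_card (subset_univ N)
    rw [card_univ, ← hB₀] at this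
    rw [hndef, add_comm]; exact_mod_cast this
  -- The threshold `2 / 10 ^ 5` lies between the bounds `1 / 10 ^ 5` and `3 / 10 ^ 5` of `Split`,
  -- leaving room for passing from `B₀` to `B`.
  set A : Finset V := univ.filter fun v => 2 / 10 ^ 5 * n ^ 2 ≤ (G.hit B₀ B₀ v).card with hA
  set B : Finset V := univ \ A with hB
  have hAmem : ∀ v, v ∈ A ↔ 2 / 10 ^ 5 * n ^ 2 ≤ ((G.hit B₀ B₀ v).card : ℝ) := by
    intro v; simp only [hA, mem_filter, mem_univ, true_and]
  have hBmem : ∀ v, v ∈ B ↔ v ∉ A := by intro v; simp only [hB, mem_sdiff, mem_univ, true_and]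
  have hn2 : 0 < n ^ 2 := by positivity
  have hn3 : 0 < n ^ 3 := by positivity
  have hD1 : ((N \ A).card : ℝ) ≤ 1 / 10 ^ 27 * n := by
    have h1 : ∀ v ∈ N \ A, 3 / 10 * n ^ 2 ≤ ((G.miss B₀ B₀ v).card : ℝ) := by
      intro v hv
      have h2 := card_hit_add_card_miss (G := G) B₀ B₀ v
      have h3 := (hAmem v).not.1 (mem_sdiff.1 hv).2
      push Not at h3
      have h4 : 59 / 100 * n ≤ B₀.card := by linarith
      have h5 : (59 / 100 * n) * (59 / 100 * n) ≤ (B₀.card : ℝ) * B₀.card := by gcongr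
      nlinarith
    have h2 : (N \ A).card * (3 / 10 * n ^ 2) ≤ 3 / 10 ^ 32 * n ^ 3 := by
      refine le_trans ?_ hM
      rw [← nsmul_eq_mul]
      refine (card_nsmul_le_sum _ _ _ h1).trans ?_
      exact sum_le_sum_of_subset_of_nonneg sdiff_subset fun _ _ _ => Nat.cast_nonneg _
    have h3 : n ^ 2 * (3 / 10 * (N \ A).card) ≤ n ^ 2 * (3 / 10 ^ 32 * n) := by
      linarith [show n ^ 2 * (3 / 10 ^ 32 * n) = 3 / 10 ^ 32 * n ^ 3 by ring,
        show n ^ 2 * (3 / 10 * ((N \ A).card : ℝ)) = (N \ A).card * (3 / 10 * n ^ 2) by ring]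
    have h4 := le_of_mul_le_mul_left h3 hn2
    linarith
  have hD2 : ((A \ N).card : ℝ) ≤ 1 / 10 ^ 27 * n := by
    have h1 : ∀ v ∈ A \ N, 2 / 10 ^ 5 * n ^ 2 ≤ ((G.hit B₀ B₀ v).card : ℝ) := fun v hv =>
      (hAmem v).1 (mem_sdiff.1 hv).1
    have h2 : (A \ N).card * (2 / 10 ^ 5 * n ^ 2) ≤ 1 / 10 ^ 32 * n ^ 3 := by
      refine le_trans ?_ htri
      rw [← sum_hit_eq_card_tri, ← nsmul_eq_mul]
      refine (card_nsmul_le_sum _ _ _ h1).trans ?_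
      refine sum_le_sum_of_subset_of_nonneg (fun v hv => ?_) fun _ _ _ => Nat.cast_nonneg _
      exact mem_sdiff.2 ⟨mem_univ v, (mem_sdiff.1 hv).2⟩
    have h3 : n ^ 2 * (2 / 10 ^ 5 * (A \ N).card) ≤ n ^ 2 * (1 / 10 ^ 32 * n) := by
      linarith [show n ^ 2 * (1 / 10 ^ 32 * n) = 1 / 10 ^ 32 * n ^ 3 by ring,
        show n ^ 2 * (2 / 10 ^ 5 * ((A \ N).card : ℝ)) = (A \ N).card * (2 / 10 ^ 5 * n ^ 2) by
          ring]
    have h4 := le_of_mul_le_mul_left h3 hn2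
    linarith
  have hBB₀ : B \ B₀ = N \ A := by
    ext v; simp only [hB, hB₀, mem_sdiff, mem_univ, true_and]; tauto
  have hB₀B : B₀ \ B = A \ N := by
    ext v; simp only [hB, hB₀, mem_sdiff, mem_univ, true_and]; tauto
  have hAle : (A.card : ℝ) ≤ (2 / 5 + 1 / 10 ^ 26) * n := by
    have h1 : A.card ≤ (A \ N).card + N.card := by
      rw [← card_sdiff_add_card_inter A N]
      exact Nat.add_le_add_left (card_le_card inter_subset_right) _
    rify at h1
    linarith
  have hAge : (2 / 5 - 1 / 10 ^ 26) * n ≤ A.card := by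
    have h1 : N.card ≤ (N \ A).card + A.card := by
      rw [← card_sdiff_add_card_inter N A]
      exact Nat.add_le_add_left (card_le_card inter_subset_right) _
    rify at h1
    linarith
  have hABc : (A.card : ℝ) + B.card = n := by
    have := card_sdiff_add_card_eq_card (subset_univ A)
    rw [card_univ, ← hB] at this
    rw [hndef, add_comm]; exact_mod_cast this
  have hD1n : ((N \ A).card : ℝ) * n ≤ 1 / 10 ^ 27 * n * n := by gcongr
  have hD2n : ((A \ N).card : ℝ) * n ≤ 1 / 10 ^ 27 * n * n := by gcongr
  have hhit_le : ∀ v ∈ B, ((G.hit B B v).card : ℝ) ≤ 3 / 10 ^ 5 * n ^ 2 := by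
    intro v hv
    have h1 := card_hit_le_add (G := G) B B₀ v
    rw [hBB₀] at h1
    have h2 := (hAmem v).not.1 ((hBmem v).1 hv)
    push Not at h2
    rw [← hndef] at h1
    linarith [show 1 / 10 ^ 27 * n * n = 1 / 10 ^ 27 * n ^ 2 by ring]
  set E : Finset V := A.filter fun v => 1 / 10 ^ 12 * n ^ 2 < (G.miss B B v).card with hE
  refine ⟨A, B, E, disjoint_sdiff, union_sdiff_of_subset (subset_univ A), ?_, ?_, ?_, hhit_le, ?_,
    ?_, ?_⟩
  · rw [← hndef]; linarith
  · rw [← hndef]; linarith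
  · intro v hv
    have h1 := card_hit_le_add (G := G) B₀ B v
    rw [hB₀B] at h1
    have h2 := (hAmem v).1 hv
    rw [← hndef] at h1 ⊢
    linarith [show 1 / 10 ^ 27 * n * n = 1 / 10 ^ 27 * n ^ 2 by ring]
  · intro v hv
    rw [← hndef]
    have h1 := card_hit_add_card_miss (G := G) A B v
    have h2 := card_ext_eq B (fun b => G.nb v b ∩ A) ((G.hit A B v).image fun p => (p.2, p.1)) (by
      intro b a
      simp only [mem_image, mem_hit, mem_inter, mem_nb, Prod.mk.injEq, Prod.exists]
      constructor
      · rintro ⟨a', b', ⟨⟨h1, h2⟩, h3⟩, rfl, rfl⟩; exact ⟨h2, G.swap23 h3, h1⟩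
      · rintro ⟨h1, h2, h3⟩; exact ⟨a, b, ⟨⟨h3, h1⟩, G.swap23 h2⟩, rfl, rfl⟩)
    rw [card_image_of_injective _ (fun z w h => by
      simp only [Prod.mk.injEq] at h; exact Prod.ext h.2 h.1)] at h2
    have h3 := card_ext_eq B (fun b => G.nb v b ∩ B) (G.hit B B v) (by
      intro b a; simp only [mem_hit, mem_inter, mem_nb]; tauto)
    -- Each pair `vb` has at least `2n/5` neighbours, and since `v ∈ B` few of them lie in `B` on
    -- average; so `v` forms an edge with almost all pairs of `A × B`.
    have h4 : ∑ b ∈ B, (2 / 5 * n - if b = v then 2 / 5 * n else 0) ≤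
        ((G.hit A B v).card : ℝ) + (G.hit B B v).card := by
      rw [h2, h3]
      push_cast
      rw [← sum_add_distrib]
      refine sum_le_sum fun b _ => ?_
      have h5 : (G.nb v b ∩ A).card + (G.nb v b ∩ B).card = (G.nb v b).card := by
        rw [← card_sdiff_add_card_inter (G.nb v b) A, add_comm]
        congr 2
        ext w
        simp only [mem_inter, mem_sdiff, hBmem]
      have h6 : ((G.nb v b ∩ A).card : ℝ) + (G.nb v b ∩ B).card = (G.nb v b).card := by
        exact_mod_cast h5
      rw [h6]
      split_ifs with h
      · simp
      · rw [sub_zero]; exact hδ _ _ (Ne.symm h)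
    rw [sum_sub_distrib, sum_const, nsmul_eq_mul, sum_ite_eq', if_pos hv] at h4
    have h5 := hhit_le v hv
    have h6 : (A.card : ℝ) * B.card ≤ (2 / 5 + 1 / 10 ^ 26) * n * B.card := by gcongr
    have h7 : 1 / 10 ^ 26 * n * (B.card : ℝ) ≤ 1 / 10 ^ 26 * n * n := by
      gcongr; linarith [(Nat.cast_nonneg A.card : (0 : ℝ) ≤ _)]
    have h8 : 10 ^ 6 * n ≤ n * n := by gcongr
    have e1 : (2 / 5 + 1 / 10 ^ 26) * n * (B.card : ℝ) =
      (B.card : ℝ) * (2 / 5 * n) + 1 / 10 ^ 26 * n * B.card := by ring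
    have e2 : n * n = n ^ 2 := by ring
    have e3 : 1 / 10 ^ 26 * n * n = 1 / 10 ^ 26 * n ^ 2 := by ring
    rw [e1] at h6
    rw [e2] at h8
    rw [e3] at h7
    linarith
  · rw [← hndef]
    have h1 : ∀ v ∈ E, 1 / 10 ^ 12 * n ^ 2 ≤ ((G.miss B B v).card : ℝ) := fun v hv =>
      (mem_filter.1 hv).2.le
    have h2 : E.card * (1 / 10 ^ 12 * n ^ 2) ≤ ∑ v ∈ A, ((G.miss B B v).card : ℝ) := by
      rw [← nsmul_eq_mul]
      refine (card_nsmul_le_sum _ _ _ h1).trans ?_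
      exact sum_le_sum_of_subset_of_nonneg (filter_subset _ _) fun _ _ _ => Nat.cast_nonneg _
    have h3 : ∑ v ∈ A, ((G.miss B B v).card : ℝ) ≤
        ∑ v ∈ A, (((G.miss B₀ B₀ v).card : ℝ) + 2 / 10 ^ 27 * n ^ 2) := by
      refine sum_le_sum fun v _ => ?_
      have := card_miss_le_add (G := G) B B₀ v
      rw [hBB₀, ← hndef] at this
      linarith [show 1 / 10 ^ 27 * n * n = 1 / 10 ^ 27 * n ^ 2 by ring]
    rw [sum_add_distrib, sum_const, nsmul_eq_mul] at h3
    have h4 : ∑ v ∈ A, ((G.miss B₀ B₀ v).card : ℝ) ≤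
        ∑ v ∈ N, ((G.miss B₀ B₀ v).card : ℝ) + ∑ v ∈ A \ N, n ^ 2 := by
      rw [← sum_sdiff (inter_subset_left : A ∩ N ⊆ A), sdiff_inter_self_left, add_comm]
      refine add_le_add ?_ (sum_le_sum fun v _ => ?_)
      · exact sum_le_sum_of_subset_of_nonneg inter_subset_right fun _ _ _ => Nat.cast_nonneg _
      · have := card_le_univ (G.miss B₀ B₀ v)
        rw [Fintype.card_prod] at this
        rw [hndef, sq]; exact_mod_cast this
    rw [sum_const, nsmul_eq_mul] at h4
    have h5 : (A.card : ℝ) * (2 / 10 ^ 27 * n ^ 2) ≤ n * (2 / 10 ^ 27 * n ^ 2) := by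
      gcongr; linarith [(Nat.cast_nonneg B.card : (0 : ℝ) ≤ _)]
    have h6 : ((A \ N).card : ℝ) * n ^ 2 ≤ 1 / 10 ^ 27 * n * n ^ 2 := by gcongr
    have h7 : n ^ 2 * (1 / 10 ^ 12 * (E.card : ℝ)) ≤ n ^ 2 * (1 / 10 ^ 24 * n) := by
      have e1 : n ^ 2 * (1 / 10 ^ 12 * (E.card : ℝ)) = E.card * (1 / 10 ^ 12 * n ^ 2) := by ring
      have e2 : n ^ 2 * (1 / 10 ^ 24 * n) = 1 / 10 ^ 24 * n ^ 3 := by ring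
      have e3 : 1 / 10 ^ 27 * n * n ^ 2 = 1 / 10 ^ 27 * n ^ 3 := by ring
      have e4 : n * (2 / 10 ^ 27 * n ^ 2) = 2 / 10 ^ 27 * n ^ 3 := by ring
      rw [e3] at h6
      rw [e4] at h5
      rw [e1, e2]
      linarith
    have h8 := le_of_mul_le_mul_left h7 hn2
    linarith
  · intro v hv hvE
    by_contra hcon
    push Not at hcon
    exact hvE (mem_filter.2 ⟨hv, hcon⟩)

/-- Every large `3`-graph with minimum codegree at least `2n / 5` whose number `n` of vertices is
divisible by five can be tiled by generalised triangles. -/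
theorem exists_til_univ : ∃ N : ℕ, ∀ (V : Type u) [Fintype V] (G : TriGraph V),
    N ≤ Fintype.card V → 5 ∣ Fintype.card V →
    (∀ x y : V, x ≠ y → 2 / 5 * (Fintype.card V : ℝ) ≤ (G.nb x y).card) → G.Til univ := by
  -- With this `ζ` the constant `400 * ζ` equals the tolerance `1 / 10 ^ 32` of `exists_split`, so
  -- the two cases are complementary.
  obtain ⟨N, hN⟩ := exists_til_univ_of_nonextremal.{u} (ζ := 1 / 10 ^ 32 / 400) (by positivity)
    (by norm_num)
  refine ⟨max N (10 ^ 40), fun V _ G hV h5 hδ => ?_⟩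
  have hn : (10 : ℝ) ^ 40 ≤ Fintype.card V := by exact_mod_cast (le_max_right _ _).trans hV
  by_cases hext : ∃ x y : V, x ≠ y ∧
      ((G.nb x y).card : ℝ) < (2 / 5 + 1 / 10 ^ 32) * Fintype.card V ∧
      ((G.tri (univ \ G.nb x y)).card : ℝ) < 1 / 10 ^ 32 * (Fintype.card V : ℝ) ^ 3
  · obtain ⟨x, y, hxy, h1, h2⟩ := hext
    obtain ⟨A, B, E, S⟩ := exists_split hδ hn (hδ x y hxy) h1.le h2.le
    exact S.til_univ hδ (le_trans (by norm_num) hn) h5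
  · push Not at hext
    refine hN V G ((le_max_left _ _).trans hV) h5 hδ fun x y hxy => ?_
    rw [mul_div_cancel₀ _ (by norm_num : (400 : ℝ) ≠ 0)]
    exact or_iff_not_imp_left.2 fun h => hext x y hxy (not_le.1 h)

end TriGraph

/-! ### Transfer to hypergraphs. -/

namespace Hypergraph

variable {α : Type u}

theorem IsUniform.ne {H : Hypergraph α} (hH : H.IsUniform 3) {x y z : α}
    (h : ({x, y, z} : Set α) ∈ H.edgeSet) : x ≠ y := by
  rintro rfl
  have h1 := hH _ h
  rw [Set.insert_eq_of_mem (Set.mem_insert x {z})] at h1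
  have h2 := Set.encard_insert_le {z} x
  rw [h1, Set.encard_singleton] at h2
  exact absurd h2 (by decide)

/-- The adjacency relation of a `3`-uniform hypergraph on the type of its vertices. -/
def toTriGraph (H : Hypergraph α) (hH : H.IsUniform 3) : TriGraph H.vertexSet where
  adj x y z := ({x.1, y.1, z.1} : Set α) ∈ H.edgeSet
  swap12 {x y z} h := by rwa [Set.insert_comm]
  swap23 {x y z} h := by rwa [Set.pair_comm]
  ne12 {x y z} h := fun he => hH.ne h (congrArg Subtype.val he)

theorem exists_eq_of_encard_three {e : Set α} (he : e.encard = 3) {x y : α} (hxy : x ≠ y)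
    (h : ({x, y} : Set α) ⊆ e) : ∃ z, z ≠ x ∧ z ≠ y ∧ e = {x, y, z} := by
  have h1 := Set.encard_sdiff_add_encard_of_subset h
  rw [Set.encard_pair hxy, he] at h1
  have h2 : (e \ {x, y}).encard = 1 := by
    have : (e \ {x, y}).encard + 2 = 1 + 2 := by rw [h1]; rfl
    exact WithTop.add_right_cancel (by decide) this
  obtain ⟨z, hz⟩ := Set.encard_eq_one.1 h2
  have hz' : z ∈ e \ {x, y} := by rw [hz]; rfl
  simp only [Set.mem_sdiff, Set.mem_insert_iff, Set.mem_singleton_iff, not_or] at hz'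
  refine ⟨z, hz'.2.1, hz'.2.2, ?_⟩
  rw [← Set.sdiff_union_of_subset h, hz]
  ext w; simp only [Set.mem_union, Set.mem_insert_iff, Set.mem_singleton_iff]; tauto

theorem minCodegree_le_deg {H : Hypergraph α} {x y : α} (hx : x ∈ H.vertexSet)
    (hy : y ∈ H.vertexSet) (hxy : x ≠ y) : H.minCodegree 3 ≤ H.deg {x, y} := by
  refine Nat.sInf_le ⟨{x, y}, ?_, ?_, rfl⟩
  · exact Set.insert_subset hx (Set.singleton_subset_iff.2 hy)
  · rw [Set.encard_pair hxy]; rfl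

theorem deg_le_card_nb {H : Hypergraph α} [Fintype H.vertexSet]
    (hH : H.IsUniform 3) {x y : H.vertexSet} (hxy : x ≠ y) :
    H.deg {x.1, y.1} ≤ ((H.toTriGraph hH).nb x y).card := by
  have hsub : {e ∈ H.edgeSet | ({x.1, y.1} : Set α) ⊆ e} ⊆
      (fun z : H.vertexSet => ({x.1, y.1, z.1} : Set α)) ''
        (((H.toTriGraph hH).nb x y : Finset H.vertexSet) : Set H.vertexSet) := by
    rintro e ⟨he, hxe⟩
    obtain ⟨z, -, -, rfl⟩ := exists_eq_of_encard_three (hH e he)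
      (fun h => hxy (Subtype.ext h)) hxe
    have hz : z ∈ H.vertexSet := subset_vertexSet_of_mem_edgeSet he (by simp)
    exact ⟨⟨z, hz⟩, mem_coe.2 (TriGraph.mem_nb.2 he), rfl⟩
  refine (Set.ncard_le_ncard hsub ((finite_toSet _).image _)).trans ?_
  refine (Set.ncard_image_le (finite_toSet _)).trans ?_
  rw [Set.ncard_coe_finset]

/-- A tileable vertex set yields a perfect tiling. -/
theorem exists_isPerfectTiling_of_til {H : Hypergraph α} [Fintype H.vertexSet]
    (hH : H.IsUniform 3) (hT : (H.toTriGraph hH).Til univ) :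
    ∃ 𝒯 : Set (Hypergraph α), IsPerfectTiling genTriangle H 𝒯 := by
  obtain ⟨Q, hQT, hQd, -, hQ⟩ := hT.exists_partition
  have hcopy : ∀ X ∈ Q, ∃ C : Hypergraph α, IsCopy genTriangle H C ∧
      C.vertexSet = Subtype.val '' (X : Set H.vertexSet) := by
    intro X hX
    obtain ⟨a, b, c, d, e, h, hXe⟩ := hQT X hX
    have hmem : ∀ v, v ∈ X ↔ v = a ∨ v = b ∨ v = c ∨ v = d ∨ v = e := by
      intro v; rw [hXe]; simp only [mem_insert, mem_singleton]
    have hrange : ∀ v, (∃ i, ![a.1, b.1, c.1, d.1, e.1] i = v) ↔ ∃ w ∈ X, w.1 = v := by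
      intro v
      simp only [hmem, Fin.exists_fin_succ, exists_eq_or_imp, exists_eq_left]
      simp
    set φ : Fin 5 → α := ![a.1, b.1, c.1, d.1, e.1] with hφ
    have hinj : Function.Injective φ := by
      have e1 : (univ.image φ).card = 5 := by
        have : univ.image φ = X.image Subtype.val := by
          ext v
          simp only [mem_image, mem_univ, true_and, hrange]
        rw [this, card_image_of_injective _ Subtype.val_injective, (hQT X hX).card]
      rw [← Set.injOn_univ, ← coe_univ]
      exact card_image_iff.1 (by rw [e1]; simp)
    have hV : (genTriangle.image φ).vertexSet = Subtype.val '' (X : Set H.vertexSet) := by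
      ext v
      simp only [genTriangle, image_vertexSet, Set.image_univ, Set.mem_range, hrange,
        Set.mem_image, mem_coe]
    refine ⟨genTriangle.image φ, ⟨?_, ?_, φ, hinj.injOn, rfl⟩, hV⟩
    · rw [hV]
      rintro _ ⟨v, -, rfl⟩
      exact v.2
    · rintro _ ⟨f, hf, rfl⟩
      simp only [genTriangle, Set.mem_insert_iff, Set.mem_singleton_iff] at hf
      rcases hf with rfl | rfl | rfl
      · have : φ '' {0, 1, 2} = {a.1, b.1, c.1} := by
          simp [Set.image_insert_eq, hφ]
        rw [this]; exact h.1
      · have : φ '' {0, 1, 3} = {a.1, b.1, d.1} := by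
          simp [Set.image_insert_eq, hφ]
        rw [this]; exact h.2.1
      · have : φ '' {2, 3, 4} = {c.1, d.1, e.1} := by
          simp [Set.image_insert_eq, hφ]
        rw [this]; exact h.2.2.1
  choose! C hC hCV using hcopy
  refine ⟨C '' (Q : Set (Finset H.vertexSet)), ⟨?_, ?_⟩, ?_⟩
  · rintro _ ⟨X, hX, rfl⟩
    exact hC X hX
  · rintro _ ⟨X, hX, rfl⟩ _ ⟨Y, hY, rfl⟩ hne
    rw [hCV X hX, hCV Y hY, Set.disjoint_image_iff Subtype.val_injective]
    exact disjoint_coe.2 (hQd X hX Y hY fun h => hne (by rw [h]))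
  · intro v hv
    obtain ⟨X, hX, hvX⟩ := hQ ⟨v, hv⟩ (mem_univ _)
    refine ⟨C X, ⟨X, hX, rfl⟩, ?_⟩
    rw [hCV X hX]
    exact ⟨⟨v, hv⟩, hvX, rfl⟩

theorem exists_isPerfectTiling : ∃ n₀ : ℕ, ∀ n : ℕ, n₀ ≤ n → 5 ∣ n →
    ∀ (α : Type u) (H : Hypergraph α), H.vertexSet.encard = n → H.IsUniform 3 →
      (2 * n / 5 : ℝ) ≤ H.minCodegree 3 →
        ∃ 𝒯 : Set (Hypergraph α), IsPerfectTiling genTriangle H 𝒯 := by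
  obtain ⟨N, hN⟩ := TriGraph.exists_til_univ.{u}
  refine ⟨N, fun n hn h5 α H hc hH hδ => ?_⟩
  have : Fintype H.vertexSet := (Set.finite_of_encard_eq_coe hc).fintype
  have hcard : Fintype.card H.vertexSet = n := by
    rw [Set.encard_eq_coe_toFinset_card, Set.toFinset_card] at hc
    exact_mod_cast hc
  refine exists_isPerfectTiling_of_til hH (hN _ _ (by rwa [hcard]) (by rwa [hcard]) ?_)
  intro x y hxy
  have h1 := (minCodegree_le_deg x.2 y.2 fun h => hxy (Subtype.ext h)).trans (deg_le_card_nb hH hxy)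
  rw [hcard]
  have h2 : (H.minCodegree 3 : ℝ) ≤ ((H.toTriGraph hH).nb x y).card := by exact_mod_cast h1
  linarith

/-! ### The extremal example. -/

section Extremal

variable {A B : Set α}

theorem isUniform_extremal (A B : Set α) : (extremal A B).IsUniform 3 := fun _ he => he.2.1

theorem deg_extremal {x y : α} (hx : x ∈ A ∪ B) (hy : y ∈ A ∪ B) (hxy : x ≠ y) :
    (extremal A B).deg {x, y} =
      {z ∈ (A ∪ B) \ {x, y} | (({x, y, z} : Set α) ∩ A).Nonempty}.ncard := by
  have e : {e ∈ (extremal A B).edgeSet | ({x, y} : Set α) ⊆ e} =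
      (fun z => ({x, y, z} : Set α)) ''
        {z ∈ (A ∪ B) \ {x, y} | (({x, y, z} : Set α) ∩ A).Nonempty} := by
    ext e
    constructor
    · rintro ⟨⟨he1, he2, he3⟩, hxe⟩
      obtain ⟨z, hzx, hzy, rfl⟩ := exists_eq_of_encard_three he2 hxy hxe
      exact ⟨z, ⟨⟨he1 (by simp), by simp [hzx, hzy]⟩, he3⟩, rfl⟩
    · rintro ⟨z, ⟨⟨hz, hzn⟩, hne⟩, rfl⟩
      simp only [Set.mem_insert_iff, Set.mem_singleton_iff, not_or] at hzn
      refine ⟨⟨?_, ?_, hne⟩, ?_⟩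
      · rintro w (rfl | rfl | rfl) <;> assumption
      · exact Set.encard_eq_three.2 ⟨x, y, z, hxy, Ne.symm hzn.1, Ne.symm hzn.2, rfl⟩
      · rintro w (rfl | rfl) <;> simp
  rw [deg, e, Set.InjOn.ncard_image]
  rintro z ⟨⟨-, hz⟩, -⟩ w ⟨⟨-, hw⟩, -⟩ h
  simp only [Set.mem_insert_iff, Set.mem_singleton_iff, not_or] at hz hw
  have : z ∈ ({x, y, w} : Set α) := by
    have h' : ({x, y, z} : Set α) = {x, y, w} := h
    rw [← h']; simp
  simp only [Set.mem_insert_iff, Set.mem_singleton_iff] at this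
  tauto

/-- A pair inside `B` is completed only by the vertices of `A`. A pair meeting `A` is completed by
any further vertex, in particular by at least `|B| - 2 ≥ 2 * q - 1` vertices of `B`. -/
theorem minCodegree_extremal (hAB : Disjoint A B) {q : ℕ} (hq : 0 < q) (hA : A.ncard = 2 * q - 1)
    (hB : B.ncard = 3 * q + 1) (hAf : A.Finite) (hBf : B.Finite) :
    (extremal A B).minCodegree 3 = 2 * q - 1 := by
  refine le_antisymm ?_ ?_
  · obtain ⟨x, hx, y, hy, hxy⟩ := (Set.one_lt_ncard hBf).1 (by omega : 1 < B.ncard)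
    refine (minCodegree_le_deg (H := extremal A B) (Or.inr hx) (Or.inr hy) hxy).trans ?_
    rw [deg_extremal (Or.inr hx) (Or.inr hy) hxy, ← hA]
    refine Set.ncard_le_ncard ?_ hAf
    rintro z ⟨-, w, (rfl | rfl | rfl), hw⟩
    · exact absurd hx (Set.disjoint_left.1 hAB hw)
    · exact absurd hy (Set.disjoint_left.1 hAB hw)
    · exact hw
  · obtain ⟨x₀, hx₀, y₀, hy₀, hxy₀⟩ := (Set.one_lt_ncard hBf).1 (by omega : 1 < B.ncard)
    -- A pair in `B` witnesses that the set of degrees is nonempty; the infimum of the empty set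
    -- would default to zero.
    refine le_csInf ⟨_, {x₀, y₀}, ?_, ?_, rfl⟩ ?_
    · exact Set.insert_subset (Or.inr hx₀) (Set.singleton_subset_iff.2 (Or.inr hy₀))
    · rw [Set.encard_pair hxy₀]; rfl
    rintro _ ⟨f, hf, hfc, rfl⟩
    have hf2 : f.encard = 2 := by
      have : f.encard + 1 = 2 + 1 := by rw [hfc]; rfl
      exact WithTop.add_right_cancel ENat.one_ne_top this
    obtain ⟨x, y, hxy, rfl⟩ := Set.encard_eq_two.1 hf2
    have hx : x ∈ A ∪ B := hf (by simp)
    have hy : y ∈ A ∪ B := hf (by simp)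
    rw [deg_extremal hx hy hxy]
    have hfin : {z ∈ (A ∪ B) \ {x, y} | (({x, y, z} : Set α) ∩ A).Nonempty}.Finite :=
      ((hAf.union hBf).sdiff).subset fun z hz => hz.1
    by_cases hfA : x ∈ A ∨ y ∈ A
    · have h1 : B \ {x, y} ⊆ {z ∈ (A ∪ B) \ {x, y} | (({x, y, z} : Set α) ∩ A).Nonempty} := by
        rintro z ⟨hz, hzn⟩
        refine ⟨⟨Or.inr hz, hzn⟩, ?_⟩
        rcases hfA with h | h
        · exact ⟨x, by simp, h⟩
        · exact ⟨y, by simp, h⟩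
      have h2 := Set.ncard_le_ncard h1 hfin
      have h3 := Set.le_ncard_sdiff {x, y} B
      rw [Set.ncard_pair hxy] at h3
      omega
    · push Not at hfA
      rw [← hA]
      refine Set.ncard_le_ncard (fun z hz => ⟨⟨Or.inl hz, ?_⟩, z, by simp, hz⟩) hfin
      rintro (rfl | rfl)
      exacts [hfA.1 hz, hfA.2 hz]

/-- Every copy of the generalised triangle has two vertices in `A`. -/
theorem exists_two_of_isCopy {C : Hypergraph α} (hC : IsCopy genTriangle (extremal A B) C) :
    ∃ φ : Fin 5 → α, Function.Injective φ ∧ C.vertexSet = Set.range φ ∧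
      ∃ i j, i ≠ j ∧ φ i ∈ A ∧ φ j ∈ A := by
  obtain ⟨-, hE, φ, hφ, rfl⟩ := hC
  refine ⟨φ, fun i j h => hφ (Set.mem_univ _) (Set.mem_univ _) h, by simp [genTriangle], ?_⟩
  have edge : ∀ i j k : Fin 5, ({i, j, k} : Set (Fin 5)) ∈ genTriangle.edgeSet →
      φ i ∈ A ∨ φ j ∈ A ∨ φ k ∈ A := by
    intro i j k h
    obtain ⟨-, -, v, ⟨w, hw, rfl⟩, hv⟩ := hE (image_mem_edgeSet_image (f := φ) h)
    rcases hw with rfl | rfl | rfl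
    exacts [Or.inl hv, Or.inr (Or.inl hv), Or.inr (Or.inr hv)]
  have h1 := edge 0 1 2 (by simp [genTriangle])
  have h2 := edge 0 1 3 (by simp [genTriangle])
  have h3 := edge 2 3 4 (by simp [genTriangle])
  -- If `0` or `1` is sent to `A`, the disjoint edge `234` supplies a second vertex; otherwise the
  -- edges `012` and `013` send both `2` and `3` to `A`.
  by_cases h : φ 0 ∈ A ∨ φ 1 ∈ A
  · rcases h with h | h <;> rcases h3 with h' | h' | h'
    exacts [⟨0, 2, by decide, h, h'⟩, ⟨0, 3, by decide, h, h'⟩, ⟨0, 4, by decide, h, h'⟩,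
      ⟨1, 2, by decide, h, h'⟩, ⟨1, 3, by decide, h, h'⟩, ⟨1, 4, by decide, h, h'⟩]
  · exact ⟨2, 3, by decide, by tauto, by tauto⟩

/-- A perfect tiling of `5 * q` vertices has `q` members, which need `2 * q` vertices of `A`, one
more than there are. -/
theorem not_isPerfectTiling_extremal (hAB : Disjoint A B) {q : ℕ} (hq : 0 < q)
    (hA : A.ncard = 2 * q - 1) (hB : B.ncard = 3 * q + 1) (hAf : A.Finite) (hBf : B.Finite)
    (𝒯 : Set (Hypergraph α)) : ¬ IsPerfectTiling genTriangle (extremal A B) 𝒯 := by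
  rintro ⟨⟨hcopy, hdis⟩, hcov⟩
  have hVf : (A ∪ B).Finite := hAf.union hBf
  have h𝒯 : 𝒯.Finite := by
    refine Set.Finite.of_finite_image (f := Hypergraph.vertexSet)
      (hVf.finite_subsets.subset ?_) ?_
    · rintro _ ⟨C, hC, rfl⟩
      exact (hcopy C hC).1
    · intro C hC D hD h
      by_contra hne
      have h1 : Disjoint C.vertexSet D.vertexSet := hdis hC hD hne
      have h2 : C.vertexSet = D.vertexSet := h
      obtain ⟨φ, -, hφ, -⟩ := exists_two_of_isCopy (hcopy C hC)
      rw [← h2, disjoint_self, hφ] at h1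
      exact (Set.range_nonempty φ).ne_empty h1
  set F := h𝒯.toFinset with hF
  have hFmem : ∀ {C}, C ∈ F ↔ C ∈ 𝒯 := by simp [hF]
  set U := hVf.toFinset with hU
  set S : Hypergraph α → Finset α := fun C => U.filter fun v => v ∈ C.vertexSet with hS
  have hSim : ∀ C ∈ F, ∃ φ : Fin 5 → α, Function.Injective φ ∧ S C = univ.image φ ∧
      ∃ i j, i ≠ j ∧ φ i ∈ A ∧ φ j ∈ A := by
    intro C hC
    have hC' := hcopy C (hFmem.1 hC)
    obtain ⟨φ, h1, h2, h3⟩ := exists_two_of_isCopy hC'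
    refine ⟨φ, h1, ?_, h3⟩
    ext v
    have hsub : v ∈ C.vertexSet → v ∈ A ∪ B := fun h => hC'.1 h
    simp only [hS, hU, mem_filter, Set.Finite.mem_toFinset, mem_image, mem_univ, true_and]
    rw [h2] at hsub ⊢
    exact ⟨fun h => h.2, fun h => ⟨hsub h, h⟩⟩
  have hSd : ∀ C ∈ F, ∀ D ∈ F, C ≠ D → Disjoint (S C) (S D) := by
    intro C hC D hD hne
    refine disjoint_left.2 fun v hv hv' => ?_
    exact Set.disjoint_left.1 (hdis (hFmem.1 hC) (hFmem.1 hD) hne) (mem_filter.1 hv).2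
      (mem_filter.1 hv').2
  have hSU : F.biUnion S = U := by
    ext v
    simp only [mem_biUnion, hS, mem_filter]
    constructor
    · rintro ⟨C, -, h, -⟩; exact h
    · intro h
      obtain ⟨C, hC, hv⟩ := hcov v (hVf.mem_toFinset.1 h)
      exact ⟨C, hFmem.2 hC, h, hv⟩
  have hUc : U.card = 5 * q := by
    rw [hU, ← Set.ncard_eq_toFinset_card _ hVf, Set.ncard_union_eq hAB hAf hBf, hA, hB]
    omega
  have h5 : U.card = F.card * 5 := by
    rw [← hSU, card_biUnion hSd, sum_const_nat]
    intro C hC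
    obtain ⟨φ, h1, h2, -⟩ := hSim C hC
    rw [h2, card_image_of_injective _ h1, card_univ, Fintype.card_fin]
  have h2 : F.card * 2 ≤ A.ncard := by
    have e : (F.biUnion fun C => (S C).filter fun v => v ∈ A) ⊆ hAf.toFinset := by
      intro v hv
      obtain ⟨C, -, hv⟩ := mem_biUnion.1 hv
      simpa using (mem_filter.1 hv).2
    rw [Set.ncard_eq_toFinset_card _ hAf]
    refine le_trans ?_ (card_le_card e)
    rw [card_biUnion fun C hC D hD hne => disjoint_of_subset_left (filter_subset _ _)
      (disjoint_of_subset_right (filter_subset _ _) (hSd C hC D hD hne)), ← smul_eq_mul]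
    refine card_nsmul_le_sum _ _ _ fun C hC => ?_
    obtain ⟨φ, h1, h2, i, j, hij, hi, hj⟩ := hSim C hC
    refine one_lt_card.2 ⟨φ i, ?_, φ j, ?_, fun h => hij (h1 h)⟩
    · exact mem_filter.2 ⟨h2 ▸ mem_image_of_mem φ (mem_univ i), hi⟩
    · exact mem_filter.2 ⟨h2 ▸ mem_image_of_mem φ (mem_univ j), hj⟩
  omega

end Extremal

end Hypergraph

theorem theorem1p1 :
    (∃ n₀ : ℕ, ∀ n : ℕ, n₀ ≤ n → 5 ∣ n →
      ∀ (α : Type*) (H : Hypergraph α), H.vertexSet.encard = n → H.IsUniform 3 →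
        (2 * n / 5 : ℝ) ≤ H.minCodegree 3 →
          ∃ 𝒯 : Set (Hypergraph α), Hypergraph.IsPerfectTiling Hypergraph.genTriangle H 𝒯) ∧
    (∀ n : ℕ, 0 < n → 5 ∣ n → ∀ (α : Type*) (A B : Set α), Disjoint A B →
      A.encard = (2 * n / 5 - 1 : ℕ) → B.encard = (3 * n / 5 + 1 : ℕ) →
        (Hypergraph.extremal A B).vertexSet.encard = n ∧
        (Hypergraph.extremal A B).IsUniform 3 ∧
        ((Hypergraph.extremal A B).minCodegree 3 : ℝ) = 2 * n / 5 - 1 ∧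
        ¬ ∃ 𝒯 : Set (Hypergraph α), Hypergraph.IsPerfectTiling Hypergraph.genTriangle
            (Hypergraph.extremal A B) 𝒯) := by
  refine ⟨Hypergraph.exists_isPerfectTiling, fun n hn h5 α A B hAB hA hB => ?_⟩
  obtain ⟨q, rfl⟩ := h5
  have hAf := Set.finite_of_encard_eq_coe hA
  have hBf := Set.finite_of_encard_eq_coe hB
  have hA' : A.ncard = 2 * q - 1 := by
    rw [Set.ncard_def, hA, ENat.toNat_natCast]; omega
  have hB' : B.ncard = 3 * q + 1 := by
    rw [Set.ncard_def, hB, ENat.toNat_natCast]; omega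
  refine ⟨?_, Hypergraph.isUniform_extremal A B, ?_, ?_⟩
  · change (A ∪ B).encard = _
    rw [Set.encard_union_eq hAB, hA, hB, ← Nat.cast_add]
    congr 1
    omega
  · rw [Hypergraph.minCodegree_extremal hAB (by omega) hA' hB' hAf hBf, Nat.cast_sub (by omega)]
    push_cast
    ring
  · rintro ⟨𝒯, h𝒯⟩
    exact Hypergraph.not_isPerfectTiling_extremal hAB (by omega) hA' hB' hAf hBf 𝒯 h𝒯
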